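/- \textbf{Theorem 2.} There are absolute constants $\kappa$ and $C$ such that the following holds. Let $G$ be a directed graph with $n$ nodes and $m$ arcs (parallel arcs and loops are allowed, and an undirected edge is a pair of opposite arcs), whose arc weights are integers in $\{0,\dots,U\}$. Let $s$ be a node of $G$, let $0<\epsilon\le 2$ be real, and let $b\ge\kappa\log_2(n+m+U+2)$ be an integer. Run Dijkstra's algorithm from $s$ on a RAM with $b$-bit words, zero-initialized memory and unit-cost arithmetic, shift, bitwise, most-significant-bit, comparison and memory operations. It is given $U$, $b$, the adjacency lists of $G$, the node $s$, and $\epsilon$ as a fixed-point number rounded down to a multiple of $2^{-b}$. Its priority queue is the approximate van Emde Boas structure with multiplicative error $1+\epsilon/(2n)$, described below. Then for every node $v$ at distance $d$ from $s$ the algorithm outputs an integer $d'$ with $d\le d'\le(1+\epsilon)\,d$, for every node that cannot be reached from $s$ it reports that there is no path, and it takes at most $$C\,(n+m)\,\log_2\!\Bigl(2+\frac{\log_2(2n/\epsilon)}{\log_2\log_2(U+4)}\Bigr)$$ steps. Here Dijkstra's algorithm scans every node at most once: it repeatedly removes the node that the queue returns as its minimum, and relaxes the arcs from that node to nodes that have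 not been scanned. The queue works with the images of the tentative distances under a fixed map, $0\mapsto 0$ and $x\mapsto 1+2^k\ell+y$ for $x\ge1$, where $\ell=\lfloor\log_2x\rfloor$, $y$ consists of the $k$ bits of $x$ after its most significant bit, and $k$ is such that $2^{-k}\le\epsilon/(2n)$ or the map is injective on $\{0,\dots,nU\}$. Equal images share a bucket. The set of images is kept in an ordered list and in a recursive van Emde Boas structure over universes of sizes $B^{2^j}$, $B=2^{\lfloor\log_2 b\rfloor}$, in which universes of size $B$ are represented by bit vectors in one word. -/

import Mathlib

namespace ApproxVEB

/-! ### Graphs and distances -/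

/-- A weighted directed graph on the nodes `0, …, n-1`, given by adjacency lists: `adj v` lists the
arcs that leave `v`, as pairs (head, weight). Parallel arcs and loops are allowed; an undirected
edge is a pair of opposite arcs. -/
structure WGraph (n : ℕ) where
  adj : Fin n → List (Fin n × ℕ)

namespace WGraph

variable {n : ℕ} (G : WGraph n)

/-- All arcs that leave one of the first `i` nodes, in the order of their tails. -/
def arcsUpTo (i : ℕ) : List (Fin n × ℕ) :=
  ((List.finRange n).take i).flatMap G.adj

/-- The number of arcs. -/
def numArcs : ℕ := (G.arcsUpTo n).length

/-- All arc weights lie in `{0, …, U}`. -/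
def WeightsLE (U : ℕ) : Prop := ∀ v, ∀ a ∈ G.adj v, a.2 ≤ U

/-- `G.Walk s v l`: there is a walk from `s` to `v` of total weight `l`. -/
inductive Walk (s : Fin n) : Fin n → ℕ → Prop
  | nil : Walk s s 0
  | snoc {v w : Fin n} {l c : ℕ} : Walk s v l → (w, c) ∈ G.adj v → Walk s w (l + c)

/-- `d` is the shortest-path distance from `s` to `v`. -/
def IsDist (s v : Fin n) (d : ℕ) : Prop := IsLeast {l | G.Walk s v l} d

end WGraph

/-! ### The word RAM

A computation of a RAM with `b`-bit words maps a memory to a result, a new memory and the number of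
unit-cost steps. Programs are put together from the instructions below only; all intermediate values
are results of instructions or small constants, hence words. Every arithmetic, bitwise, comparison or memory
instruction costs one step, and so do a procedure call and a loop iteration (`tick`). -/

/-- Computations on a RAM with `b`-bit words. -/
def RAM (_b : ℕ) (α : Type) : Type := (ℕ → ℕ) → α × (ℕ → ℕ) × ℕ

namespace RAM

variable {b : ℕ}

instance : Monad (RAM b) where
  pure a := fun μ => (a, μ, 0)
  bind p f := fun μ =>
    let r := p μ
    let r' := f r.1 r.2.1
    (r'.1, r'.2.1, r.2.2 + r'.2.2)

/-- The memory after running `p` on the memory `μ`. -/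
def memory {α : Type} (p : RAM b α) (μ : ℕ → ℕ) : ℕ → ℕ := (p μ).2.1

/-- The number of steps of `p` on the memory `μ`. -/
def time {α : Type} (p : RAM b α) (μ : ℕ → ℕ) : ℕ := (p μ).2.2

/-- One step whose outcome is a given value. -/
def unit {α : Type} (a : α) : RAM b α := fun μ => (a, μ, 1)

def tick : RAM b Unit := unit ()

def load (a : ℕ) : RAM b ℕ := fun μ => (μ a, μ, 1)
def store (a v : ℕ) : RAM b Unit := fun μ => ((), Function.update μ a v, 1)

def add (x y : ℕ) : RAM b ℕ := unit ((x + y) % 2 ^ b)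
/-- Subtraction, truncated at `0`. -/
def sub (x y : ℕ) : RAM b ℕ := unit (x - y)
def mul (x y : ℕ) : RAM b ℕ := unit ((x * y) % 2 ^ b)
def shl (x y : ℕ) : RAM b ℕ := unit ((x <<< y) % 2 ^ b)
def shr (x y : ℕ) : RAM b ℕ := unit (x >>> y)
def band (x y : ℕ) : RAM b ℕ := unit (x &&& y)
def bxor (x y : ℕ) : RAM b ℕ := unit (x ^^^ y)
/-- The index of the most significant `1`-bit (`0` for the word `0`). -/
def msb (x : ℕ) : RAM b ℕ := unit (Nat.log 2 x)
def eq (x y : ℕ) : RAM b Bool := unit (decide (x = y))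
def lt (x y : ℕ) : RAM b Bool := unit (decide (x < y))

end RAM

open RAM

/-- The registers of the program. They hold word-size parameters and the base addresses of
the arrays; they are set once. -/
structure Regs where
  /-- number of nodes -/
  n : ℕ
  /-- address of the offsets of the adjacency lists -/
  off : ℕ
  /-- address of the array of arc heads -/
  tgt : ℕ
  /-- address of the array of arc weights -/
  wt : ℕ
  /-- address of the tentative distances (`0`: no distance yet, `d + 1`: distance `d`) -/
  dist : ℕ
  /-- address of the array of scan marks -/
  done : ℕ
  /-- address of the mapped keys of the queued nodes -/
  key : ℕ
  /-- addresses of the links of the bucket lists -/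
  onext : ℕ
  oprev : ℕ
  /-- precision of the approximation map -/
  prec : ℕ
  /-- universes of size `2 ^ beta ≤ b` are handled by bit vectors -/
  beta : ℕ
  /-- address of the table of instance sizes -/
  szTab : ℕ
  /-- recursion level of the top instance -/
  level : ℕ
  /-- address of the dictionary that maps an element to its bucket -/
  dict : ℕ
  /-- addresses of the links of the ordered list of elements -/
  bnext : ℕ
  bprev : ℕ
  /-- address of the top instance -/
  root : ℕ

variable {b : ℕ}

/-! ### The recursive exact van Emde Boas structure

An instance of level `j` stores a set `S` of numbers below `2 ^ (beta * 2 ^ j)`. Elements are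
encoded as `x + 1`, and `0` means nil. An instance at address `a` has
* `a`, `a + 1`: the smallest and the largest element of `S`, or nil if `S` is empty;
* at level `0`, in `a + 2`: the bit vector of `S`, a single word;
* at level `j + 1`: the instance `T` of level `j` at `a + 2` and, for each `k`, the instance `S_k`
  of level `j` at `a + 2 + (k + 1) * size_j`. If `S` has at least two elements, then `S_k` holds the
  lower halves of the elements of `S` with upper half `k`, and `T` holds the `k` with `S_k ≠ ∅`.
  If `S` has at most one element, then `T` and all `S_k` are empty. -/

/-- Upper half of an element of an instance of level `j + 1`. -/
def hi (R : Regs) (j x : ℕ) : RAM b ℕ := do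
  shr x (← shl R.beta j)

/-- The number with upper half `k` and lower half `r` (an encoded `r` gives an encoded result). -/
def join (R : Regs) (j k r : ℕ) : RAM b ℕ := do
  add (← shl k (← shl R.beta j)) r

/-- Lower half of an element of an instance of level `j + 1`. -/
def lo (R : Regs) (j x : ℕ) : RAM b ℕ := do
  sub x (← join R j (← hi R j x) 0)

/-- Address of `S_k` in the instance of level `j + 1` at address `a`. -/
def sub_k (R : Regs) (j a k : ℕ) : RAM b ℕ := do
  let sz ← load (← add R.szTab j)
  add (← add a 2) (← mul (← add k 1) sz)

/-- Replace the bit vector of the instance of level `0` at address `a` by `w`. -/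
def setBits (a w : ℕ) : RAM b Unit := do
  store (← add a 2) w
  if ← eq w 0 then
    store a 0
    store (← add a 1) 0
  else
    store a (← add (← msb (← bxor w (← sub w 1))) 1)
    store (← add a 1) (← add (← msb w) 1)

/-- Encoded largest element `≤ i`, or nil. -/
def vebSearch (R : Regs) : ℕ → ℕ → ℕ → RAM b ℕ
  | 0, a, i => do
    tick
    let mn ← load a
    let mx ← load (← add a 1)
    let e ← add i 1
    if ← eq mn 0 then pure 0
    else if ← lt e mn then pure 0
    else if ← lt e mx then
      let w ← load (← add a 2)
      let mask ← sub (← shl 1 e) 1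
      add (← msb (← band w mask)) 1
    else pure mx
  | j + 1, a, i => do
    tick
    let mn ← load a
    let mx ← load (← add a 1)
    let e ← add i 1
    if ← eq mn 0 then pure 0
    else if ← lt e mn then pure 0
    else if ← lt e mx then
      let k ← hi R j i
      let r ← lo R j i
      let c ← sub_k R j a k
      let m ← load c
      -- does `S_k` have no element `≤ r`?
      let skip ← if ← eq m 0 then pure true else lt (← add r 1) m
      if skip then
        let k' ← sub (← vebSearch R j (← add a 2) (← sub k 1)) 1
        join R j k' (← load (← add (← sub_k R j a k') 1))
      else
        join R j k (← vebSearch R j c r)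
    else pure mx

/-- Insert `x`, which is not yet in the set. -/
def vebInsert (R : Regs) : ℕ → ℕ → ℕ → RAM b Unit
  | 0, a, x => do
    tick
    setBits a (← bxor (← load (← add a 2)) (← shl 1 x))
  | j + 1, a, x => do
    tick
    let mn ← load a
    let mx ← load (← add a 1)
    let e ← add x 1
    if ← eq mn 0 then
      store a e
      store (← add a 1) e
    else
      -- a one-element set gets its recursive structures now
      if ← eq mn mx then
        let y ← sub mn 1
        let k ← hi R j y
        vebInsert R j (← sub_k R j a k) (← lo R j y)
        vebInsert R j (← add a 2) k
      let k ← hi R j x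
      let c ← sub_k R j a k
      if ← eq (← load c) 0 then
        vebInsert R j (← add a 2) k
      vebInsert R j c (← lo R j x)
      if ← lt e mn then store a e
      if ← lt mx e then store (← add a 1) e

/-- Delete `x`, which is in the set. -/
def vebDelete (R : Regs) : ℕ → ℕ → ℕ → RAM b Unit
  | 0, a, x => do
    tick
    setBits a (← bxor (← load (← add a 2)) (← shl 1 x))
  | j + 1, a, x => do
    tick
    let mn ← load a
    let mx ← load (← add a 1)
    if ← eq mn mx then
      store a 0
      store (← add a 1) 0
    else
      let t ← add a 2
      let k ← hi R j x
      let c ← sub_k R j a k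
      vebDelete R j c (← lo R j x)
      if ← eq (← load c) 0 then
        vebDelete R j t k
      let k₁ ← sub (← load t) 1
      let c₁ ← sub_k R j a k₁
      let m₁ ← load c₁
      let mn' ← join R j k₁ m₁
      let k₂ ← sub (← load (← add t 1)) 1
      let mx' ← join R j k₂ (← load (← add (← sub_k R j a k₂) 1))
      store a mn'
      store (← add a 1) mx'
      -- a set that shrinks to one element gives up its recursive structures
      if ← eq mn' mx' then
        vebDelete R j c₁ (← sub m₁ 1)
        vebDelete R j t k₁

/-! ### The approximate structure

The multiset of (distance, node) pairs is kept through the images of the distances under a fixed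
map. Pairs with the same image `u` form a bucket, a doubly linked list of nodes; the name of a pair
is its node. The dictionary maps `u` to the first node of its bucket. The `u` with a non-empty
bucket are kept in an exact structure and in an ordered doubly linked list, which is circular with
sentinel `0`. Nodes and elements are encoded by adding `1`, and `0` means nil. -/

/-- The map of the approximate structure: `0 ↦ 0`, and a positive `x` with most significant bit `l`
is mapped to `1 + l * 2 ^ prec + y`, where `y` consists of the `prec` bits of `x` after that bit.
Two positive numbers with the same image differ by a factor less than `1 + 2 ^ (-prec)`. -/
def approxMap (R : Regs) (x : ℕ) : RAM b ℕ := do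
  if ← eq x 0 then pure 0
  else
    let l ← msb x
    let z ← if ← lt l R.prec then shl x (← sub R.prec l) else shr x (← sub l R.prec)
    let y ← sub z (← shl 1 R.prec)
    add (← add (← shl l R.prec) y) 1

/-- Insert the node `v` with distance `x`. -/
def insert (R : Regs) (x v : ℕ) : RAM b Unit := do
  tick
  let u ← approxMap R x
  let e ← add u 1
  let f ← add v 1
  store (← add R.key v) u
  let h ← load (← add R.dict u)
  if ← eq h 0 then
    let p ← vebSearch R R.level R.root u
    let q ← load (← add R.bnext p)
    store (← add R.bnext e) q
    store (← add R.bprev e) p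
    store (← add R.bnext p) e
    store (← add R.bprev q) e
    vebInsert R R.level R.root u
  else
    store (← add R.oprev h) f
  store (← add R.onext f) h
  store (← add R.oprev f) 0
  store (← add R.dict u) f

/-- Delete the node `v`. -/
def delete (R : Regs) (v : ℕ) : RAM b Unit := do
  tick
  let u ← load (← add R.key v)
  let e ← add u 1
  let f ← add v 1
  let q ← load (← add R.onext f)
  let p ← load (← add R.oprev f)
  if ← eq q 0 then pure ()
  else store (← add R.oprev q) p
  if ← eq p 0 then
    store (← add R.dict u) q
    if ← eq q 0 then
      let q' ← load (← add R.bnext e)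
      let p' ← load (← add R.bprev e)
      store (← add R.bnext p') q'
      store (← add R.bprev q') p'
      vebDelete R R.level R.root u
  else store (← add R.onext p) q

/-- The encoded first node of the first bucket, or nil if the structure is empty. -/
def minimum (R : Regs) : RAM b ℕ := do
  tick
  let e ← load R.bnext
  if ← eq e 0 then pure 0
  else load (← add R.dict (← sub e 1))

/-! ### Dijkstra's algorithm -/

/-- Process an arc with head `w` and weight `c` whose tail has tentative distance `d`. -/
def relax (R : Regs) (d w c : ℕ) : RAM b Unit := do
  tick
  if ← eq (← load (← add R.done w)) 0 then
    let x ← add d c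
    let x' ← add x 1
    let old ← load (← add R.dist w)
    if ← eq old 0 then
      store (← add R.dist w) x'
      insert R x w
    else if ← lt x' old then
      delete R w
      store (← add R.dist w) x'
      insert R x w

/-- Process `cnt` arcs, starting with arc number `i`, whose tail has tentative distance `d`. -/
def scan (R : Regs) (d : ℕ) : ℕ → ℕ → RAM b Unit
  | 0, _ => tick
  | cnt + 1, i => do
    tick
    relax R d (← load (← add R.tgt i)) (← load (← add R.wt i))
    scan R d cnt (← add i 1)

/-- Scan the nodes one by one, at most `cnt` of them: as long as the queue is not empty, remove
its minimum, mark it as scanned and process the arcs that leave it. -/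
def mainLoop (R : Regs) : ℕ → RAM b Unit
  | 0 => tick
  | cnt + 1 => do
    tick
    let f ← minimum R
    if ← eq f 0 then pure ()
    else
      let v ← sub f 1
      delete R v
      store (← add R.done v) 1
      let d ← sub (← load (← add R.dist v)) 1
      let i ← load (← add R.off v)
      let i' ← load (← add (← add R.off v) 1)
      scan R d (← sub i' i) i
      mainLoop R cnt

/-- Find the least level `≥ j` whose universe has at least `nb`-bit numbers, and store the sizes of
the instances of all levels up to it, where `sz` is the size at level `j` (`cnt` bounds the number
of iterations). -/
def mkLevels (beta szTab nb : ℕ) : ℕ → ℕ → ℕ → RAM b ℕ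
  | 0, j, _ => do
    tick
    pure j
  | cnt + 1, j, sz => do
    tick
    store (← add szTab j) sz
    let width ← shl beta j
    if ← lt width nb then
      let sz' ← add (← mul (← add (← shl 1 width) 1) sz) 2
      mkLevels beta szTab nb cnt (← add j 1) sz'
    else pure j

/-- The precision for error `ε / (2 n)`, where `ε` is given as `e₀ + e₁ / 2 ^ b`, rounded down: a
number `p` with `2 ^ (-p) ≤ ε / (2 n)` that exceeds `⌈log₂ (2 n / ε)⌉` by at most two. (If `ε` is
less than `2 ^ (-b)`, then `p` is at least `b`, which makes the map injective on words.) -/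
def precision (n wb e₀ e₁ : ℕ) : RAM b ℕ := do
  let p ← add (← msb n) 2
  if ← eq e₀ 0 then add p (← sub wb (← msb e₁)) else pure p

/-- Read the parameters and lay out the memory. -/
def setup : RAM b Regs := do
  let n ← load 0
  let m ← load 1
  let U ← load 3
  let wb ← load 4
  let e₀ ← load 5
  let e₁ ← load 6
  -- the elements are integers at most `n * U`, whose highest bit has index `l`
  let l ← msb (← mul n U)
  let l' ← add l 1
  let p ← precision n wb e₀ e₁
  -- with precision `l'`, the map is injective on the elements, so more is never needed
  let prec ← if ← lt p l' then pure p else pure l'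
  -- the images of the elements are less than `N < 2 ^ nb`
  let N ← add (← shl l' prec) 1
  let nb ← add (← msb N) 1
  let beta ← msb wb
  let off := 7
  let tgt ← add n 8
  let wt ← add tgt m
  let dist ← add wt m
  let done ← add dist n
  let key ← add done n
  let onext ← add key n
  let oprev ← add onext (← add n 1)
  let szTab ← add oprev (← add n 1)
  let dict ← add szTab nb
  let bnext ← add dict N
  let bprev ← add bnext (← add N 1)
  let root ← add bprev (← add N 1)
  let level ← mkLevels beta szTab nb nb 0 3
  pure (Regs.mk n off tgt wt dist done key onext oprev
    prec beta szTab level dict bnext bprev root)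

/-- Dijkstra's algorithm with the approximate structure as its priority queue. -/
def dijkstra (b : ℕ) : RAM b Unit := do
  let R ← setup
  let s ← load 2
  store (← add R.dist s) 1
  insert R 0 s
  mainLoop R R.n

/-! ### Input and output -/

/-- The input: the numbers of nodes and arcs, the source, the weight bound, the word size, the two
words of `ε` (integer part, and fractional part rounded down to a multiple of `2 ^ (-b)`), the
offsets of the adjacency lists, the heads of the arcs and their weights. -/
noncomputable def inputWords {n : ℕ} (G : WGraph n) (s : Fin n) (U b : ℕ) (ε : ℝ) : List ℕ :=
  [n, G.numArcs, s, U, b, ⌊ε⌋₊, ⌊Int.fract ε * 2 ^ b⌋₊]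
    ++ (List.range (n + 1)).map (fun i => (G.arcsUpTo i).length)
    ++ (G.arcsUpTo n).map (fun a => (a.1 : ℕ))
    ++ (G.arcsUpTo n).map (fun a => a.2)

/-- The initial memory: the input words from address `0` on, and `0` elsewhere. -/
noncomputable def inputMemory {n : ℕ} (G : WGraph n) (s : Fin n) (U b : ℕ) (ε : ℝ) : ℕ → ℕ :=
  fun a => (inputWords G s U b ε).getD a 0

/-- The output word for the node `v`: `0` if no distance was found, `d + 1` for the distance `d`. -/
def outputWord {n : ℕ} (G : WGraph n) (v : Fin n) (μ : ℕ → ℕ) : ℕ :=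
  μ (n + 8 + G.numArcs + G.numArcs + v)

end ApproxVEB

/-!
The program is verified in the style of Hoare logic: `wp p μ t Q` says that `p`, started on the
memory `μ`, ends with a result, a memory and a number of steps that satisfy `Q`.

*The exact structure.* `Rep β j a S μ` says that the memory `μ` holds at address `a` an instance
of level `j` for the set `S`. The recursive instances of a set with at least two elements store
its upper halves and, for each upper half, the lower halves; those of a smaller set are empty. So
insertion into an empty set and deletion from a one-element set take constant time. When an
operation makes recursive calls both for the summary and for a subinstance `S_k`, then `S_k` is
empty before the insertion, or after the deletion, so that one of the two calls is trivial. Hence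
all operations take `O(level + 1)` steps (`wp_vebSearch`, `insertSpec`, `deleteSpec`).

*The queue.* `QInv` says that the memory represents a queue of nodes with given mapped keys: the
buckets are linked lists (`Buckets`), the nonempty ones form an ordered list (`OList`), and the
exact structure finds the place of a new element in that list. `minimum` returns a node whose
mapped key is minimal; as the map is monotone up to a factor `1 + ε / (2 n)` (`le_of_amap_le`,
`approx_factor`), its tentative distance is minimal up to that factor.

*Dijkstra's algorithm.* The invariant `DInv` says that tentative distances are lengths of walks,
and that the distance of a scanned node exceeds the length `l` of any walk to it at most by the
factor `(1 + ε / (2 n)) ^ k`, where `k` is the number of scanned nodes. It survives a scan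
(`DInv.mark_min`): a walk to the removed node `v` leaves the scanned set through an arc that has
been relaxed, so some queued node has tentative distance at most `(1 + ε / (2 n)) ^ k * l`
(`DInv.exists_frontier`), and `v` is at most one factor worse. Finally
`(1 + ε / (2 n)) ^ n ≤ exp (ε / 2) ≤ 1 + ε` for `ε ≤ 2` (`pow_factor_le`).

*Running time.* Every arc is relaxed at most once, so `O(n + m)` queue operations of
`O(level + 1)` steps are made. Images have at most `log₂ b + prec + O(1)` bits with
`prec ≤ log₂ (2 n / ε) + 2`, and level `j` handles `⌊log₂ b⌋ * 2 ^ j` bits, so the least sufficient level is logarithmic in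
`2 + log₂ (2 n / ε) / log₂ b`, where `b ≥ log₂ (U + 4)` (`level_le`).
-/

namespace ApproxVEB

open RAM

/-! ### Reasoning about RAM programs -/

/-- `wp p μ t Q`: after running `p` on the memory `μ`, with `t` steps already on the clock, the
result, the final memory and the clock satisfy `Q`. -/
def wp {b : ℕ} {α : Type} (p : RAM b α) (μ : ℕ → ℕ) (t : ℕ) (Q : α → (ℕ → ℕ) → ℕ → Prop) : Prop :=
  Q (p μ).1 (p μ).2.1 (t + (p μ).2.2)

section Rules

variable {b : ℕ} {α β : Type}

theorem wp_mono {p : RAM b α} {μ : ℕ → ℕ} {t : ℕ} {Q Q' : α → (ℕ → ℕ) → ℕ → Prop}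
    (h : wp p μ 0 Q) (hQ : ∀ a μ' t', Q a μ' t' → Q' a μ' (t + t')) : wp p μ t Q' := by
  have := hQ _ _ _ h
  simpa [wp] using this

theorem wp_bind (p : RAM b α) (f : α → RAM b β) (μ : ℕ → ℕ) (t : ℕ)
    (Q : β → (ℕ → ℕ) → ℕ → Prop) :
    wp (p >>= f) μ t Q = wp p μ t (fun a μ' t' => wp (f a) μ' t' Q) := by
  simp [wp, bind, Nat.add_assoc]

theorem wp_call {p : RAM b α} {f : α → RAM b β} {μ : ℕ → ℕ} {t : ℕ}
    {Q : α → (ℕ → ℕ) → ℕ → Prop} {Q' : β → (ℕ → ℕ) → ℕ → Prop}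
    (h : wp p μ 0 Q) (hQ : ∀ a μ' t', Q a μ' t' → wp (f a) μ' (t + t') Q') :
    wp (p >>= f) μ t Q' := by
  rw [wp_bind]
  exact wp_mono h hQ

/-- The rules for the single instructions and for control flow, in the two forms "last instruction"
and "instruction followed by a continuation". They have the absence of overflow as a side
condition. -/
theorem exec (μ : ℕ → ℕ) (t : ℕ) :
    (∀ (α β γ : Type) (p : RAM b α) (g : α → RAM b β) (f : β → RAM b γ) Q,
      wp ((p >>= g) >>= f) μ t Q = wp (p >>= fun a => g a >>= f) μ t Q) ∧
    (∀ (α : Type) (a : α) Q, wp (pure a : RAM b α) μ t Q = Q a μ t) ∧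
    (∀ (α β : Type) (a : α) (f : α → RAM b β) Q, wp (pure a >>= f) μ t Q = wp (f a) μ t Q) ∧
    (∀ Q, wp (tick : RAM b Unit) μ t Q = Q () μ (t + 1)) ∧
    (∀ (β : Type) (f : Unit → RAM b β) Q, wp (tick >>= f) μ t Q = wp (f ()) μ (t + 1) Q) ∧
    (∀ a Q, wp (load a : RAM b ℕ) μ t Q = Q (μ a) μ (t + 1)) ∧
    (∀ (β : Type) a (f : ℕ → RAM b β) Q, wp (load a >>= f) μ t Q = wp (f (μ a)) μ (t + 1) Q) ∧
    (∀ a v Q, wp (store a v : RAM b Unit) μ t Q = Q () (Function.update μ a v) (t + 1)) ∧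
    (∀ (β : Type) a v (f : Unit → RAM b β) Q,
      wp (store a v >>= f) μ t Q = wp (f ()) (Function.update μ a v) (t + 1) Q) ∧
    (∀ x y Q, x + y < 2 ^ b → wp (add x y : RAM b ℕ) μ t Q = Q (x + y) μ (t + 1)) ∧
    (∀ (β : Type) x y (f : ℕ → RAM b β) Q, x + y < 2 ^ b →
      wp (add x y >>= f) μ t Q = wp (f (x + y)) μ (t + 1) Q) ∧
    (∀ x y Q, wp (sub x y : RAM b ℕ) μ t Q = Q (x - y) μ (t + 1)) ∧
    (∀ (β : Type) x y (f : ℕ → RAM b β) Q, wp (sub x y >>= f) μ t Q = wp (f (x - y)) μ (t + 1) Q) ∧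
    (∀ (β : Type) x y (f : ℕ → RAM b β) Q, x * y < 2 ^ b →
      wp (mul x y >>= f) μ t Q = wp (f (x * y)) μ (t + 1) Q) ∧
    (∀ x y Q, x * 2 ^ y < 2 ^ b → wp (shl x y : RAM b ℕ) μ t Q = Q (x * 2 ^ y) μ (t + 1)) ∧
    (∀ (β : Type) x y (f : ℕ → RAM b β) Q, x * 2 ^ y < 2 ^ b →
      wp (shl x y >>= f) μ t Q = wp (f (x * 2 ^ y)) μ (t + 1) Q) ∧
    (∀ x y Q, wp (shr x y : RAM b ℕ) μ t Q = Q (x / 2 ^ y) μ (t + 1)) ∧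
    (∀ (β : Type) x y (f : ℕ → RAM b β) Q,
      wp (shr x y >>= f) μ t Q = wp (f (x / 2 ^ y)) μ (t + 1) Q) ∧
    (∀ (β : Type) x y (f : ℕ → RAM b β) Q,
      wp (band x y >>= f) μ t Q = wp (f (x &&& y)) μ (t + 1) Q) ∧
    (∀ (β : Type) x y (f : ℕ → RAM b β) Q,
      wp (bxor x y >>= f) μ t Q = wp (f (x ^^^ y)) μ (t + 1) Q) ∧
    (∀ (β : Type) x (f : ℕ → RAM b β) Q,
      wp (msb x >>= f) μ t Q = wp (f (Nat.log 2 x)) μ (t + 1) Q) ∧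
    (∀ (β : Type) x y (f : Bool → RAM b β) Q,
      wp (RAM.eq x y >>= f) μ t Q = wp (f (decide (x = y))) μ (t + 1) Q) ∧
    (∀ (β : Type) x y (f : Bool → RAM b β) Q,
      wp (RAM.lt x y >>= f) μ t Q = wp (f (decide (x < y))) μ (t + 1) Q) := by
  refine ⟨?_, ?_, ?_, ?_, ?_, ?_, ?_, ?_, ?_, ?_, ?_, ?_, ?_, ?_, ?_, ?_, ?_, ?_, ?_, ?_, ?_, ?_,
    ?_⟩
  all_goals intros
  all_goals
    simp +contextual [wp, bind, pure, tick, load, store, add, sub, mul, shl, shr, band, bxor, msb,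
      RAM.eq, RAM.lt, RAM.unit, Nat.add_assoc, Nat.mod_eq_of_lt, Nat.shiftLeft_eq,
      Nat.shiftRight_eq_div_pow, *]

theorem wp_ite {c : Prop} [Decidable c] {p q : RAM b α} {μ : ℕ → ℕ} {t : ℕ}
    {Q : α → (ℕ → ℕ) → ℕ → Prop} (h1 : c → wp p μ t Q) (h2 : ¬c → wp q μ t Q) :
    wp (if decide c = true then p else q) μ t Q := by
  by_cases h : c
  · simpa [h] using h1 h
  · simpa [h] using h2 h

end Rules

/-! ### Universes and instance sizes -/

/-- The size of the universe of level `j`. -/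
def uni (β j : ℕ) : ℕ := 2 ^ (β * 2 ^ j)

/-- The number of memory cells of an instance of level `j`. -/
def vsz (β : ℕ) : ℕ → ℕ
  | 0 => 3
  | j + 1 => (uni β j + 1) * vsz β j + 2

theorem uni_pos (β j : ℕ) : 0 < uni β j := by unfold uni; positivity

theorem uni_succ (β j : ℕ) : uni β (j + 1) = uni β j * uni β j := by
  unfold uni; rw [← pow_add]; congr 1; ring

theorem width_lt_uni (β j : ℕ) : β * 2 ^ j < uni β j := Nat.lt_two_pow_self

theorem uni_le_succ (β j : ℕ) : uni β j ≤ uni β (j + 1) := by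
  rw [uni_succ]; exact Nat.le_mul_of_pos_left _ (uni_pos β j)

theorem vsz_ge (β j : ℕ) : 3 ≤ vsz β j := by
  induction j with
  | zero => simp [vsz]
  | succ j ih => simp only [vsz]; nlinarith [uni_pos β j]

/-- The end of the `k`-th subinstance is inside the instance. -/
theorem sub_end_le {β j k : ℕ} (hk : k < uni β j) :
    2 + (k + 1) * vsz β j + vsz β j ≤ vsz β (j + 1) := by
  simp only [vsz]
  nlinarith [vsz_ge β j]

theorem head_end_le (β j : ℕ) : 2 + vsz β j + vsz β j ≤ vsz β (j + 1) := by
  have := sub_end_le (uni_pos β j)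
  simpa using this

theorem sub_disj (s : ℕ) {k k' : ℕ} (h : k ≠ k') :
    (k + 1) * s + s ≤ (k' + 1) * s ∨ (k' + 1) * s + s ≤ (k + 1) * s := by
  rcases Nat.lt_or_gt_of_ne h with h | h
  · left; nlinarith [Nat.mul_le_mul_right s h]
  · right; nlinarith [Nat.mul_le_mul_right s h]

/-! ### Encoded minima and maxima -/

/-- `m` encodes the least element of `S`: it is that element plus one, or `0` if `S = ∅`. -/
def MinEnc (S : Set ℕ) (m : ℕ) : Prop := (S = ∅ ∧ m = 0) ∨ ∃ x, IsLeast S x ∧ m = x + 1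

/-- `m` encodes the greatest element of `S`: it is that element plus one, or `0` if `S = ∅`. -/
def MaxEnc (S : Set ℕ) (m : ℕ) : Prop := (S = ∅ ∧ m = 0) ∨ ∃ x, IsGreatest S x ∧ m = x + 1

theorem MinEnc.eq_zero_iff {S : Set ℕ} {m : ℕ} (h : MinEnc S m) : m = 0 ↔ S = ∅ := by
  rcases h with ⟨h, rfl⟩ | ⟨x, h, rfl⟩
  · simp [h]
  · simpa using (Set.nonempty_iff_ne_empty.1 ⟨x, h.1⟩)

theorem MaxEnc.eq_zero_iff {S : Set ℕ} {m : ℕ} (h : MaxEnc S m) : m = 0 ↔ S = ∅ := by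
  rcases h with ⟨h, rfl⟩ | ⟨x, h, rfl⟩
  · simp [h]
  · simpa using (Set.nonempty_iff_ne_empty.1 ⟨x, h.1⟩)

theorem MinEnc.of_ne {S : Set ℕ} {m : ℕ} (h : MinEnc S m) (hm : m ≠ 0) :
    ∃ x, IsLeast S x ∧ m = x + 1 := by
  rcases h with ⟨_, h⟩ | h
  · exact absurd h hm
  · exact h

theorem MaxEnc.of_ne {S : Set ℕ} {m : ℕ} (h : MaxEnc S m) (hm : m ≠ 0) :
    ∃ x, IsGreatest S x ∧ m = x + 1 := by
  rcases h with ⟨_, h⟩ | h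
  · exact absurd h hm
  · exact h

theorem minEnc_empty : MinEnc ∅ 0 := Or.inl ⟨rfl, rfl⟩
theorem maxEnc_empty : MaxEnc ∅ 0 := Or.inl ⟨rfl, rfl⟩
theorem minEnc_singleton (x : ℕ) : MinEnc {x} (x + 1) := Or.inr ⟨x, isLeast_singleton, rfl⟩
theorem maxEnc_singleton (x : ℕ) : MaxEnc {x} (x + 1) := Or.inr ⟨x, isGreatest_singleton, rfl⟩

/-! ### Bit vectors -/

/-- The most significant bit of a nonzero bit vector is its greatest element. -/
theorem isGreatest_log {w : ℕ} (hw : w ≠ 0) :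
    IsGreatest {i | w.testBit i = true} (Nat.log 2 w) := by
  constructor
  · have := Nat.testBit_log2 hw
    rwa [Nat.log2_eq_log_two] at this
  · intro i hi
    have := Nat.ge_two_pow_of_testBit hi
    exact Nat.le_log_of_pow_le (by norm_num) this

/-- `w ^^^ (w - 1)` consists of the lowest bit of `w` and all bits below it. -/
theorem isLeast_log_xor {w : ℕ} (hw : w ≠ 0) :
    IsLeast {i | w.testBit i = true} (Nat.log 2 (w ^^^ (w - 1))) := by
  obtain ⟨i, q, hq, rfl⟩ := Nat.exists_eq_two_pow_mul_odd hw
  obtain ⟨r, rfl⟩ := hq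
  have e1 : 2 ^ i * (2 * r + 1) - 1 = 2 ^ (i + 1) * r + (2 ^ i - 1) := by
    have : 0 < 2 ^ i := by positivity
    have : 2 ^ i * (2 * r + 1) = 2 ^ (i + 1) * r + 2 ^ i := by ring
    omega
  have e0 : 2 ^ i * (2 * r + 1) = 2 ^ (i + 1) * r + 2 ^ i := by ring
  have hlt : 2 ^ i < 2 ^ (i + 1) := Nat.pow_lt_pow_right (by norm_num) (by omega)
  have hx : 2 ^ i * (2 * r + 1) ^^^ (2 ^ i * (2 * r + 1) - 1) = 2 ^ (i + 1) - 1 := by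
    rw [e1, e0]
    apply Nat.eq_of_testBit_eq
    intro k
    rw [Nat.testBit_xor, Nat.testBit_two_pow_mul_add _ hlt,
      Nat.testBit_two_pow_mul_add _ (by omega), Nat.testBit_two_pow_sub_one,
      Nat.testBit_two_pow, Nat.testBit_two_pow_sub_one]
    by_cases hk : k < i + 1
    · simp only [hk, if_true, decide_true]
      by_cases h2 : i = k
      · simp [h2]
      · have : k < i := by omega
        simp [h2, this]
    · simp [hk]
  rw [hx]
  have hlog : Nat.log 2 (2 ^ (i + 1) - 1) = i := by
    rw [Nat.log_eq_iff (by right; constructor <;> omega)]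
    constructor
    · rw [pow_succ]; have : 0 < 2 ^ i := by positivity
      omega
    · have : 0 < 2 ^ (i + 1) := by positivity
      omega
  rw [hlog]
  constructor
  · simp only [Set.mem_ofPred_eq]
    rw [e0, Nat.testBit_two_pow_mul_add _ hlt]
    simp
  · intro k hk
    by_contra hlt'
    push Not at hlt'
    simp only [Set.mem_ofPred_eq] at hk
    rw [e0, Nat.testBit_two_pow_mul_add _ hlt, if_pos (by omega), Nat.testBit_two_pow] at hk
    simp at hk
    omega

/-! ### The representation of sets by instances -/

/-- The set that the recursive structures of an instance for `S` store: `S` if it has at least two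
elements, and `∅` otherwise. -/
def core (S : Set ℕ) : Set ℕ := {x | x ∈ S ∧ S.Nontrivial}

/-- The upper halves of the elements of `P`. -/
def his (u : ℕ) (P : Set ℕ) : Set ℕ := {k | ∃ x ∈ P, x / u = k}

/-- The lower halves of the elements of `P` with upper half `k`. -/
def los (u k : ℕ) (P : Set ℕ) : Set ℕ := {r | r < u ∧ k * u + r ∈ P}

/-- The instance of level `j` at address `a` represents the set `S`. -/
def Rep (β : ℕ) : ℕ → ℕ → Set ℕ → (ℕ → ℕ) → Prop
  | 0, a, S, μ => MinEnc S (μ a) ∧ MaxEnc S (μ (a + 1)) ∧ (∀ x ∈ S, x < uni β 0) ∧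
      ∀ i, (μ (a + 2)).testBit i = true ↔ i ∈ S
  | j + 1, a, S, μ => MinEnc S (μ a) ∧ MaxEnc S (μ (a + 1)) ∧ (∀ x ∈ S, x < uni β (j + 1)) ∧
      Rep β j (a + 2) (his (uni β j) (core S)) μ ∧
      ∀ k < uni β j, Rep β j (a + 2 + (k + 1) * vsz β j) (los (uni β j) k (core S)) μ

/-- The recursive structures of the instance of level `j + 1` at address `a` represent `P`. -/
def StrRep (β j a : ℕ) (P : Set ℕ) (μ : ℕ → ℕ) : Prop :=
  Rep β j (a + 2) (his (uni β j) P) μ ∧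
    ∀ k < uni β j, Rep β j (a + 2 + (k + 1) * vsz β j) (los (uni β j) k P) μ

/-- `μ'` agrees with `μ` outside the addresses from `lo` to `hi - 1`. -/
def Frame (lo hi : ℕ) (μ μ' : ℕ → ℕ) : Prop := ∀ i, i < lo ∨ hi ≤ i → μ' i = μ i

/-- An instance of level `j` fits into the memory at address `a`, after the table of sizes, and its
elements are words. -/
structure Fits (b : ℕ) (R : Regs) (j a : ℕ) : Prop where
  tab_le : R.szTab + j ≤ a
  end_le : a + vsz R.beta j ≤ 2 ^ b
  uni_lt : uni R.beta j < 2 ^ b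
  bits : 2 ^ R.beta ≤ b

/-- The table of sizes is correct below level `j`. -/
def Tab (R : Regs) (j : ℕ) (μ : ℕ → ℕ) : Prop := ∀ i < j, μ (R.szTab + i) = vsz R.beta i

section Basics

variable {β j a : ℕ} {S P : Set ℕ} {μ μ' : ℕ → ℕ}

theorem Frame.refl (lo hi : ℕ) (μ : ℕ → ℕ) : Frame lo hi μ μ := fun _ _ => rfl

theorem Frame.mono {lo hi lo' hi' : ℕ} (h : Frame lo hi μ μ') (h1 : lo' ≤ lo) (h2 : hi ≤ hi') :
    Frame lo' hi' μ μ' := fun i hi => h i (by omega)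

theorem Frame.trans {lo hi : ℕ} {μ'' : ℕ → ℕ} (h : Frame lo hi μ μ') (h' : Frame lo hi μ' μ'') :
    Frame lo hi μ μ'' := fun i hi => (h' i hi).trans (h i hi)

theorem frame_update {lo hi : ℕ} (μ : ℕ → ℕ) {c : ℕ} (v : ℕ) (h1 : lo ≤ c) (h2 : c < hi) :
    Frame lo hi μ (Function.update μ c v) := fun i hi =>
  Function.update_of_ne (by omega) _ _

theorem Frame.update {lo hi : ℕ} {c : ℕ} (v : ℕ) (h : Frame lo hi μ μ') (h1 : lo ≤ c)
    (h2 : c < hi) : Frame lo hi μ (Function.update μ' c v) :=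
  h.trans (frame_update _ _ h1 h2)

theorem Tab.frame {R : Regs} {lo hi : ℕ} (hT : Tab R j μ) (h : Frame lo hi μ μ')
    (hlo : R.szTab + j ≤ lo) : Tab R j μ' := fun i hi => by
  rw [h _ (by omega)]; exact hT i hi

theorem Tab.mono {R : Regs} {i : ℕ} (hT : Tab R j μ) (h : i ≤ j) : Tab R i μ :=
  fun k hk => hT k (by omega)

theorem Rep.minEnc (h : Rep β j a S μ) : MinEnc S (μ a) := by
  cases j <;> exact h.1

theorem Rep.maxEnc (h : Rep β j a S μ) : MaxEnc S (μ (a + 1)) := by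
  cases j <;> exact h.2.1

theorem Rep.lt (h : Rep β j a S μ) {x : ℕ} (hx : x ∈ S) : x < uni β j := by
  cases j <;> exact h.2.2.1 x hx

theorem Rep.congr (h : Rep β j a S μ) (hμ : ∀ i, a ≤ i → i < a + vsz β j → μ' i = μ i) :
    Rep β j a S μ' := by
  induction j generalizing a S with
  | zero =>
    simp only [vsz] at hμ
    simp only [Rep] at h ⊢
    rw [hμ a (by omega) (by omega), hμ (a + 1) (by omega) (by omega),
      hμ (a + 2) (by omega) (by omega)]
    exact h
  | succ j ih =>
    have hsz := head_end_le β j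
    simp only [Rep] at h ⊢
    rw [hμ a (by omega) (by omega), hμ (a + 1) (by omega) (by omega)]
    refine ⟨h.1, h.2.1, h.2.2.1, ih h.2.2.2.1 fun i h1 h2 => hμ i (by omega) (by omega),
      fun k hk => ih (h.2.2.2.2 k hk) fun i h1 h2 => ?_⟩
    have := sub_end_le hk
    exact hμ i (by omega) (by omega)

theorem Rep.frame {lo hi : ℕ} (h : Rep β j a S μ) (hF : Frame lo hi μ μ')
    (hd : hi ≤ a ∨ a + vsz β j ≤ lo) : Rep β j a S μ' :=
  h.congr fun i h1 h2 => hF i (by omega)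

theorem StrRep.frame {lo hi : ℕ} (h : StrRep β j a P μ) (hF : Frame lo hi μ μ')
    (hd : hi ≤ a + 2 ∨ a + vsz β (j + 1) ≤ lo) : StrRep β j a P μ' := by
  have hsz := head_end_le β j
  refine ⟨h.1.frame hF (by omega), fun k hk => (h.2 k hk).frame hF ?_⟩
  have := sub_end_le hk
  omega

theorem core_of_nontrivial (h : S.Nontrivial) : core S = S := by
  ext x; simp [core, h]

theorem core_of_subsingleton (h : S.Subsingleton) : core S = ∅ := by
  ext x
  simp only [core, Set.mem_ofPred_eq, Set.mem_empty_iff_false, iff_false, not_and]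
  exact fun _ => Set.not_nontrivial_iff.2 h

theorem his_empty (u : ℕ) : his u ∅ = ∅ := by ext; simp [his]
theorem los_empty (u k : ℕ) : los u k ∅ = ∅ := by ext; simp [los]

theorem his_union (u x : ℕ) : his u (P ∪ {x}) = his u P ∪ {x / u} := by
  ext k
  simp only [his, Set.mem_union, Set.mem_singleton_iff, Set.mem_ofPred_eq]
  constructor
  · rintro ⟨y, h | rfl, rfl⟩
    · exact Or.inl ⟨y, h, rfl⟩
    · exact Or.inr rfl
  · rintro (⟨y, h, rfl⟩ | rfl)
    · exact ⟨y, Or.inl h, rfl⟩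
    · exact ⟨x, Or.inr rfl, rfl⟩

theorem los_union_self {u : ℕ} (hu : 0 < u) (x : ℕ) :
    los u (x / u) (P ∪ {x}) = los u (x / u) P ∪ {x % u} := by
  ext r
  have h1 := Nat.mod_lt x hu
  have h2 := Nat.div_add_mod' x u
  simp only [los, Set.mem_union, Set.mem_singleton_iff, Set.mem_ofPred_eq]
  constructor
  · rintro ⟨hr, h | h⟩
    · exact Or.inl ⟨hr, h⟩
    · right; omega
  · rintro (⟨hr, h⟩ | h)
    · exact ⟨hr, Or.inl h⟩
    · exact ⟨by omega, Or.inr (by rw [h]; omega)⟩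

theorem los_union_ne {u k : ℕ} {x : ℕ} (hk : k ≠ x / u) :
    los u k (P ∪ {x}) = los u k P := by
  ext r
  simp only [los, Set.mem_union, Set.mem_singleton_iff, Set.mem_ofPred_eq]
  constructor
  · rintro ⟨hr, h | h⟩
    · exact ⟨hr, h⟩
    · exfalso; apply hk
      rw [← h, Nat.mul_comm, Nat.mul_add_div (by omega), Nat.div_eq_of_lt hr]; simp
  · rintro ⟨hr, h⟩; exact ⟨hr, Or.inl h⟩

theorem mem_his_iff {u : ℕ} (hu : 0 < u) {k : ℕ} : k ∈ his u P ↔ los u k P ≠ ∅ := by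
  rw [← Set.nonempty_iff_ne_empty]
  constructor
  · rintro ⟨x, hx, rfl⟩
    refine ⟨x % u, Nat.mod_lt _ hu, ?_⟩
    rwa [Nat.div_add_mod']
  · rintro ⟨r, hr, h⟩
    refine ⟨_, h, ?_⟩
    rw [Nat.mul_comm, Nat.mul_add_div hu, Nat.div_eq_of_lt hr]; simp

theorem mem_los_iff {u : ℕ} (hu : 0 < u) {x : ℕ} : x % u ∈ los u (x / u) P ↔ x ∈ P := by
  simp only [los, Set.mem_ofPred_eq, Nat.div_add_mod', and_iff_right_iff_imp]
  exact fun _ => Nat.mod_lt _ hu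

theorem div_lt_uni {x : ℕ} (hx : x < uni β (j + 1)) : x / uni β j < uni β j := by
  rw [uni_succ] at hx; exact Nat.div_lt_of_lt_mul hx

theorem mod_lt_uni (x : ℕ) : x % uni β j < uni β j := Nat.mod_lt _ (uni_pos β j)

variable {b : ℕ} {R : Regs}

theorem Fits.top (h : Fits b R (j + 1) a) : Fits b R j (a + 2) := by
  have h1 := h.tab_le
  have h2 := h.end_le
  have h3 := uni_le_succ R.beta j
  have h4 := h.uni_lt
  have h5 := head_end_le R.beta j
  exact ⟨by omega, by omega, by omega, h.bits⟩

theorem Fits.sub (h : Fits b R (j + 1) a) {k : ℕ} (hk : k < uni R.beta j) :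
    Fits b R j (a + 2 + (k + 1) * vsz R.beta j) := by
  have h1 := h.tab_le
  have h2 := h.end_le
  have h3 := uni_le_succ R.beta j
  have h4 := h.uni_lt
  have h5 := sub_end_le hk
  exact ⟨by omega, by omega, by omega, h.bits⟩

end Basics

/-! ### The two halves of an element -/

section Halves

variable {b : ℕ} {α : Type} {R : Regs} {j : ℕ} {μ : ℕ → ℕ} {t : ℕ} {Q : α → (ℕ → ℕ) → ℕ → Prop}

theorem wp_hi {x : ℕ} {f : ℕ → RAM b α} (hu : uni R.beta (j + 1) < 2 ^ b)
    (h : wp (f (x / uni R.beta j)) μ (t + 2) Q) : wp (hi R j x >>= f) μ t Q := by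
  have h1 := width_lt_uni R.beta j
  have h2 := uni_le_succ R.beta j
  simp (disch := omega) only [hi, ↓exec]
  exact h

theorem wp_join_last {k r : ℕ} {Q : ℕ → (ℕ → ℕ) → ℕ → Prop}
    (hu : uni R.beta (j + 1) < 2 ^ b)
    (hk : k * uni R.beta j + r < 2 ^ b)
    (h : Q (k * uni R.beta j + r) μ (t + 3)) : wp (join R j k r : RAM b ℕ) μ t Q := by
  have h1 := width_lt_uni R.beta j
  have h2 := uni_le_succ R.beta j
  have h3 : k * uni R.beta j = k * 2 ^ (R.beta * 2 ^ j) := rfl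
  rw [h3] at h hk
  simp (disch := omega) only [join, ↓exec]
  exact h

theorem wp_join {k r : ℕ} {f : ℕ → RAM b α} (hu : uni R.beta (j + 1) < 2 ^ b)
    (hk : k * uni R.beta j + r < 2 ^ b)
    (h : wp (f (k * uni R.beta j + r)) μ (t + 3) Q) : wp (join R j k r >>= f) μ t Q := by
  rw [wp_bind]
  exact wp_join_last hu hk h

theorem wp_lo {x : ℕ} {f : ℕ → RAM b α} (hu : uni R.beta (j + 1) < 2 ^ b)
    (hx : x < 2 ^ b)
    (h : wp (f (x % uni R.beta j)) μ (t + 6) Q) : wp (lo R j x >>= f) μ t Q := by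
  have h1 := Nat.div_add_mod' x (uni R.beta j)
  simp only [lo, ↓exec]
  refine wp_hi hu ?_
  simp only [↓exec]
  refine wp_join hu (by omega) ?_
  simp only [↓exec]
  have : x - (x / uni R.beta j * uni R.beta j + 0) = x % uni R.beta j := by omega
  rwa [this]

theorem wp_sub_k {a k : ℕ} {f : ℕ → RAM b α} (hf : Fits b R (j + 1) a) (hT : Tab R (j + 1) μ)
    (hk : k < uni R.beta j)
    (h : wp (f (a + 2 + (k + 1) * vsz R.beta j)) μ (t + 6) Q) :
    wp (sub_k R j a k >>= f) μ t Q := by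
  have h1 := hf.tab_le
  have h2 := hf.end_le
  have h3 := sub_end_le hk
  have h4 := hf.uni_lt
  have h5 := uni_le_succ R.beta j
  have h6 := vsz_ge R.beta j
  simp (disch := omega) only [sub_k, ↓exec]
  rw [hT j (by omega)]
  simp (disch := omega) only [↓exec]
  exact h

end Halves

/-! ### Predecessor search -/

/-- Numbers are ordered like the pairs of their two halves. -/
theorem le_iff_div_mod {u : ℕ} (hu : 0 < u) (x y : ℕ) :
    x ≤ y ↔ x / u < y / u ∨ x / u = y / u ∧ x % u ≤ y % u := by
  have hx := Nat.div_add_mod' x u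
  have hy := Nat.div_add_mod' y u
  have hx' := Nat.mod_lt x hu
  have hy' := Nat.mod_lt y hu
  constructor
  · intro h
    rcases Nat.lt_or_ge (x / u) (y / u) with h1 | h1
    · exact Or.inl h1
    · have h2 : x / u = y / u := le_antisymm (Nat.div_le_div_right h) h1
      rw [h2] at hx
      exact Or.inr ⟨h2, by omega⟩
  · rintro (h | ⟨h, h'⟩)
    · have := Nat.mul_le_mul_right u h
      rw [Nat.succ_mul] at this
      omega
    · rw [h] at hx; omega

theorem maxEnc_le_zero {S : Set ℕ} {m i : ℕ} (hm : MinEnc S m) (h : m = 0 ∨ i + 1 < m) :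
    MaxEnc {x | x ∈ S ∧ x ≤ i} 0 := by
  left
  refine ⟨?_, rfl⟩
  ext x
  simp only [Set.mem_ofPred_eq, Set.mem_empty_iff_false, iff_false, not_and]
  intro hx
  rcases hm with ⟨rfl, -⟩ | ⟨y, hy, rfl⟩
  · exact absurd hx (Set.notMem_empty x)
  · have := hy.2 hx
    omega

theorem maxEnc_le_top {S : Set ℕ} {m i : ℕ} (hm : MaxEnc S m) (h : ¬ i + 1 < m) :
    MaxEnc {x | x ∈ S ∧ x ≤ i} m := by
  rcases hm with ⟨rfl, rfl⟩ | ⟨y, hy, rfl⟩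
  · left; simp
  · right
    exact ⟨y, ⟨⟨hy.1, by omega⟩, fun x hx => hy.2 hx.1⟩, rfl⟩

/-- `vebSearch` is correct. There is one recursive call: for the lower half if `S_k` has an element
below it, and otherwise for the upper half, followed by a look at the maximum of a subinstance. -/
theorem wp_vebSearch {b : ℕ} {R : Regs} {j a i : ℕ} {S : Set ℕ} {μ : ℕ → ℕ} (hf : Fits b R j a)
    (hT : Tab R j μ) (hS : Rep R.beta j a S μ) (hi : i < uni R.beta j) :
    wp (vebSearch R j a i : RAM b ℕ) μ 0 (fun r μ' t => μ' = μ ∧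
      MaxEnc {x | x ∈ S ∧ x ≤ i} r ∧ t ≤ 60 * (j + 1)) := by
  induction j generalizing a i S with
  | zero =>
    have h1 := hf.end_le
    have h2 := hf.uni_lt
    simp only [vsz] at h1
    simp (disch := omega) only [vebSearch, ↓exec]
    refine wp_ite (fun h => ?_) (fun hmn => ?_)
    · simp only [↓exec]
      exact ⟨trivial, maxEnc_le_zero hS.minEnc (Or.inl h), by omega⟩
    simp only [↓exec]
    refine wp_ite (fun h => ?_) (fun hmn' => ?_)
    · simp only [↓exec]
      exact ⟨trivial, maxEnc_le_zero hS.minEnc (Or.inr h), by omega⟩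
    simp only [↓exec]
    refine wp_ite (fun hmx => ?_) (fun h => ?_)
    swap
    · simp only [↓exec]
      exact ⟨trivial, maxEnc_le_top hS.maxEnc h, by omega⟩
    obtain ⟨x, hx, hxm⟩ := hS.minEnc.of_ne hmn
    obtain ⟨y, hy, hym⟩ := hS.maxEnc.of_ne (by omega)
    have hyu := hS.lt hy.1
    have hbits := hf.bits
    have hu : uni R.beta 0 = 2 ^ R.beta := by simp [uni]
    have hp : 1 * 2 ^ (i + 1) < 2 ^ b := by
      rw [one_mul]; exact Nat.pow_lt_pow_right (by norm_num) (by omega)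
    simp (disch := omega) only [↓exec]
    set w := μ (a + 2) &&& (1 * 2 ^ (i + 1) - 1) with hw
    have hbit : {k | w.testBit k = true} = {x | x ∈ S ∧ x ≤ i} := by
      ext k
      have := hS.2.2.2 k
      simp only [Set.mem_ofPred_eq, hw, Nat.testBit_and, one_mul, Nat.testBit_two_pow_sub_one,
        Bool.and_eq_true, decide_eq_true_eq, this]
      exact and_congr_right fun _ => by omega
    have hw0 : w ≠ 0 := by
      intro h0
      have : x ∈ {k | w.testBit k = true} := by rw [hbit]; exact ⟨hx.1, by omega⟩
      simp [h0] at this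
    have hg := isGreatest_log hw0
    rw [hbit] at hg
    have hgi : Nat.log 2 w ≤ i := hg.1.2
    simp (disch := omega) only [↓exec]
    exact ⟨trivial, Or.inr ⟨_, hg, rfl⟩, by omega⟩
  | succ j ih =>
    have h1 := hf.end_le
    have h2 := hf.uni_lt
    have h3 := head_end_le R.beta j
    have hsz := vsz_ge R.beta j
    have hupos := uni_pos R.beta j
    simp (disch := omega) only [vebSearch, ↓exec]
    refine wp_ite (fun h => ?_) (fun hmn => ?_)
    · simp only [↓exec]
      exact ⟨trivial, maxEnc_le_zero hS.minEnc (Or.inl h), by omega⟩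
    simp only [↓exec]
    refine wp_ite (fun h => ?_) (fun hmn' => ?_)
    · simp only [↓exec]
      exact ⟨trivial, maxEnc_le_zero hS.minEnc (Or.inr h), by omega⟩
    simp only [↓exec]
    refine wp_ite (fun hmx => ?_) (fun h => ?_)
    swap
    · simp only [↓exec]
      exact ⟨trivial, maxEnc_le_top hS.maxEnc h, by omega⟩
    obtain ⟨x, hx, hxm⟩ := hS.minEnc.of_ne hmn
    obtain ⟨y, hy, hym⟩ := hS.maxEnc.of_ne (by omega)
    have hcore : core S = S := core_of_nontrivial ⟨x, hx.1, y, hy.1, by omega⟩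
    obtain ⟨-, -, hlt, htop, hsub⟩ := hS
    rw [hcore] at htop hsub
    have hk := div_lt_uni hi
    have hr : i % uni R.beta j < uni R.beta j := mod_lt_uni i
    have hj := uni_le_succ R.beta j
    have hxi : x ≤ i := by omega
    -- the two ways to continue, according to whether `S_k` has an element below
    have skip_case : ∀ t', t' ≤ 30 →
        (∀ r ∈ los (uni R.beta j) (i / uni R.beta j) S, i % uni R.beta j < r) → wp (do
        let l₁ ← add a 2
        let l₂ ← sub (i / uni R.beta j) 1
        let l₃ ← vebSearch R j l₁ l₂
        let k' ← sub l₃ 1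
        let l₄ ← sub_k R j a k'
        let l₅ ← add l₄ 1
        let l₆ ← load l₅
        join R j k' l₆ : RAM b ℕ) μ t' (fun r μ' t => μ' = μ ∧
      MaxEnc {x | x ∈ S ∧ x ≤ i} r ∧ t ≤ 60 * (j + 1 + 1)) := by
      intro t' ht' hno
      have key : ∀ z ∈ S, z ≤ i → z / uni R.beta j < i / uni R.beta j := by
        intro z hz hzi
        rcases (le_iff_div_mod hupos z i).1 hzi with h | ⟨h, h'⟩
        · exact h
        · have := hno (z % uni R.beta j) (by rw [← h]; exact (mem_los_iff hupos).2 hz)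
          omega
      have hxk := key x hx.1 hxi
      simp (disch := omega) only [↓exec]
      refine wp_call (ih hf.top (hT.mono (by omega)) htop (by omega)) ?_
      rintro e _ t ⟨rfl, hmax, ht⟩
      rcases hmax with ⟨hem, -⟩ | ⟨k', hk', rfl⟩
      · have : x / uni R.beta j ∈ {z | z ∈ his (uni R.beta j) S ∧ z ≤ i / uni R.beta j - 1} :=
          ⟨⟨x, hx.1, rfl⟩, by omega⟩
        rw [hem] at this
        exact absurd this (Set.notMem_empty _)
      have hk'u := htop.lt hk'.1.1
      have hs' := hsub k' hk'u
      have hfs := (hf.sub hk'u).end_le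
      simp only [↓exec, Nat.add_sub_cancel]
      refine wp_sub_k hf hT hk'u ?_
      simp (disch := omega) only [↓exec]
      obtain ⟨y', hy', hym'⟩ := hs'.maxEnc.of_ne
        (by rw [Ne, hs'.maxEnc.eq_zero_iff]; exact (mem_his_iff hupos).1 hk'.1.1)
      rw [hym']
      have hv := hlt _ hy'.1.2
      refine wp_join_last h2 (by omega)
        ⟨rfl, Or.inr ⟨k' * uni R.beta j + y', ⟨⟨hy'.1.2, ?_⟩, ?_⟩, ?_⟩, ?_⟩
      · rw [le_iff_div_mod hupos, Nat.mul_comm, Nat.mul_add_div hupos,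
          Nat.div_eq_of_lt hy'.1.1]
        have := hk'.1.2
        have := Nat.zero_lt_of_lt hxk
        omega
      · rintro z ⟨hz, hzi⟩
        have h4 := key z hz hzi
        have h5 : z / uni R.beta j ≤ k' := hk'.2 ⟨⟨z, hz, rfl⟩, by omega⟩
        rw [le_iff_div_mod hupos, Nat.mul_comm, Nat.mul_add_div hupos,
          Nat.div_eq_of_lt hy'.1.1, Nat.mul_add_mod, Nat.mod_eq_of_lt hy'.1.1]
        rcases Nat.lt_or_ge (z / uni R.beta j) k' with h6 | h6
        · left; omega
        · right
          refine ⟨by omega, hy'.2 ?_⟩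
          rw [show k' = z / uni R.beta j by omega]
          exact (mem_los_iff hupos).2 hz
      · rfl
      · omega
    have sub_case : ∀ t', t' ≤ 30 →
        (∃ r ∈ los (uni R.beta j) (i / uni R.beta j) S, r ≤ i % uni R.beta j) → wp (do
        let l ← vebSearch R j (a + 2 + (i / uni R.beta j + 1) * vsz R.beta j) (i % uni R.beta j)
        join R j (i / uni R.beta j) l : RAM b ℕ) μ t' (fun r μ' t => μ' = μ ∧
      MaxEnc {x | x ∈ S ∧ x ≤ i} r ∧ t ≤ 60 * (j + 1 + 1)) := by
      rintro t' ht' ⟨r, hr1, hr2⟩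
      refine wp_call (ih (hf.sub hk) (hT.mono (by omega)) (hsub _ hk) hr) ?_
      rintro e _ t ⟨rfl, hmax, ht⟩
      rcases hmax with ⟨hem, -⟩ | ⟨y', hy', rfl⟩
      · have : r ∈ {z | z ∈ los (uni R.beta j) (i / uni R.beta j) S ∧ z ≤ i % uni R.beta j} :=
          ⟨hr1, hr2⟩
        rw [hem] at this
        exact absurd this (Set.notMem_empty _)
      have hv := hlt _ hy'.1.1.2
      refine wp_join_last h2 (by omega)
        ⟨rfl, Or.inr ⟨i / uni R.beta j * uni R.beta j + y', ⟨⟨hy'.1.1.2, ?_⟩, ?_⟩, ?_⟩, ?_⟩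
      · have := Nat.div_add_mod' i (uni R.beta j)
        have := hy'.1.2
        omega
      · rintro z ⟨hz, hzi⟩
        rw [le_iff_div_mod hupos, Nat.mul_comm, Nat.mul_add_div hupos,
          Nat.div_eq_of_lt hy'.1.1.1, Nat.mul_add_mod, Nat.mod_eq_of_lt hy'.1.1.1]
        rcases (le_iff_div_mod hupos z i).1 hzi with h | ⟨h, h'⟩
        · left; omega
        · right
          refine ⟨by omega, hy'.2 ⟨?_, h'⟩⟩
          rw [← h]
          exact (mem_los_iff hupos).2 hz
      · rfl
      · omega
    refine wp_hi h2 ?_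
    refine wp_lo h2 (by omega) ?_
    refine wp_sub_k hf hT hk ?_
    simp only [↓exec]
    have hmin := (hsub _ hk).minEnc
    refine wp_ite (fun h => ?_) (fun hm => ?_)
    · simp only [↓exec, if_true]
      refine skip_case _ (by omega) ?_
      rw [hmin.eq_zero_iff.1 h]
      intro r hr; exact absurd hr (Set.notMem_empty _)
    · simp (disch := omega) only [↓exec]
      obtain ⟨z, hz, hzm⟩ := hmin.of_ne hm
      refine wp_ite (fun h => ?_) (fun h => ?_)
      · refine skip_case _ (by omega) fun r hr => ?_
        have := hz.2 hr
        omega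
      · exact sub_case _ (by omega) ⟨z, hz.1, by omega⟩

/-! ### Insertion -/

theorem MinEnc.union {S : Set ℕ} {m : ℕ} (h : MinEnc S m) (hm : m ≠ 0) (x : ℕ) :
    MinEnc (S ∪ {x}) (if x + 1 < m then x + 1 else m) := by
  obtain ⟨y, hy, rfl⟩ := h.of_ne hm
  have := hy.union (isLeast_singleton (a := x))
  right
  refine ⟨_, this, ?_⟩
  split_ifs with h
  · rw [min_eq_right (by omega)]
  · rw [min_eq_left (by omega)]

theorem MaxEnc.union {S : Set ℕ} {m : ℕ} (h : MaxEnc S m) (hm : m ≠ 0) (x : ℕ) :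
    MaxEnc (S ∪ {x}) (if m < x + 1 then x + 1 else m) := by
  obtain ⟨y, hy, rfl⟩ := h.of_ne hm
  have := hy.union (isGreatest_singleton (a := x))
  right
  refine ⟨_, this, ?_⟩
  split_ifs with h
  · rw [max_eq_right (by omega)]
  · rw [max_eq_left (by omega)]

/-- `setBits` makes an instance of level `0` represent the set with the bit vector `w`. -/
theorem wp_setBits {b : ℕ} {R : Regs} {a w : ℕ} {S : Set ℕ} {μ : ℕ → ℕ} {t : ℕ}
    (hf : Fits b R 0 a) (hS : ∀ x ∈ S, x < uni R.beta 0) (hw : ∀ i, w.testBit i = true ↔ i ∈ S) :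
    wp (setBits a w : RAM b Unit) μ t (fun _ μ' t' => Rep R.beta 0 a S μ' ∧
      Frame a (a + vsz R.beta 0) μ μ' ∧ t' ≤ t + 14) := by
  have h1 := hf.end_le
  have h2 := hf.uni_lt
  simp only [vsz] at h1
  have hSw : {i | w.testBit i = true} = S := by ext i; simp [hw]
  simp (disch := omega) only [setBits, ↓exec]
  refine wp_ite (fun h => ?_) (fun h => ?_)
  · simp (disch := omega) only [↓exec]
    have hS0 : S = ∅ := by rw [← hSw, h]; simp
    refine ⟨⟨?_, ?_, hS, ?_⟩, ?_, by omega⟩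
    · simpa [Function.update_apply, hS0] using minEnc_empty
    · simpa [Function.update_apply, hS0] using maxEnc_empty
    · simpa [Function.update_apply] using hw
    · exact (((Frame.refl _ _ _).update _ (by omega) (by simp [vsz])).update _ (by omega)
        (by simp [vsz])).update _ (by omega) (by simp [vsz])
  · have hg := isGreatest_log h
    have hl := isLeast_log_xor h
    rw [hSw] at hg hl
    have hmin : MinEnc S (Nat.log 2 (w ^^^ (w - 1)) + 1) := Or.inr ⟨_, hl, rfl⟩
    have hmax : MaxEnc S (Nat.log 2 w + 1) := Or.inr ⟨_, hg, rfl⟩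
    have := hS _ hg.1
    have := hS _ hl.1
    simp (disch := omega) only [↓exec]
    refine ⟨⟨?_, ?_, hS, ?_⟩, ?_, by omega⟩
    · simpa [Function.update_apply] using hmin
    · simpa [Function.update_apply] using hmax
    · simpa [Function.update_apply] using hw
    · exact (((Frame.refl _ _ _).update _ (by omega) (by simp [vsz])).update _ (by omega)
        (by simp [vsz])).update _ (by omega) (by simp [vsz])

/-- `vebInsert` is correct on instances of level `j`. It takes constant time if the set is empty,
which is what makes the time linear in the level: at most one of the recursive calls for the new
element has a nonempty set. -/
def InsertSpec (b : ℕ) (R : Regs) (j : ℕ) : Prop :=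
  ∀ (a x : ℕ) (S : Set ℕ) (μ : ℕ → ℕ), Fits b R j a → Tab R j μ → Rep R.beta j a S μ → x ∉ S →
    x < uni R.beta j → wp (vebInsert R j a x : RAM b Unit) μ 0 (fun _ μ' t =>
      Rep R.beta j a (S ∪ {x}) μ' ∧ Frame a (a + vsz R.beta j) μ μ' ∧ t ≤ 200 * (j + 1) ∧
      (S = ∅ → t ≤ 30))

section Structures

variable {b : ℕ} {α : Type} {R : Regs} {j a x : ℕ} {P : Set ℕ} {μ : ℕ → ℕ} {t : ℕ}
  {Q : α → (ℕ → ℕ) → ℕ → Prop} {F : RAM b α}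

/-- Updating the subinstance `k` does not disturb the others. -/
theorem rep_sub_frame {β k k' : ℕ} {S : Set ℕ} {μ' : ℕ → ℕ}
    (h : Rep β j (a + 2 + (k' + 1) * vsz β j) S μ)
    (hF : Frame (a + 2 + (k + 1) * vsz β j) (a + 2 + (k + 1) * vsz β j + vsz β j) μ μ')
    (hk : k' ≠ k) : Rep β j (a + 2 + (k' + 1) * vsz β j) S μ' := by
  have := sub_disj (vsz β j) hk
  exact h.frame hF (by omega)

theorem top_disj (a k s : ℕ) : a + 2 + s ≤ a + 2 + (k + 1) * s := by
  rw [Nat.succ_mul]; omega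

/-- Adding an element to the recursive structures. -/
theorem wp_strInsert (ih : InsertSpec b R j) (hf : Fits b R (j + 1) a) (hT : Tab R (j + 1) μ)
    (hP : StrRep R.beta j a P μ) (hx : x ∉ P) (hxu : x < uni R.beta (j + 1))
    (hF : ∀ μ' t', StrRep R.beta j a (P ∪ {x}) μ' →
      Frame (a + 2) (a + vsz R.beta (j + 1)) μ μ' → t' ≤ t + 60 + 200 * (j + 1) → wp F μ' t' Q) :
    wp (do
      let k ← hi R j x
      let c ← sub_k R j a k
      if ← eq (← load c) 0 then
        vebInsert R j (← add a 2) k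
      vebInsert R j c (← lo R j x)
      F) μ t Q := by
  have h1 := hf.end_le
  have h2 := hf.uni_lt
  have h3 := head_end_le R.beta j
  have hsz := vsz_ge R.beta j
  have hupos := uni_pos R.beta j
  have hk := div_lt_uni hxu
  have hend := sub_end_le hk
  have htab := hf.tab_le
  have hlos := los_union_self (P := P) hupos x
  have hhis := his_union (P := P) (uni R.beta j) x
  have hnot : x % uni R.beta j ∉ los (uni R.beta j) (x / uni R.beta j) P := by
    rwa [mem_los_iff hupos]
  have hmem : x / uni R.beta j ∈ his (uni R.beta j) P ↔ _ := mem_his_iff hupos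
  have hne : ∀ k' ≠ x / uni R.beta j, los (uni R.beta j) k' (P ∪ {x}) = los (uni R.beta j) k' P :=
    fun k' h => los_union_ne h
  have htd := top_disj a (x / uni R.beta j) (vsz R.beta j)
  have hL := hP.2 _ hk
  refine wp_hi h2 ?_
  refine wp_sub_k hf hT hk ?_
  simp only [↓exec]
  refine wp_ite (fun h => ?_) (fun h => ?_)
  · have hem := hL.minEnc.eq_zero_iff.1 h
    simp (disch := omega) only [↓exec]
    refine wp_call (ih _ _ _ _ hf.top (hT.mono (by omega)) hP.1 (by rw [hmem]; simpa using hem) hk)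
      ?_
    rintro _ μ₁ t₁ ⟨r1, f1, ht1, -⟩
    refine wp_lo h2 (by omega) ?_
    refine wp_call (ih _ _ _ _ (hf.sub hk) ((hT.mono (i := j) (by omega)).frame f1 (by omega))
      (hL.frame f1 (by omega)) hnot (mod_lt_uni x)) ?_
    rintro _ μ₂ t₂ ⟨r2, f2, -, ht2⟩
    have ht2 := ht2 hem
    refine hF _ _ ⟨?_, fun k' hk' => ?_⟩ ?_ ?_
    · rw [hhis]; exact r1.frame f2 (by omega)
    · by_cases hkk : k' = x / uni R.beta j
      · subst hkk; rw [hlos]; exact r2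
      · rw [hne _ hkk]
        exact rep_sub_frame ((hP.2 k' hk').frame f1
          (by have := top_disj a k' (vsz R.beta j); omega))
          f2 hkk
    · exact (f1.mono (by omega) (by omega)).trans (f2.mono (by omega) (by omega))
    · omega
  · have hem : los (uni R.beta j) (x / uni R.beta j) P ≠ ∅ := fun h' =>
      h (hL.minEnc.eq_zero_iff.2 h')
    have hhis' : his (uni R.beta j) (P ∪ {x}) = his (uni R.beta j) P := by
      rw [hhis, Set.union_eq_left]
      exact Set.singleton_subset_iff.2 (hmem.2 hem)
    refine wp_lo h2 (by omega) ?_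
    refine wp_call (ih _ _ _ _ (hf.sub hk) (hT.mono (by omega)) hL hnot (mod_lt_uni x)) ?_
    rintro _ μ₂ t₂ ⟨r2, f2, ht2, -⟩
    refine hF _ _ ⟨?_, fun k' hk' => ?_⟩ ?_ ?_
    · rw [hhis']; exact hP.1.frame f2 (by omega)
    · by_cases hkk : k' = x / uni R.beta j
      · subst hkk; rw [hlos]; exact r2
      · rw [hne _ hkk]
        exact rep_sub_frame (hP.2 k' hk') f2 hkk
    · exact f2.mono (by omega) (by omega)
    · omega

/-- Adding an element to empty recursive structures takes constant time. -/
theorem wp_strInsert_empty (ih : InsertSpec b R j) (hf : Fits b R (j + 1) a)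
    (hT : Tab R (j + 1) μ) (hP : StrRep R.beta j a ∅ μ) (hxu : x < uni R.beta (j + 1))
    (hF : ∀ μ' t', StrRep R.beta j a {x} μ' →
      Frame (a + 2) (a + vsz R.beta (j + 1)) μ μ' → t' ≤ t + 80 → wp F μ' t' Q) :
    wp (do
      let k ← hi R j x
      vebInsert R j (← sub_k R j a k) (← lo R j x)
      vebInsert R j (← add a 2) k
      F) μ t Q := by
  have h1 := hf.end_le
  have h2 := hf.uni_lt
  have h3 := head_end_le R.beta j
  have hsz := vsz_ge R.beta j
  have hupos := uni_pos R.beta j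
  have hk := div_lt_uni hxu
  have hend := sub_end_le hk
  have htab := hf.tab_le
  have hlos := los_union_self (P := ∅) hupos x
  have hhis := his_union (P := ∅) (uni R.beta j) x
  have hne : ∀ k' ≠ x / uni R.beta j, los (uni R.beta j) k' (∅ ∪ {x}) = los (uni R.beta j) k' ∅ :=
    fun k' h => los_union_ne h
  rw [Set.empty_union] at hlos hhis
  simp only [Set.empty_union] at hne
  have htd := top_disj a (x / uni R.beta j) (vsz R.beta j)
  have hL := hP.2 _ hk
  refine wp_hi h2 ?_
  refine wp_sub_k hf hT hk ?_
  refine wp_lo h2 (by omega) ?_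
  refine wp_call (ih _ _ _ _ (hf.sub hk) (hT.mono (by omega)) hL (by simp [los_empty])
    (mod_lt_uni x)) ?_
  rintro _ μ₁ t₁ ⟨r1, f1, -, ht1⟩
  have ht1 := ht1 (los_empty _ _)
  simp (disch := omega) only [↓exec]
  refine wp_call (ih _ _ _ _ hf.top ((hT.mono (i := j) (by omega)).frame f1 (by omega))
    (hP.1.frame f1 (by omega)) (by simp [his_empty]) hk) ?_
  rintro _ μ₂ t₂ ⟨r2, f2, -, ht2⟩
  have ht2 := ht2 (his_empty _)
  refine hF _ _ ⟨?_, fun k' hk' => ?_⟩ ?_ ?_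
  · rw [hhis]; exact r2
  · by_cases hkk : k' = x / uni R.beta j
    · subst hkk; rw [hlos]; exact r1.frame f2 (by omega)
    · rw [hne _ hkk]
      exact (rep_sub_frame (hP.2 k' hk') f1 hkk).frame f2
        (by have := top_disj a k' (vsz R.beta j); omega)
  · exact (f1.mono (by omega) (by omega)).trans (f2.mono (by omega) (by omega))
  · omega

end Structures

/-- By induction on the level: besides the insertion of `x`, the program moves the only element of a
one-element set into the recursive structures, which are empty then. -/
theorem insertSpec (b : ℕ) (R : Regs) (j : ℕ) : InsertSpec b R j := by
  induction j with
  | zero =>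
    intro a x S μ hf hT hS hx hxu
    have h1 := hf.end_le
    have h2 := hf.uni_lt
    have hbits := hf.bits
    simp only [vsz] at h1
    have hu : uni R.beta 0 = 2 ^ R.beta := by simp [uni]
    have hp : 1 * 2 ^ x < 2 ^ b := by
      rw [one_mul]; exact Nat.pow_lt_pow_right (by norm_num) (by omega)
    simp (disch := omega) only [vebInsert, ↓exec]
    refine wp_mono (wp_setBits (S := S ∪ {x}) hf ?_ ?_) ?_
    · rintro y (hy | rfl)
      · exact hS.lt hy
      · exact hxu
    · intro i
      have := hS.2.2.2 i
      simp only [one_mul, Nat.testBit_xor, Nat.testBit_two_pow, Set.mem_union,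
        Set.mem_singleton_iff, ← this]
      by_cases hxi : x = i
      · subst hxi
        have : (μ (a + 2)).testBit x = false := by
          rw [← Bool.not_eq_true, this]; exact hx
        simp [this]
      · simp [hxi, Ne.symm hxi]
    · rintro _ μ' t' ⟨r1, f1, ht⟩
      exact ⟨r1, f1, by omega, fun _ => by omega⟩
  | succ j ih =>
    intro a x S μ hf hT hS hx hxu
    have h1 := hf.end_le
    have h2 := hf.uni_lt
    have htab := hf.tab_le
    have h3 := head_end_le R.beta j
    have hsz := vsz_ge R.beta j
    have hlt : ∀ y ∈ S ∪ {x}, y < uni R.beta (j + 1) := by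
      rintro y (hy | rfl)
      · exact hS.lt hy
      · exact hxu
    simp (disch := omega) only [vebInsert, ↓exec]
    refine wp_ite (fun h => ?_) (fun hmn => ?_)
    · have hS0 := hS.minEnc.eq_zero_iff.1 h
      subst hS0
      rw [Set.empty_union] at hlt ⊢
      simp (disch := omega) only [↓exec]
      refine ⟨⟨?_, ?_, hlt, ?_⟩, ?_, by omega, by omega⟩
      · simpa [Function.update_apply] using minEnc_singleton x
      · simpa [Function.update_apply] using maxEnc_singleton x
      · rw [core_of_subsingleton Set.subsingleton_singleton]
        have := hS.2.2.2
        rw [core_of_subsingleton Set.subsingleton_empty] at this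
        exact StrRep.frame this (lo := a) (hi := a + 2)
          (((Frame.refl _ _ _).update _ (by omega) (by omega)).update _ (by omega) (by omega))
          (by omega)
      · exact ((Frame.refl _ _ _).update _ (by omega) (by omega)).update _ (by omega) (by omega)
    have hSne : S ≠ ∅ := fun h => hmn (hS.minEnc.eq_zero_iff.2 h)
    have hmx : μ (a + 1) ≠ 0 := fun h => hSne (hS.maxEnc.eq_zero_iff.1 h)
    have hmin := hS.minEnc.union hmn x
    have hmax := hS.maxEnc.union hmx x
    have hcore : core (S ∪ {x}) = S ∪ {x} := by
      obtain ⟨y, hy⟩ := Set.nonempty_iff_ne_empty.2 hSne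
      exact core_of_nontrivial ⟨y, Or.inl hy, x, Or.inr rfl, fun h => hx (h ▸ hy)⟩
    -- once the recursive structures represent `S`, `x` is added
    have rest : ∀ μ₁ t₁, StrRep R.beta j a S μ₁ → Frame (a + 2) (a + vsz R.beta (j + 1)) μ μ₁ →
        t₁ ≤ 100 → wp (do
          let k ← hi R j x
          let c ← sub_k R j a k
          if ← eq (← load c) 0 then
            vebInsert R j (← add a 2) k
          vebInsert R j c (← lo R j x)
          if ← lt (x + 1) (μ a) then store a (x + 1)
          if ← lt (μ (a + 1)) (x + 1) then store (← add a 1) (x + 1) : RAM b Unit) μ₁ t₁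
          (fun _ μ' t => Rep R.beta (j + 1) a (S ∪ {x}) μ' ∧
            Frame a (a + vsz R.beta (j + 1)) μ μ' ∧ t ≤ 200 * (j + 1 + 1) ∧ (S = ∅ → t ≤ 30)) := by
      intro μ₁ t₁ hr1 hf1 ht1
      refine wp_strInsert ih hf (hT.frame hf1 (by omega)) hr1 hx hxu ?_
      intro μ₂ t₂ hr2 hf2 ht2
      have e1 : μ₂ a = μ a := (hf2 a (by omega)).trans (hf1 a (by omega))
      have e2 : μ₂ (a + 1) = μ (a + 1) := (hf2 _ (by omega)).trans (hf1 _ (by omega))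
      have hfr := ((hf1.trans hf2).mono (lo' := a) (by omega) le_rfl)
      have fin : ∀ μ₃ t₃, Frame a (a + 2) μ₂ μ₃ → t₃ ≤ t₂ + 10 →
          μ₃ a = (if x + 1 < μ a then x + 1 else μ a) →
          μ₃ (a + 1) = (if μ (a + 1) < x + 1 then x + 1 else μ (a + 1)) →
          (Rep R.beta (j + 1) a (S ∪ {x}) μ₃ ∧
            Frame a (a + vsz R.beta (j + 1)) μ μ₃ ∧ t₃ ≤ 200 * (j + 1 + 1) ∧
            (S = ∅ → t₃ ≤ 30)) := by
        intro μ₃ t₃ hf3 ht3 e3 e4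
        refine ⟨⟨by rwa [e3], by rwa [e4], hlt, ?_⟩, hfr.trans (hf3.mono le_rfl (by omega)),
          by omega, fun h => absurd h hSne⟩
        rw [hcore]
        exact StrRep.frame hr2 hf3 (by omega)
      have u1 : ∀ (ν : ℕ → ℕ) v, Function.update ν a v (a + 1) = ν (a + 1) := fun ν v =>
        Function.update_of_ne (by omega) _ _
      have u2 : ∀ (ν : ℕ → ℕ) v, Function.update ν (a + 1) v a = ν a := fun ν v =>
        Function.update_of_ne (by omega) _ _
      simp only [↓exec]
      refine wp_ite (fun h => ?_) (fun h => ?_) <;> simp only [↓exec] <;>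
        refine wp_ite (fun h' => ?_) (fun h' => ?_) <;> simp (disch := omega) only [↓exec]
      · refine fin _ _ (((Frame.refl _ _ _).update _ le_rfl (by omega)).update _ (by omega)
          (by omega)) (by omega) ?_ ?_
        · rw [u2, if_pos h, Function.update_self]
        · rw [if_pos h', Function.update_self]
      · refine fin _ _ ((Frame.refl _ _ _).update _ le_rfl (by omega)) (by omega) ?_ ?_
        · rw [if_pos h, Function.update_self]
        · rw [u1, if_neg h', e2]
      · refine fin _ _ ((Frame.refl _ _ _).update _ (by omega) (by omega)) (by omega) ?_ ?_
        · rw [u2, if_neg h, e1]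
        · rw [if_pos h', Function.update_self]
      · exact fin _ _ (Frame.refl _ _ _) (by omega) (by rw [if_neg h, e1]) (by rw [if_neg h', e2])
    obtain ⟨y, hy, hym⟩ := hS.minEnc.of_ne hmn
    obtain ⟨z, hz, hzm⟩ := hS.maxEnc.of_ne hmx
    simp only [↓exec]
    refine wp_ite (fun h => ?_) (fun h => ?_)
    · have hsub : S = {y} := by
        ext w
        constructor
        · intro hw
          have := hy.2 hw
          have := hz.2 hw
          exact Set.mem_singleton_iff.2 (by omega)
        · rintro rfl; exact hy.1
      have hstr := hS.2.2.2
      rw [hsub, core_of_subsingleton Set.subsingleton_singleton] at hstr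
      simp only [↓exec, hym, Nat.add_sub_cancel]
      rw [hym] at rest
      refine wp_strInsert_empty ih hf hT hstr (hS.lt hy.1) ?_
      intro μ₁ t₁ hr hfr ht
      exact rest _ _ (by rw [hsub]; exact hr) hfr (by omega)
    · have hnt : S.Nontrivial := ⟨y, hy.1, z, hz.1, by omega⟩
      have hstr := hS.2.2.2
      rw [core_of_nontrivial hnt] at hstr
      exact rest _ _ hstr (Frame.refl _ _ _) (by omega)

/-! ### Deletion -/

theorem los_diff_self {u : ℕ} (x : ℕ) (P : Set ℕ) :
    los u (x / u) (P \ {x}) = los u (x / u) P \ {x % u} := by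
  ext r
  have h2 := Nat.div_add_mod' x u
  simp only [los, Set.mem_sdiff, Set.mem_singleton_iff, Set.mem_ofPred_eq]
  constructor
  · rintro ⟨hr, h, h'⟩
    exact ⟨⟨hr, h⟩, fun h'' => h' (by omega)⟩
  · rintro ⟨⟨hr, h⟩, h'⟩
    exact ⟨hr, h, fun h'' => h' (by omega)⟩

theorem los_diff_ne {u k : ℕ} {x : ℕ} (P : Set ℕ) (hk : k ≠ x / u) :
    los u k (P \ {x}) = los u k P := by
  ext r
  simp only [los, Set.mem_sdiff, Set.mem_singleton_iff, Set.mem_ofPred_eq]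
  constructor
  · rintro ⟨hr, h, -⟩; exact ⟨hr, h⟩
  · rintro ⟨hr, h⟩
    refine ⟨hr, h, fun h' => hk ?_⟩
    rw [← h', Nat.mul_comm, Nat.mul_add_div (by omega), Nat.div_eq_of_lt hr]; simp

theorem his_diff_of_ne {u : ℕ} (hu : 0 < u) {x : ℕ} {P : Set ℕ}
    (h : los u (x / u) (P \ {x}) ≠ ∅) : his u (P \ {x}) = his u P := by
  ext k
  rw [mem_his_iff hu, mem_his_iff hu]
  by_cases hk : k = x / u
  · subst hk
    simp only [h, ne_eq, not_false_eq_true, true_iff]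
    rw [los_diff_self] at h
    intro h'
    simp [h'] at h
  · rw [los_diff_ne P hk]

theorem his_diff_of_eq {u : ℕ} (hu : 0 < u) {x : ℕ} {P : Set ℕ}
    (h : los u (x / u) (P \ {x}) = ∅) : his u (P \ {x}) = his u P \ {x / u} := by
  ext k
  rw [Set.mem_sdiff, mem_his_iff hu, mem_his_iff hu]
  by_cases hk : k = x / u
  · subst hk; simp [h]
  · rw [los_diff_ne P hk]; simp [hk]

theorem his_singleton (u x : ℕ) : his u {x} = {x / u} := by
  have := his_union (P := ∅) u x
  rwa [his_empty, Set.empty_union, Set.empty_union] at this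

theorem los_singleton {u : ℕ} (hu : 0 < u) (x : ℕ) : los u (x / u) {x} = {x % u} := by
  have := los_union_self (P := ∅) hu x
  rwa [los_empty, Set.empty_union, Set.empty_union] at this

theorem isLeast_join {u k r : ℕ} (hu : 0 < u) {P : Set ℕ} (hk : IsLeast (his u P) k)
    (hr : IsLeast (los u k P) r) : IsLeast P (k * u + r) := by
  refine ⟨hr.1.2, fun z hz => ?_⟩
  rw [le_iff_div_mod hu, Nat.mul_comm, Nat.mul_add_div hu, Nat.div_eq_of_lt hr.1.1,
    Nat.mul_add_mod, Nat.mod_eq_of_lt hr.1.1]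
  rcases Nat.lt_or_ge k (z / u) with h | h
  · left; omega
  · have h' : z / u = k := le_antisymm h (hk.2 ⟨z, hz, rfl⟩)
    right
    refine ⟨by omega, hr.2 ?_⟩
    rw [← h']
    exact (mem_los_iff hu).2 hz

theorem isGreatest_join {u k r : ℕ} (hu : 0 < u) {P : Set ℕ} (hk : IsGreatest (his u P) k)
    (hr : IsGreatest (los u k P) r) : IsGreatest P (k * u + r) := by
  refine ⟨hr.1.2, fun z hz => ?_⟩
  rw [le_iff_div_mod hu, Nat.mul_comm, Nat.mul_add_div hu, Nat.div_eq_of_lt hr.1.1,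
    Nat.mul_add_mod, Nat.mod_eq_of_lt hr.1.1]
  rcases Nat.lt_or_ge (z / u) k with h | h
  · left; omega
  · have h' : z / u = k := le_antisymm (hk.2 ⟨z, hz, rfl⟩) h
    right
    refine ⟨by omega, hr.2 ?_⟩
    rw [← h']
    exact (mem_los_iff hu).2 hz

/-- `vebDelete` is correct on instances of level `j`. It takes constant time if the set has no other
element. -/
def DeleteSpec (b : ℕ) (R : Regs) (j : ℕ) : Prop :=
  ∀ (a x : ℕ) (S : Set ℕ) (μ : ℕ → ℕ), Fits b R j a → Tab R j μ → Rep R.beta j a S μ → x ∈ S →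
    wp (vebDelete R j a x : RAM b Unit) μ 0 (fun _ μ' t =>
      Rep R.beta j a (S \ {x}) μ' ∧ Frame a (a + vsz R.beta j) μ μ' ∧ t ≤ 200 * (j + 1) ∧
      (S = {x} → t ≤ 30))

section Structures

variable {b : ℕ} {α : Type} {R : Regs} {j a x : ℕ} {P : Set ℕ} {μ : ℕ → ℕ} {t : ℕ}
  {Q : α → (ℕ → ℕ) → ℕ → Prop} {F : RAM b α}

/-- Removing an element from the recursive structures. -/
theorem wp_strDelete (ih : DeleteSpec b R j) (hf : Fits b R (j + 1) a) (hT : Tab R (j + 1) μ)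
    (hP : StrRep R.beta j a P μ) (hx : x ∈ P) (hxu : x < uni R.beta (j + 1))
    (hF : ∀ μ' t', StrRep R.beta j a (P \ {x}) μ' →
      Frame (a + 2) (a + vsz R.beta (j + 1)) μ μ' → t' ≤ t + 60 + 200 * (j + 1) → wp F μ' t' Q) :
    wp (do
      let k ← hi R j x
      let c ← sub_k R j a k
      vebDelete R j c (← lo R j x)
      if ← eq (← load c) 0 then
        vebDelete R j (a + 2) k
      F) μ t Q := by
  have h1 := hf.end_le
  have h2 := hf.uni_lt
  have h3 := head_end_le R.beta j
  have hsz := vsz_ge R.beta j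
  have hupos := uni_pos R.beta j
  have hk := div_lt_uni hxu
  have hend := sub_end_le hk
  have htab := hf.tab_le
  have hlos := los_diff_self (u := uni R.beta j) x P
  have hmem' : x % uni R.beta j ∈ los (uni R.beta j) (x / uni R.beta j) P := by
    rwa [mem_los_iff hupos]
  have hmem : x / uni R.beta j ∈ his (uni R.beta j) P := ⟨x, hx, rfl⟩
  have hne : ∀ k' ≠ x / uni R.beta j, los (uni R.beta j) k' (P \ {x}) = los (uni R.beta j) k' P :=
    fun k' h => los_diff_ne P h
  have htd := top_disj a (x / uni R.beta j) (vsz R.beta j)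
  have hL := hP.2 _ hk
  refine wp_hi h2 ?_
  refine wp_sub_k hf hT hk ?_
  refine wp_lo h2 (by omega) ?_
  refine wp_call (ih _ _ _ _ (hf.sub hk) (hT.mono (by omega)) hL hmem') ?_
  rintro _ μ₁ t₁ ⟨r1, f1, ht1, ht1'⟩
  rw [← hlos] at r1
  have subs : ∀ k' < uni R.beta j, Rep R.beta j (a + 2 + (k' + 1) * vsz R.beta j)
      (los (uni R.beta j) k' (P \ {x})) μ₁ := by
    intro k' hk'
    by_cases hkk : k' = x / uni R.beta j
    · subst hkk; exact r1
    · rw [hne _ hkk]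
      exact rep_sub_frame (hP.2 k' hk') f1 hkk
  have r0 := hP.1.frame f1 (by omega)
  simp only [↓exec]
  refine wp_ite (fun h => ?_) (fun h => ?_)
  · have hem := r1.minEnc.eq_zero_iff.1 h
    have hone : los (uni R.beta j) (x / uni R.beta j) P = {x % uni R.beta j} := by
      rw [hlos] at hem
      exact Set.Subset.antisymm (Set.sdiff_eq_empty.1 hem) (Set.singleton_subset_iff.2 hmem')
    have ht1' := ht1' hone
    refine wp_call (ih _ _ _ _ hf.top ((hT.mono (i := j) (by omega)).frame f1 (by omega)) r0 hmem)
      ?_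
    rintro _ μ₂ t₂ ⟨r2, f2, ht2, -⟩
    refine hF _ _ ⟨?_, fun k' hk' => ?_⟩ ?_ ?_
    · rw [his_diff_of_eq hupos hem]; exact r2
    · exact (subs k' hk').frame f2 (by have := top_disj a k' (vsz R.beta j); omega)
    · exact (f1.mono (by omega) (by omega)).trans (f2.mono (by omega) (by omega))
    · omega
  · have hem : los (uni R.beta j) (x / uni R.beta j) (P \ {x}) ≠ ∅ := fun h' =>
      h (r1.minEnc.eq_zero_iff.2 h')
    refine hF _ _ ⟨?_, subs⟩ ?_ ?_
    · rw [his_diff_of_ne hupos hem]; exact r0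
    · exact f1.mono (by omega) (by omega)
    · omega

/-- Removing the only element from the recursive structures takes constant time. -/
theorem wp_strDelete_singleton (ih : DeleteSpec b R j) (hf : Fits b R (j + 1) a)
    (hT : Tab R (j + 1) μ) (hP : StrRep R.beta j a {x} μ) (hxu : x < uni R.beta (j + 1)) :
    wp (do
      vebDelete R j (a + 2 + (x / uni R.beta j + 1) * vsz R.beta j) (x % uni R.beta j)
      vebDelete R j (a + 2) (x / uni R.beta j) : RAM b Unit) μ t (fun _ μ' t' =>
        StrRep R.beta j a ∅ μ' ∧ Frame (a + 2) (a + vsz R.beta (j + 1)) μ μ' ∧ t' ≤ t + 60) := by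
  have h3 := head_end_le R.beta j
  have hsz := vsz_ge R.beta j
  have hupos := uni_pos R.beta j
  have hk := div_lt_uni hxu
  have hend := sub_end_le hk
  have htab := hf.tab_le
  have hlos := los_singleton hupos x
  have hhis := his_singleton (uni R.beta j) x
  have htd := top_disj a (x / uni R.beta j) (vsz R.beta j)
  have hL := hP.2 _ hk
  have hne : ∀ k' ≠ x / uni R.beta j, los (uni R.beta j) k' {x} = ∅ := by
    intro k' h
    rw [← los_diff_ne {x} h, Set.sdiff_self, los_empty]
  refine wp_call (ih _ _ _ _ (hf.sub hk) (hT.mono (by omega)) hL (by rw [hlos]; rfl)) ?_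
  rintro _ μ₁ t₁ ⟨r1, f1, -, ht1⟩
  rw [hlos, Set.sdiff_self] at r1
  have ht1 := ht1 hlos
  refine wp_mono (ih _ _ _ _ hf.top ((hT.mono (i := j) (by omega)).frame f1 (by omega))
    (hP.1.frame f1 (by omega)) (by rw [hhis]; rfl)) ?_
  rintro _ μ₂ t₂ ⟨r2, f2, -, ht2⟩
  rw [hhis, Set.sdiff_self] at r2
  have ht2 := ht2 hhis
  refine ⟨⟨by rw [his_empty]; exact r2, fun k' hk' => ?_⟩, ?_, ?_⟩
  · rw [los_empty]
    have hd := top_disj a k' (vsz R.beta j)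
    by_cases hkk : k' = x / uni R.beta j
    · subst hkk; exact r1.frame f2 (by omega)
    · have := hP.2 k' hk'
      rw [hne _ hkk] at this
      exact (rep_sub_frame this f1 hkk).frame f2 (by omega)
  · exact (f1.mono (by omega) (by omega)).trans (f2.mono (by omega) (by omega))
  · omega

end Structures

/-- By induction on the level: besides the deletion of `x`, the program clears the recursive
structures when one element is left, which takes constant time. -/
theorem deleteSpec (b : ℕ) (R : Regs) (j : ℕ) : DeleteSpec b R j := by
  induction j with
  | zero =>
    intro a x S μ hf hT hS hx
    have h1 := hf.end_le
    have h2 := hf.uni_lt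
    have hbits := hf.bits
    have hxu := hS.lt hx
    simp only [vsz] at h1
    have hu : uni R.beta 0 = 2 ^ R.beta := by simp [uni]
    have hp : 1 * 2 ^ x < 2 ^ b := by
      rw [one_mul]; exact Nat.pow_lt_pow_right (by norm_num) (by omega)
    simp (disch := omega) only [vebDelete, ↓exec]
    refine wp_mono (wp_setBits (S := S \ {x}) hf (fun y hy => hS.lt hy.1) ?_) ?_
    · intro i
      have := hS.2.2.2 i
      simp only [one_mul, Nat.testBit_xor, Nat.testBit_two_pow, Set.mem_sdiff,
        Set.mem_singleton_iff, ← this]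
      by_cases hxi : x = i
      · subst hxi
        simp [this.2 hx]
      · simp [hxi, Ne.symm hxi]
    · rintro _ μ' t' ⟨r1, f1, ht⟩
      exact ⟨r1, f1, by omega, fun _ => by omega⟩
  | succ j ih =>
    intro a x S μ hf hT hS hx
    have h1 := hf.end_le
    have h2 := hf.uni_lt
    have htab := hf.tab_le
    have h3 := head_end_le R.beta j
    have hsz := vsz_ge R.beta j
    have hupos := uni_pos R.beta j
    have hxu := hS.lt hx
    have hSne : S ≠ ∅ := fun h => by simp [h] at hx
    obtain ⟨y, hy, hym⟩ := hS.minEnc.of_ne fun h => hSne (hS.minEnc.eq_zero_iff.1 h)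
    obtain ⟨z, hz, hzm⟩ := hS.maxEnc.of_ne fun h => hSne (hS.maxEnc.eq_zero_iff.1 h)
    simp (disch := omega) only [vebDelete, ↓exec]
    refine wp_ite (fun h => ?_) (fun h => ?_)
    · have hsub : S = {x} := by
        have := hy.2 hx
        have := hz.2 hx
        ext w
        constructor
        · intro hw
          have := hy.2 hw
          have := hz.2 hw
          exact Set.mem_singleton_iff.2 (by omega)
        · rintro rfl; exact hx
      have hstr := hS.2.2.2
      rw [hsub, core_of_subsingleton Set.subsingleton_singleton] at hstr
      simp (disch := omega) only [↓exec]
      have hfr : Frame a (a + 2) μ (Function.update (Function.update μ a 0) (a + 1) 0) :=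
        ((Frame.refl _ _ _).update _ (by omega) (by omega)).update _ (by omega) (by omega)
      refine ⟨⟨?_, ?_, fun w hw => hS.lt hw.1, ?_⟩, hfr.mono (by omega) (by omega), by omega,
        by omega⟩
      · simpa [Function.update_apply, hsub] using minEnc_empty
      · simpa [Function.update_apply, hsub] using maxEnc_empty
      · rw [hsub, Set.sdiff_self, core_of_subsingleton Set.subsingleton_empty]
        exact StrRep.frame hstr hfr (by omega)
    have hnt : S.Nontrivial := ⟨y, hy.1, z, hz.1, by omega⟩
    have hstr := hS.2.2.2
    rw [core_of_nontrivial hnt] at hstr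
    simp (disch := omega) only [↓exec]
    refine wp_strDelete ih hf hT hstr hx hxu ?_
    intro μ₁ t₁ hr1 hf1 ht1
    have hT1 : Tab R (j + 1) μ₁ := hT.frame hf1 (by omega)
    have hPne : S \ {x} ≠ ∅ := by
      obtain ⟨w, hw, hwx⟩ := hnt.exists_ne x
      exact Set.nonempty_iff_ne_empty.1 ⟨w, hw, hwx⟩
    have hlt : ∀ w ∈ S \ {x}, w < uni R.beta (j + 1) := fun w hw => hS.lt hw.1
    have hsne : S ≠ {x} := fun h => by rw [h] at hPne; simp at hPne
    generalize S \ {x} = P at *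
    have hhis : his (uni R.beta j) P ≠ ∅ := by
      obtain ⟨w, hw⟩ := Set.nonempty_iff_ne_empty.2 hPne
      exact Set.nonempty_iff_ne_empty.1 ⟨_, w, hw, rfl⟩
    obtain ⟨k₁, hk₁, hkm₁⟩ := hr1.1.minEnc.of_ne fun h => hhis (hr1.1.minEnc.eq_zero_iff.1 h)
    obtain ⟨k₂, hk₂, hkm₂⟩ := hr1.1.maxEnc.of_ne fun h => hhis (hr1.1.maxEnc.eq_zero_iff.1 h)
    have hku₁ := hr1.1.lt hk₁.1
    have hku₂ := hr1.1.lt hk₂.1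
    have hl₁ := (mem_his_iff hupos).1 hk₁.1
    have hl₂ := (mem_his_iff hupos).1 hk₂.1
    have hs₁ := hr1.2 _ hku₁
    have hs₂ := hr1.2 _ hku₂
    obtain ⟨r₁, hr₁, hrm₁⟩ := hs₁.minEnc.of_ne fun h => hl₁ (hs₁.minEnc.eq_zero_iff.1 h)
    obtain ⟨r₂, hr₂, hrm₂⟩ := hs₂.maxEnc.of_ne fun h => hl₂ (hs₂.maxEnc.eq_zero_iff.1 h)
    have hmin := isLeast_join hupos hk₁ hr₁
    have hmax := isGreatest_join hupos hk₂ hr₂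
    have hv₁ := hlt _ hmin.1
    have hv₂ := hlt _ hmax.1
    have he₁ := (hf.sub hku₁).end_le
    have he₂ := (hf.sub hku₂).end_le
    simp (disch := omega) only [↓exec, hkm₁, Nat.add_sub_cancel]
    refine wp_sub_k hf hT1 hku₁ ?_
    simp (disch := omega) only [↓exec, hrm₁]
    refine wp_join h2 (by omega) ?_
    simp (disch := omega) only [↓exec, hkm₂, Nat.add_sub_cancel]
    refine wp_sub_k hf hT1 hku₂ ?_
    simp (disch := omega) only [↓exec, hrm₂]
    refine wp_join h2 (by omega) ?_
    simp (disch := omega) only [↓exec]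
    have hdiv : (k₁ * uni R.beta j + r₁) / uni R.beta j = k₁ := by
      rw [Nat.mul_comm, Nat.mul_add_div hupos, Nat.div_eq_of_lt hr₁.1.1]; simp
    have hmod : (k₁ * uni R.beta j + r₁) % uni R.beta j = r₁ := by
      rw [Nat.mul_comm, Nat.mul_add_mod, Nat.mod_eq_of_lt hr₁.1.1]
    set v₁ := k₁ * uni R.beta j + r₁ with hv₁'
    set v₂ := k₂ * uni R.beta j + r₂ with hv₂'
    have e₁ : k₁ * uni R.beta j + (r₁ + 1) = v₁ + 1 := by omega
    have e₂ : k₂ * uni R.beta j + (r₂ + 1) = v₂ + 1 := by omega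
    rw [e₁, e₂]
    have hf2 : Frame a (a + 2) μ₁ (Function.update (Function.update μ₁ a (v₁ + 1)) (a + 1)
        (v₂ + 1)) :=
      ((Frame.refl _ _ _).update _ (by omega) (by omega)).update _ (by omega) (by omega)
    have ea₁ : Function.update (Function.update μ₁ a (v₁ + 1)) (a + 1) (v₂ + 1) a = v₁ + 1 := by
      rw [Function.update_of_ne (by omega), Function.update_self]
    have ea₂ : Function.update (Function.update μ₁ a (v₁ + 1)) (a + 1) (v₂ + 1) (a + 1) =
        v₂ + 1 := Function.update_self ..
    generalize Function.update (Function.update μ₁ a (v₁ + 1)) (a + 1) (v₂ + 1) = μ₂ at *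
    have hr2 := hr1.frame hf2 (by omega)
    have hT2 : Tab R (j + 1) μ₂ := hT1.frame hf2 (by omega)
    have hfr2 := (hf1.mono (lo' := a) (by omega) le_rfl).trans (hf2.mono le_rfl (by omega))
    refine wp_ite (fun h => ?_) (fun h => ?_)
    · have hone : P = {v₁} := by
        ext w
        constructor
        · intro hw
          have := hmin.2 hw
          have := hmax.2 hw
          exact Set.mem_singleton_iff.2 (by omega)
        · rintro rfl; exact hmin.1
      simp only [↓exec]
      rw [hone] at hr2
      have key := wp_strDelete_singleton (b := b) (t := 0) ih hf hT2 hr2 hv₁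
      rw [hdiv, hmod] at key
      refine wp_mono key ?_
      rintro _ μ₃ t₃ ⟨hr3, hf3, ht3⟩
      refine ⟨⟨?_, ?_, hlt, ?_⟩, hfr2.trans (hf3.mono (by omega) le_rfl), by omega,
        fun h => absurd h hsne⟩
      · rw [hf3 a (by omega), ea₁]; exact Or.inr ⟨_, hmin, rfl⟩
      · rw [hf3 (a + 1) (by omega), ea₂]; exact Or.inr ⟨_, hmax, rfl⟩
      · rw [hone, core_of_subsingleton Set.subsingleton_singleton]
        exact hr3
    · simp only [↓exec]
      refine ⟨⟨?_, ?_, hlt, ?_⟩, hfr2, by omega, fun h => absurd h hsne⟩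
      · rw [ea₁]; exact Or.inr ⟨_, hmin, rfl⟩
      · rw [ea₂]; exact Or.inr ⟨_, hmax, rfl⟩
      · rw [core_of_nontrivial ⟨_, hmin.1, _, hmax.1, by omega⟩]
        exact hr2

/-! ### The ordered list of elements -/

/-- `MinEnc` without the decoded element, as needed for updates of links. -/
theorem minEnc_iff {S : Set ℕ} {m : ℕ} :
    MinEnc S m ↔ (m = 0 ∨ m - 1 ∈ S) ∧ ∀ x ∈ S, 1 ≤ m ∧ m ≤ x + 1 := by
  constructor
  · rintro (⟨rfl, rfl⟩ | ⟨x, hx, rfl⟩)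
    · simp
    · exact ⟨Or.inr hx.1, fun y hy => ⟨by omega, by have := hx.2 hy; omega⟩⟩
  · rintro ⟨h | h, h'⟩
    · left
      refine ⟨Set.eq_empty_of_forall_notMem fun x hx => ?_, h⟩
      have := h' x hx; omega
    · right
      have h1 := h' _ h
      exact ⟨m - 1, ⟨h, fun y hy => by have := h' y hy; omega⟩, by omega⟩

/-- `MaxEnc` without the decoded element, as needed for updates of links. -/
theorem maxEnc_iff {S : Set ℕ} {m : ℕ} :
    MaxEnc S m ↔ (m = 0 ∨ m - 1 ∈ S) ∧ ∀ x ∈ S, x + 1 ≤ m := by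
  constructor
  · rintro (⟨rfl, rfl⟩ | ⟨x, hx, rfl⟩)
    · simp
    · exact ⟨Or.inr hx.1, fun y hy => by have := hx.2 hy; omega⟩
  · rintro ⟨h | h, h'⟩
    · left
      refine ⟨Set.eq_empty_of_forall_notMem fun x hx => ?_, h⟩
      have := h' x hx; omega
    · right
      have h1 := h' _ h
      exact ⟨m - 1, ⟨h, fun y hy => by have := h' y hy; omega⟩, by omega⟩

/-- `X` and `P` are the links of the ordered list of the elements of `S`. Elements are encoded by
adding `1`, and `0` is the sentinel, whose backward link is never used. -/
structure OList (S : Set ℕ) (X P : ℕ → ℕ) : Prop where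
  next : ∀ e, e = 0 ∨ e - 1 ∈ S → MinEnc {w | w ∈ S ∧ e ≤ w} (X e)
  prev : ∀ u ∈ S, MaxEnc {w | w ∈ S ∧ w < u} (P (u + 1))

/-- A new element `u` is linked between its predecessor `p` and the successor of `p`. -/
theorem OList.insert {S : Set ℕ} {X P : ℕ → ℕ} (h : OList S X P) {u p : ℕ} (hu : u ∉ S)
    (hp : MaxEnc {w | w ∈ S ∧ w ≤ u} p) :
    OList (S ∪ {u}) (Function.update (Function.update X (u + 1) (X p)) p (u + 1))
      (Function.update (Function.update P (u + 1) p) (X p) (u + 1)) := by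
  obtain ⟨h1, h2⟩ := h
  simp only [minEnc_iff, maxEnc_iff, Set.mem_ofPred_eq] at *
  obtain ⟨hp1, hp2⟩ := hp
  obtain ⟨hq1, hq2⟩ := h1 p (by tauto)
  generalize X p = q at *
  have hpu : p ≠ u + 1 := by
    rintro rfl
    exact hu (by simpa using hp1)
  constructor
  · intro e he
    have he1 := h1 e
    simp only [minEnc_iff, Set.mem_ofPred_eq, Set.mem_union, Set.mem_singleton_iff,
      Function.update_apply] at *
    clear h1 h2
    split_ifs with c1 c2
    · refine ⟨Or.inr ⟨Or.inr rfl, by omega⟩, ?_⟩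
      rintro x ⟨hx | rfl, hxe⟩
      · have := hp2 x
        grind
      · omega
    · refine ⟨by grind, ?_⟩
      rintro x ⟨hx | rfl, hxe⟩
      · exact hq2 x ⟨hx, by grind⟩
      · omega
    · obtain ⟨he1, he2⟩ := he1 (by grind)
      refine ⟨by grind, ?_⟩
      rintro x ⟨hx | rfl, hxe⟩
      · exact he2 x ⟨hx, hxe⟩
      · have := he2 (p - 1)
        have := hp2 (e - 1)
        grind
  · intro v hv
    have hv1 := h2 v
    simp only [maxEnc_iff, Set.mem_ofPred_eq, Set.mem_union, Set.mem_singleton_iff,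
      Function.update_apply] at *
    clear h1 h2
    split_ifs with c1 c2
    · refine ⟨Or.inr ⟨Or.inr rfl, by grind⟩, ?_⟩
      rintro x ⟨hx | rfl, hxe⟩
      · have := hp2 x
        have := hq2 x
        grind
      · omega
    · refine ⟨by grind, ?_⟩
      rintro x ⟨hx | rfl, hxe⟩
      · exact hp2 x ⟨hx, by omega⟩
      · omega
    · have hv' : v ∈ S := by grind
      obtain ⟨hv2, hv3⟩ := hv1 hv'
      refine ⟨by grind, ?_⟩
      rintro x ⟨hx | rfl, hxe⟩
      · exact hv3 x ⟨hx, hxe⟩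
      · have := hv3 (q - 1)
        have := hp2 v
        have := hq2 v
        grind

/-- The neighbours of a deleted element are linked to each other. -/
theorem OList.delete {S : Set ℕ} {X P : ℕ → ℕ} (h : OList S X P) {u : ℕ} (hu : u ∈ S) :
    OList (S \ {u}) (Function.update X (P (u + 1)) (X (u + 1)))
      (Function.update P (X (u + 1)) (P (u + 1))) := by
  obtain ⟨h1, h2⟩ := h
  simp only [minEnc_iff, maxEnc_iff, Set.mem_ofPred_eq] at *
  obtain ⟨hq1, hq2⟩ := h1 (u + 1) (by simp [hu])
  obtain ⟨hp1, hp2⟩ := h2 u hu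
  generalize X (u + 1) = q at *
  generalize P (u + 1) = p at *
  constructor
  · intro e he
    have he1 := h1 e
    simp only [minEnc_iff, Set.mem_ofPred_eq, Set.mem_sdiff, Set.mem_singleton_iff,
      Function.update_apply] at *
    clear h1 h2
    split_ifs with c1
    · refine ⟨by grind, ?_⟩
      rintro x ⟨⟨hx, hxu⟩, hxe⟩
      have := hp2 x
      have := hq2 x
      grind
    · obtain ⟨he1, he2⟩ := he1 (by grind)
      have h3 := he2 u
      have h4 := he2 (p - 1)
      have h5 := hp2 (e - 1)
      exact ⟨by grind, fun x hx => he2 x ⟨hx.1.1, hx.2⟩⟩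
  · intro v hv
    have hv1 := h2 v
    simp only [maxEnc_iff, Set.mem_ofPred_eq, Set.mem_sdiff, Set.mem_singleton_iff,
      Function.update_apply] at *
    clear h1 h2
    obtain ⟨hv2, hv3⟩ := hv1 hv.1
    split_ifs with c1
    · refine ⟨by grind, ?_⟩
      rintro x ⟨⟨hx, hxu⟩, hxe⟩
      have := hp2 x
      have := hq2 x
      grind
    · have h3 := hv3 (q - 1)
      have h4 := hq2 v
      have h5 := hp2 v
      exact ⟨by grind, fun x hx => hv3 x ⟨hx.1.1, hx.2⟩⟩

/-! ### The buckets -/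

/-- The links `X` (forward) and `P` (backward) and the dictionary `D` represent buckets of the nodes
in `Q` with the keys `K`. The links are described locally; the ranking `τ`, which decreases along
forward links, excludes cycles, and so makes every bucket one list that starts at its entry in `D`.
Nodes are encoded by adding `1`, and `0` means nil. -/
structure Buckets (Q : Set ℕ) (K X P D τ : ℕ → ℕ) : Prop where
  prev : ∀ v ∈ Q, (P v = 0 ∧ D (K v) = v + 1) ∨
    ∃ p ∈ Q, P v = p + 1 ∧ K p = K v ∧ X p = v + 1 ∧ τ v < τ p
  next : ∀ v ∈ Q, X v = 0 ∨ ∃ q ∈ Q, X v = q + 1 ∧ K q = K v ∧ P q = v + 1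
  head : ∀ u, D u = 0 ∨ ∃ f ∈ Q, D u = f + 1 ∧ K f = u ∧ P f = 0

/-- The bucket of a node of the queue is not empty: a node of largest rank in that bucket has no
predecessor, so it is the first one. -/
theorem Buckets.head_ne {Q : Set ℕ} {K X P D τ : ℕ → ℕ} (h : Buckets Q K X P D τ) {n : ℕ}
    (hQ : ∀ v ∈ Q, v < n) {v : ℕ} (hv : v ∈ Q) : D (K v) ≠ 0 := by
  have hfin : Set.Finite {w | w ∈ Q ∧ K w = K v} :=
    (Set.finite_lt_nat n).subset fun w hw => hQ w hw.1
  obtain ⟨w, ⟨hw, hwv⟩, hmax⟩ := Set.exists_max_image _ τ hfin ⟨v, hv, rfl⟩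
  rcases h.prev w hw with ⟨-, h1⟩ | ⟨p, hp, -, h2, -, h3⟩
  · rw [← hwv, h1]; omega
  · have := hmax p ⟨hp, h2.trans hwv⟩
    omega

/-- A new node is put in front of its bucket, with the largest rank of all. -/
theorem Buckets.insert {Q : Set ℕ} {K X P D τ : ℕ → ℕ} (h : Buckets Q K X P D τ) {n : ℕ}
    (hQ : ∀ v ∈ Q, v < n) {v : ℕ} (hv : v ∉ Q) (u : ℕ) :
    ∃ τ', Buckets (Q ∪ {v}) (Function.update K v u) (Function.update X v (D u))
      (Function.update (if D u = 0 then P else Function.update P (D u - 1) (v + 1)) v 0)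
      (Function.update D u (v + 1)) τ' := by
  have hfin : Set.Finite Q := (Set.finite_lt_nat n).subset fun w hw => hQ w hw
  obtain ⟨M, hM⟩ := (hfin.image τ).bddAbove
  have hM' : ∀ w ∈ Q, τ w ≤ M := fun w hw => hM ⟨w, hw, rfl⟩
  refine ⟨Function.update τ v (M + 1), ?_⟩
  obtain ⟨h1, h2, h3⟩ := h
  constructor
  · intro w hw
    simp only [Set.mem_union, Set.mem_singleton_iff, Function.update_apply] at *
    by_cases hwv : w = v
    · subst hwv; simp
    have hw' : w ∈ Q := by tauto
    have h3u := h3 u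
    have h1w := h1 w hw'
    have hMw := hM' w hw'
    clear h1 h2 h3
    by_cases hd : D u = 0
    · grind
    obtain ⟨f, hf, hf1, hf2, hf3⟩ := h3u.resolve_left hd
    clear h3u
    have hfv : f ≠ v := fun h => hv (h ▸ hf)
    rw [if_neg hd, if_neg hwv, hf1, Nat.add_sub_cancel]
    by_cases hwf : w = f
    · right
      exact ⟨v, by grind⟩
    · rcases h1w with ⟨h, h'⟩ | ⟨p, hp, hp'⟩
      · left; grind
      · right; exact ⟨p, by grind⟩
  · intro w hw
    simp only [Set.mem_union, Set.mem_singleton_iff, Function.update_apply] at *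
    have h3u := h3 u
    by_cases hwv : w = v
    · subst hwv
      grind
    have hw' : w ∈ Q := by tauto
    rcases h2 w hw' with h | ⟨q, hq, hq1, hq2, hq3⟩
    · left; grind
    · right
      refine ⟨q, Or.inl hq, by grind, by grind, ?_⟩
      have hqv : q ≠ v := fun h => hv (h ▸ hq)
      rw [if_neg hqv]
      clear h1 h2 h3
      rcases h3u with h | ⟨f, hf, hf1, hf2, hf3⟩
      · rw [if_pos h]; exact hq3
      · rw [if_neg (by omega), Function.update_apply]
        grind
  · intro u'
    simp only [Set.mem_union, Set.mem_singleton_iff, Function.update_apply] at *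
    have h3u := h3 u'
    have h3u' := h3 u
    grind

/-- The neighbours of a deleted node are linked to each other; the ranks stay. -/
theorem Buckets.delete {Q : Set ℕ} {K X P D τ : ℕ → ℕ} (h : Buckets Q K X P D τ)
    {v : ℕ} (hv : v ∈ Q) :
    Buckets (Q \ {v}) K (if P v = 0 then X else Function.update X (P v - 1) (X v))
      (if X v = 0 then P else Function.update P (X v - 1) (P v))
      (if P v = 0 then Function.update D (K v) (X v) else D) τ := by
  obtain ⟨h1, h2, h3⟩ := h
  have hX : ∀ w, (if P v = 0 then X else Function.update X (P v - 1) (X v)) w =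
      if P v = w + 1 then X v else X w := by
    intro w; split_ifs <;> grind
  have hP : ∀ w, (if X v = 0 then P else Function.update P (X v - 1) (P v)) w =
      if X v = w + 1 then P v else P w := by
    intro w; split_ifs <;> grind
  have hD : ∀ u, (if P v = 0 then Function.update D (K v) (X v) else D) u =
      if P v = 0 ∧ u = K v then X v else D u := by
    intro u; split_ifs <;> grind
  have h1v := h1 v hv
  have h2v := h2 v hv
  have h1' : ∀ w ∈ Q, P w = v + 1 → X v = w + 1 ∧ K w = K v ∧ τ w < τ v := by
    intro w hw hw'
    rcases h1 w hw with ⟨h, -⟩ | ⟨p, hp, hp1, hp2, hp3, hp4⟩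
    · omega
    · obtain rfl : p = v := by omega
      exact ⟨hp3, hp2.symm, hp4⟩
  have h2' : ∀ w ∈ Q, X w = v + 1 → P v = w + 1 ∧ K w = K v := by
    intro w hw hw'
    rcases h2 w hw with h | ⟨q, hq, hq1, hq2, hq3⟩
    · omega
    · obtain rfl : q = v := by omega
      exact ⟨hq3, hq2.symm⟩
  constructor
  · intro w hw
    simp only [hX, hP, hD]
    simp only [Set.mem_sdiff, Set.mem_singleton_iff] at *
    by_cases hwq : X v = w + 1
    · have hPw : P w = v + 1 ∧ K w = K v := by
        rcases h2v with h | ⟨q, hq, hq1, hq2, hq3⟩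
        · omega
        · obtain rfl : q = w := by omega
          exact ⟨hq3, hq2⟩
      have hτ := (h1' w hw.1 hPw.1).2.2
      rw [if_pos hwq]
      rcases h1v with ⟨h, h'⟩ | ⟨p, hp, hp1, hp2, hp3, hp4⟩
      · left
        exact ⟨h, by rw [if_pos ⟨h, hPw.2⟩, hwq]⟩
      · right
        refine ⟨p, ⟨hp, ?_⟩, hp1, by omega, by rw [if_pos hp1, hwq], by omega⟩
        rintro rfl; omega
    · rw [if_neg hwq]
      rcases h1 w hw.1 with ⟨h, h'⟩ | ⟨p, hp, hp1, hp2, hp3, hp4⟩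
      · left
        refine ⟨h, ?_⟩
        rw [if_neg, h']
        rintro ⟨hv0, hK⟩
        rcases h1v with ⟨-, h3⟩ | ⟨p, -, hp, -⟩
        · rw [hK] at h'; omega
        · omega
      · right
        refine ⟨p, ⟨hp, ?_⟩, hp1, hp2, ?_, hp4⟩
        · rintro rfl; omega
        · rw [if_neg, hp3]
          intro h
          rcases h1v with ⟨h3, -⟩ | ⟨p', hp', hp1', -, hp3', -⟩
          · omega
          · obtain rfl : p' = p := by omega
            omega
  · intro w hw
    simp only [hX, hP]
    simp only [Set.mem_sdiff, Set.mem_singleton_iff] at *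
    by_cases hwq : P v = w + 1
    · have hXw : X w = v + 1 ∧ K w = K v := by
        rcases h1v with ⟨h, -⟩ | ⟨p, hp, hp1, hp2, hp3, hp4⟩
        · omega
        · obtain rfl : p = w := by omega
          exact ⟨hp3, hp2⟩
      rw [if_pos hwq]
      rcases h2v with h | ⟨q, hq, hq1, hq2, hq3⟩
      · left; exact h
      · right
        refine ⟨q, ⟨hq, ?_⟩, hq1, by omega, by rw [if_pos hq1, hwq]⟩
        rintro rfl
        have := (h1' _ hq hq3).2.2
        omega
    · rw [if_neg hwq]
      rcases h2 w hw.1 with h | ⟨q, hq, hq1, hq2, hq3⟩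
      · left; exact h
      · right
        refine ⟨q, ⟨hq, ?_⟩, hq1, hq2, ?_⟩
        · rintro rfl; omega
        · rw [if_neg, hq3]
          intro h
          rcases h2v with h3 | ⟨q', hq', hq1', -, hq3'⟩
          · omega
          · obtain rfl : q' = q := by omega
            omega
  · intro u'
    simp only [hP, hD]
    simp only [Set.mem_sdiff, Set.mem_singleton_iff] at *
    by_cases hu : P v = 0 ∧ u' = K v
    · rw [if_pos hu]
      rcases h2v with h | ⟨q, hq, hq1, hq2, hq3⟩
      · left; exact h
      · right
        refine ⟨q, ⟨hq, ?_⟩, hq1, by rw [hq2, hu.2], by rw [if_pos hq1, hu.1]⟩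
        rintro rfl; omega
    · rw [if_neg hu]
      rcases h3 u' with h | ⟨f, hf, hf1, hf2, hf3⟩
      · left; exact h
      · right
        refine ⟨f, ⟨hf, ?_⟩, hf1, hf2, ?_⟩
        · rintro rfl
          exact hu ⟨hf3, hf2.symm⟩
        · rw [if_neg, hf3]
          intro h
          rcases h2v with h3 | ⟨q', hq', hq1', -, hq3'⟩
          · omega
          · obtain rfl : q' = f := by omega
            omega

/-! ### The approximation map -/

/-- The map of the approximate structure with precision `p`. -/
def amap (p x : ℕ) : ℕ :=
  if x = 0 then 0
  else Nat.log 2 x * 2 ^ p +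
    ((if Nat.log 2 x < p then x * 2 ^ (p - Nat.log 2 x) else x / 2 ^ (Nat.log 2 x - p)) - 2 ^ p) + 1

/-- The number that consists of the first `p + 1` bits of `x`. -/
theorem mantissa_bounds {p x : ℕ} (hx : x ≠ 0) :
    2 ^ p ≤ (if Nat.log 2 x < p then x * 2 ^ (p - Nat.log 2 x) else x / 2 ^ (Nat.log 2 x - p)) ∧
    (if Nat.log 2 x < p then x * 2 ^ (p - Nat.log 2 x) else x / 2 ^ (Nat.log 2 x - p)) <
      2 ^ (p + 1) := by
  have h1 := Nat.pow_log_le_self 2 hx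
  have h2 := Nat.lt_pow_succ_log_self (b := 2) (by norm_num) x
  set l := Nat.log 2 x
  split_ifs with h
  · have e1 : 2 ^ p = 2 ^ l * 2 ^ (p - l) := by rw [← pow_add]; congr 1; omega
    have e2 : 2 ^ (p + 1) = 2 ^ (l + 1) * 2 ^ (p - l) := by rw [← pow_add]; congr 1; omega
    have : 0 < 2 ^ (p - l) := by positivity
    rw [e1, e2]
    exact ⟨Nat.mul_le_mul_right _ h1, Nat.mul_lt_mul_of_pos_right h2 this⟩
  · have e1 : 2 ^ p * 2 ^ (l - p) = 2 ^ l := by rw [← pow_add]; congr 1; omega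
    have e2 : 2 ^ (p + 1) * 2 ^ (l - p) = 2 ^ (l + 1) := by rw [← pow_add]; congr 1; omega
    constructor
    · rw [Nat.le_div_iff_mul_le (by positivity), e1]; exact h1
    · rw [Nat.div_lt_iff_lt_mul (by positivity), e2]; exact h2

theorem amap_lt {p x L : ℕ} (hx : x < 2 ^ L) : amap p x < L * 2 ^ p + 1 := by
  by_cases h : x = 0
  · simp [amap, h]
  have hb := (mantissa_bounds (p := p) h).2
  have hl : Nat.log 2 x < L := Nat.log_lt_of_lt_pow h hx
  have := Nat.mul_le_mul_right (2 ^ p) hl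
  rw [Nat.succ_mul] at this
  rw [pow_succ] at hb
  rw [amap, if_neg h]
  omega

/-- The map is monotone up to a factor `1 + 2 ^ (-p)`, and strictly monotone below `2 ^ p`. -/
theorem le_of_amap_le {p x y : ℕ} (h : amap p x ≤ amap p y) :
    x ≤ y ∨ p ≤ Nat.log 2 y ∧ 2 ^ p * x ≤ (2 ^ p + 1) * y := by
  by_cases hx : x = 0
  · left; omega
  by_cases hy : y = 0
  · simp [amap, hx, hy] at h
  have bx := mantissa_bounds (p := p) hx
  have by' := mantissa_bounds (p := p) hy
  simp only [amap, hx, hy, if_false] at h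
  have hx1 := Nat.lt_pow_succ_log_self (b := 2) (by norm_num) x
  have hy1 := Nat.pow_log_le_self 2 hy
  generalize hlx : Nat.log 2 x = lx at *
  generalize hly : Nat.log 2 y = ly at *
  rw [pow_succ] at bx by'
  rcases lt_trichotomy lx ly with hl | hl | hl
  · left
    have : 2 ^ (lx + 1) ≤ 2 ^ ly := Nat.pow_le_pow_right (by norm_num) hl
    omega
  · subst hl
    split_ifs at * with hp
    · left
      exact Nat.le_of_mul_le_mul_right (by omega) (show 0 < 2 ^ (p - lx) by positivity)
    · right
      refine ⟨by omega, ?_⟩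
      have e1 : 2 ^ p * 2 ^ (lx - p) = 2 ^ lx := by rw [← pow_add]; congr 1; omega
      have h2 : x / 2 ^ (lx - p) ≤ y / 2 ^ (lx - p) := by omega
      have h3 : x < (y / 2 ^ (lx - p) + 1) * 2 ^ (lx - p) := by
        rw [← Nat.div_lt_iff_lt_mul (by positivity)]; omega
      have h4 := Nat.div_mul_le_self y (2 ^ (lx - p))
      have h5 : x ≤ y + 2 ^ (lx - p) := by
        rw [Nat.succ_mul] at h3; omega
      calc 2 ^ p * x ≤ 2 ^ p * (y + 2 ^ (lx - p)) := Nat.mul_le_mul_left _ h5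
        _ = 2 ^ p * y + 2 ^ lx := by rw [Nat.mul_add, e1]
        _ ≤ (2 ^ p + 1) * y := by rw [Nat.succ_mul]; omega
  · exfalso
    have := Nat.mul_le_mul_right (2 ^ p) hl
    rw [Nat.succ_mul] at this
    omega

theorem wp_approxMap {b : ℕ} {α : Type} {R : Regs} {x L : ℕ} {f : ℕ → RAM b α} {μ : ℕ → ℕ} {t : ℕ}
    {Q : α → (ℕ → ℕ) → ℕ → Prop} (hx : x < 2 ^ L) (hN : L * 2 ^ R.prec + 1 < 2 ^ b)
    (hp : R.prec + 1 < b) (h : ∀ t' ≤ t + 10, wp (f (amap R.prec x)) μ t' Q) :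
    wp (approxMap R x >>= f) μ t Q := by
  have hlt := amap_lt (p := R.prec) hx
  have hpb : 2 ^ (R.prec + 1) < 2 ^ b := Nat.pow_lt_pow_right (by norm_num) hp
  have h1 : 1 * 2 ^ R.prec < 2 ^ b := by rw [pow_succ] at hpb; omega
  rw [wp_bind]
  simp only [approxMap, ↓exec]
  refine wp_ite (fun h0 => ?_) (fun h0 => ?_)
  · simp only [↓exec]
    have := h (t + 1) (by omega)
    rwa [amap, if_pos h0] at this
  have hb := mantissa_bounds (p := R.prec) h0
  rw [amap, if_neg h0] at h hlt
  simp only [↓exec]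
  refine wp_ite (fun hl => ?_) (fun hl => ?_)
  · simp only [if_pos hl] at h hlt hb
    simp (disch := omega) only [↓exec, one_mul]
    exact h _ (by omega)
  · simp only [if_neg hl] at h hlt hb
    simp (disch := omega) only [↓exec, one_mul]
    exact h _ (by omega)

/-! ### The queue in memory -/

/-- The arrays of the program are disjoint and fit into the memory. The distances have at most `L`
bits, and their images are less than `N`. -/
structure Layout (b : ℕ) (R : Regs) (N L : ℕ) : Prop where
  dist_le : R.dist + R.n ≤ R.done
  done_le : R.done + R.n ≤ R.key
  key_le : R.key + R.n ≤ R.onext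
  onext_le : R.onext + (R.n + 1) ≤ R.oprev
  oprev_le : R.oprev + (R.n + 1) ≤ R.szTab
  szTab_le : R.szTab + R.level ≤ R.dict
  dict_le : R.dict + N ≤ R.bnext
  bnext_le : R.bnext + (N + 1) ≤ R.bprev
  bprev_le : R.bprev + (N + 1) ≤ R.root
  fits : Fits b R R.level R.root
  le_uni : N ≤ uni R.beta R.level
  N_eq : N = L * 2 ^ R.prec + 1
  prec_lt : R.prec + 1 < b

/-- The memory represents the queue of the nodes in `Q` with the mapped keys `K`, where `X`, `P`,
`D`, `BX`, `BP` are the contents of the arrays of the queue. -/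
structure QRep (R : Regs) (N : ℕ) (Q : Set ℕ) (K X P D τ BX BP : ℕ → ℕ) (μ : ℕ → ℕ) : Prop where
  tab : Tab R R.level μ
  lt : ∀ v ∈ Q, v < R.n
  key : ∀ v ∈ Q, μ (R.key + v) = K v
  next : ∀ v < R.n, μ (R.onext + (v + 1)) = X v
  prev : ∀ v < R.n, μ (R.oprev + (v + 1)) = P v
  dict : ∀ u < N, μ (R.dict + u) = D u
  dict_zero : ∀ u, N ≤ u → D u = 0
  buckets : Buckets Q K X P D τ
  bnext : ∀ e ≤ N, μ (R.bnext + e) = BX e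
  bprev : ∀ e, e ≠ 0 → e ≤ N → μ (R.bprev + e) = BP e
  olist : OList {u | D u ≠ 0} BX BP
  rep : Rep R.beta R.level R.root {u | D u ≠ 0} μ

/-- The memory represents the queue of the nodes in `Q` with the mapped keys `K`. -/
def QInv (R : Regs) (N : ℕ) (Q : Set ℕ) (K : ℕ → ℕ) (μ : ℕ → ℕ) : Prop :=
  ∃ X P D τ BX BP, QRep R N Q K X P D τ BX BP μ

section Queue

variable {b : ℕ} {R : Regs} {N L : ℕ} {Q : Set ℕ} {K : ℕ → ℕ} {μ : ℕ → ℕ}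

theorem QRep.key_lt {X P D τ BX BP : ℕ → ℕ} (h : QRep R N Q K X P D τ BX BP μ) {v : ℕ}
    (hv : v ∈ Q) : K v < N := by
  by_contra hN
  exact h.buckets.head_ne h.lt hv (h.dict_zero _ (by omega))

theorem QInv.congr_key {K' : ℕ → ℕ} (h : QInv R N Q K μ) (hK : ∀ v ∈ Q, K' v = K v) :
    QInv R N Q K' μ := by
  obtain ⟨X, P, D, τ, BX, BP, h⟩ := h
  refine ⟨X, P, D, τ, BX, BP, { h with
    key := fun v hv => (h.key v hv).trans (hK v hv).symm
    buckets := ⟨fun v hv => ?_, fun v hv => ?_, fun u => ?_⟩ }⟩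
  · rw [hK v hv]
    rcases h.buckets.prev v hv with h1 | ⟨p, hp, h1, h2, h3⟩
    · exact Or.inl h1
    · exact Or.inr ⟨p, hp, h1, by rw [hK p hp, h2], h3⟩
  · rcases h.buckets.next v hv with h1 | ⟨p, hp, h1, h2, h3⟩
    · exact Or.inl h1
    · exact Or.inr ⟨p, hp, h1, by rw [hK p hp, hK v hv, h2], h3⟩
  · rcases h.buckets.head u with h1 | ⟨p, hp, h1, h2, h3⟩
    · exact Or.inl h1
    · exact Or.inr ⟨p, hp, h1, by rw [hK p hp, h2], h3⟩

theorem QInv.lt (h : QInv R N Q K μ) {v : ℕ} (hv : v ∈ Q) : v < R.n := by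
  obtain ⟨X, P, D, τ, BX, BP, h⟩ := h
  exact h.lt v hv

theorem QInv.frame {μ' : ℕ → ℕ} (hL : Layout b R N L) (h : QInv R N Q K μ)
    (hμ : ∀ i, R.key ≤ i → μ' i = μ i) : QInv R N Q K μ' := by
  obtain ⟨X, P, D, τ, BX, BP, h⟩ := h
  obtain ⟨l1, l2, l3, l4, l5, l6, l7, l8, l9, l10, l11, l12⟩ := hL
  have := l10.tab_le
  refine ⟨X, P, D, τ, BX, BP, { h with
    tab := fun i hi => by rw [hμ _ (by omega)]; exact h.tab i hi
    key := fun v hv => by rw [hμ _ (by omega)]; exact h.key v hv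
    next := fun v hv => by rw [hμ _ (by omega)]; exact h.next v hv
    prev := fun v hv => by rw [hμ _ (by omega)]; exact h.prev v hv
    dict := fun v hv => by rw [hμ _ (by omega)]; exact h.dict v hv
    bnext := fun v hv => by rw [hμ _ (by omega)]; exact h.bnext v hv
    bprev := fun v h0 hv => by rw [hμ _ (by omega)]; exact h.bprev v h0 hv
    rep := h.rep.congr fun i h1 _ => hμ i (by omega) }⟩

/-- `minimum` returns a node with the least mapped key: the first one of the bucket of the first
element of the ordered list. -/
theorem wp_minimum (hL : Layout b R N L) (h : QInv R N Q K μ) :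
    wp (minimum R : RAM b ℕ) μ 0 (fun r μ' t => μ' = μ ∧ t ≤ 10 ∧
      ((r = 0 ∧ Q = ∅) ∨ ∃ f ∈ Q, r = f + 1 ∧ ∀ v ∈ Q, K f ≤ K v)) := by
  obtain ⟨X, P, D, τ, BX, BP, h⟩ := h
  obtain ⟨l1, l2, l3, l4, l5, l6, l7, l8, l9, l10, l11, l12⟩ := hL
  have l13 := l10.end_le
  have hmin := h.olist.next 0 (Or.inl rfl)
  rw [← h.bnext 0 (Nat.zero_le _), Nat.add_zero] at hmin
  simp only [Nat.zero_le, and_true, Set.mem_ofPred_eq] at hmin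
  simp only [minimum, ↓exec]
  refine wp_ite (fun h0 => ?_) (fun h0 => ?_)
  · simp only [↓exec]
    refine ⟨trivial, by omega, Or.inl ⟨trivial, Set.eq_empty_of_forall_notMem fun v hv => ?_⟩⟩
    have := hmin.eq_zero_iff.1 h0
    have hv' := h.buckets.head_ne h.lt hv
    have : K v ∈ {x | D x ≠ 0} := hv'
    simp_all
  · obtain ⟨u, hu, hum⟩ := hmin.of_ne h0
    have hu0 : D u ≠ 0 := hu.1
    have huN : u < N := by
      by_contra hN
      exact hu0 (h.dict_zero _ (by omega))
    simp (disch := omega) only [↓exec, hum, Nat.add_sub_cancel]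
    refine ⟨trivial, by omega, Or.inr ?_⟩
    obtain ⟨f, hf, hf1, hf2, -⟩ := (h.buckets.head u).resolve_left hu0
    refine ⟨f, hf, by rw [h.dict u huN, hf1], fun v hv => ?_⟩
    rw [hf2]
    exact hu.2 (h.buckets.head_ne h.lt hv)

end Queue

/-! ### Insertion into and deletion from the queue -/

section Queue

variable {b : ℕ} {R : Regs} {N L : ℕ} {Q : Set ℕ} {K : ℕ → ℕ} {μ : ℕ → ℕ}

theorem support_update_ne (D : ℕ → ℕ) (u m : ℕ) (hm : m ≠ 0) :
    {w | Function.update D u m w ≠ 0} = {w | D w ≠ 0} ∪ {u} := by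
  ext w
  simp only [Set.mem_ofPred_eq, Set.mem_union, Set.mem_singleton_iff, Function.update_apply]
  by_cases h : w = u <;> simp [h, hm]

theorem support_update_zero (D : ℕ → ℕ) (u : ℕ) :
    {w | Function.update D u 0 w ≠ 0} = {w | D w ≠ 0} \ {u} := by
  ext w
  simp only [Set.mem_ofPred_eq, Set.mem_sdiff, Set.mem_singleton_iff, Function.update_apply]
  by_cases h : w = u <;> simp [h]

/-- `insert` is correct. It makes at most one search and one insertion in the exact structure. -/
theorem wp_insert (hL : Layout b R N L) (h : QInv R N Q K μ) {v x : ℕ} (hv : v < R.n)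
    (hvQ : v ∉ Q) (hx : x < 2 ^ L) :
    wp (ApproxVEB.insert R x v : RAM b Unit) μ 0 (fun _ μ' t =>
      QInv R N (Q ∪ {v}) (Function.update K v (amap R.prec x)) μ' ∧
      (∀ i < R.key, μ' i = μ i) ∧ t ≤ 300 * (R.level + 1)) := by
  obtain ⟨X, P, D, τ, BX, BP, h⟩ := h
  obtain ⟨l1, l2, l3, l4, l5, l6, l7, l8, l9, l10, l11, l12, l13⟩ := hL
  have l14 := l10.end_le
  have l15 := l10.tab_le
  have hu := amap_lt (p := R.prec) hx
  rw [← l12] at hu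
  simp only [ApproxVEB.insert, ↓exec]
  refine wp_approxMap hx (by omega) l13 fun t₀ ht₀ => ?_
  generalize amap R.prec x = u at *
  have hDu := h.dict u hu
  simp (disch := omega) only [↓exec]
  have e0 : Function.update μ (R.key + v) u (R.dict + u) = D u := by
    rw [Function.update_of_ne (by omega), hDu]
  rw [e0]
  obtain ⟨τ', hB⟩ := h.buckets.insert h.lt hvQ u
  -- the stores that put `v` at the head of its bucket
  have tail : ∀ ν t' BX' BP', t' ≤ 290 * (R.level + 1) → (∀ i < R.key, ν i = μ i) →
      Tab R R.level ν → ν (R.key + v) = u → (∀ w ∈ Q, ν (R.key + w) = μ (R.key + w)) →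
      (∀ w < R.n, ν (R.onext + (w + 1)) = μ (R.onext + (w + 1))) →
      (∀ w < R.n, ν (R.oprev + (w + 1)) =
        (if D u = 0 then P else Function.update P (D u - 1) (v + 1)) w) →
      (∀ w < N, ν (R.dict + w) = μ (R.dict + w)) → (∀ e ≤ N, ν (R.bnext + e) = BX' e) →
      (∀ e, e ≠ 0 → e ≤ N → ν (R.bprev + e) = BP' e) → OList ({u | D u ≠ 0} ∪ {u}) BX' BP' →
      Rep R.beta R.level R.root ({u | D u ≠ 0} ∪ {u}) ν →
      wp (do
        store (← add R.onext (v + 1)) (D u)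
        store (← add R.oprev (v + 1)) 0
        store (← add R.dict u) (v + 1) : RAM b Unit) ν t' (fun _ μ' t =>
      QInv R N (Q ∪ {v}) (Function.update K v u) μ' ∧
      (∀ i < R.key, μ' i = μ i) ∧ t ≤ 300 * (R.level + 1)) := by
    intro ν t' BX' BP' ht' c1 c2 c3 c4 c5 c6 c7 c8 c9 c10 c11
    simp (disch := omega) only [↓exec]
    have hfr : ∀ i, i ≠ R.onext + (v + 1) → i ≠ R.oprev + (v + 1) → i ≠ R.dict + u →
        Function.update (Function.update (Function.update ν (R.onext + (v + 1)) (D u))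
          (R.oprev + (v + 1)) 0) (R.dict + u) (v + 1) i = ν i := by
      intro i i1 i2 i3
      rw [Function.update_of_ne i3, Function.update_of_ne i2, Function.update_of_ne i1]
    refine ⟨⟨Function.update X v (D u),
      Function.update (if D u = 0 then P else Function.update P (D u - 1) (v + 1)) v 0,
      Function.update D u (v + 1), τ', BX', BP', ?_⟩, ?_, by omega⟩
    · refine ⟨?_, ?_, ?_, ?_, ?_, ?_, ?_, hB, ?_, ?_, ?_, ?_⟩
      · intro i hi
        rw [hfr _ (by omega) (by omega) (by omega)]; exact c2 i hi
      · rintro w (hw | rfl)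
        · exact h.lt w hw
        · exact hv
      · rintro w (hw | hw)
        · have hw1 := h.lt w hw
          rw [hfr _ (by omega) (by omega) (by omega), c4 w hw, h.key w hw,
            Function.update_of_ne (by rintro rfl; exact hvQ hw)]
        · obtain rfl : w = v := hw
          rw [hfr _ (by omega) (by omega) (by omega), Function.update_self, c3]
      · intro w hw
        by_cases hwv : w = v
        · subst hwv
          rw [Function.update_of_ne (by omega), Function.update_of_ne (by omega),
            Function.update_self, Function.update_self]
        · rw [hfr _ (by omega) (by omega) (by omega), Function.update_of_ne hwv, c5 w hw,
            h.next w hw]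
      · intro w hw
        by_cases hwv : w = v
        · subst hwv
          rw [Function.update_of_ne (by omega), Function.update_self, Function.update_self]
        · rw [hfr _ (by omega) (by omega) (by omega), Function.update_of_ne hwv, c6 w hw]
      · intro w hw
        by_cases hwu : w = u
        · subst hwu
          rw [Function.update_self, Function.update_self]
        · rw [hfr _ (by omega) (by omega) (by omega), Function.update_of_ne hwu, c7 w hw,
            h.dict w hw]
      · intro w hw
        rw [Function.update_of_ne (by omega)]; exact h.dict_zero w hw
      · intro e he
        rw [hfr _ (by omega) (by omega) (by omega), c8 e he]
      · intro e he0 he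
        rw [hfr _ (by omega) (by omega) (by omega), c9 e he0 he]
      · rw [support_update_ne _ _ _ (by omega)]; exact c10
      · rw [support_update_ne _ _ _ (by omega)]
        exact c11.congr fun i i1 i2 => hfr i (by omega) (by omega) (by omega)
    · intro i hi
      rw [hfr _ (by omega) (by omega) (by omega), c1 i hi]
  refine wp_ite (fun h0 => ?_) (fun h0 => ?_)
  · simp only [h0, if_true] at tail ⊢
    have huS : u ∉ {w | D w ≠ 0} := by simp [h0]
    have hT1 : Tab R R.level (Function.update μ (R.key + v) u) := fun i hi => by
      rw [Function.update_of_ne (by omega)]; exact h.tab i hi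
    have hR1 : Rep R.beta R.level R.root {w | D w ≠ 0} (Function.update μ (R.key + v) u) :=
      h.rep.congr fun i i1 i2 => Function.update_of_ne (by omega) _ _
    refine wp_call (wp_vebSearch l10 hT1 hR1 (i := u) (by omega)) ?_
    rintro p _ t₁ ⟨rfl, hp, ht₁⟩
    have hpu : p ≤ u := by
      rcases hp with ⟨-, rfl⟩ | ⟨y, hy, rfl⟩
      · omega
      · have : y ≤ u := hy.1.2
        have : y ≠ u := fun e => huS (e ▸ hy.1.1)
        omega
    simp (disch := omega) only [↓exec]
    have e1 : Function.update μ (R.key + v) u (R.bnext + p) = BX p := by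
      rw [Function.update_of_ne (by omega), h.bnext p (by omega)]
    rw [e1]
    have hq : BX p ≤ N := by
      have := h.olist.next p (by
        rcases hp with ⟨-, rfl⟩ | ⟨y, hy, rfl⟩
        · exact Or.inl rfl
        · exact Or.inr hy.1.1)
      rcases this with ⟨-, hz⟩ | ⟨y, hy, hz⟩
      · omega
      · have hy0 : D y ≠ 0 := hy.1.1
        by_contra hN
        exact hy0 (h.dict_zero y (by omega))
    have hO := h.olist.insert huS hp
    simp (disch := omega) only [↓exec]
    set ν := Function.update (Function.update (Function.update (Function.update (Function.update μ
      (R.key + v) u) (R.bnext + (u + 1)) (BX p)) (R.bprev + (u + 1)) p) (R.bnext + p) (u + 1))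
      (R.bprev + BX p) (u + 1) with hν
    have hν1 : ∀ i, i < R.bnext ∨ R.root ≤ i → ν i = Function.update μ (R.key + v) u i := by
      intro i hi
      rw [hν, Function.update_of_ne (by omega), Function.update_of_ne (by omega),
        Function.update_of_ne (by omega), Function.update_of_ne (by omega)]
    have hν2 : ∀ e ≤ N, ν (R.bnext + e) =
        Function.update (Function.update BX (u + 1) (BX p)) p (u + 1) e := by
      intro e he
      have := h.bnext e he
      simp only [hν, Function.update_apply]
      split_ifs <;> omega
    have hν3 : ∀ e, e ≠ 0 → e ≤ N → ν (R.bprev + e) =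
        Function.update (Function.update BP (u + 1) p) (BX p) (u + 1) e := by
      intro e he0 he
      have := h.bprev e he0 he
      simp only [hν, Function.update_apply]
      split_ifs <;> omega
    clear_value ν
    have hT2 : Tab R R.level ν := fun i hi => by rw [hν1 _ (by omega)]; exact hT1 i hi
    have hR2 := hR1.congr fun i i1 i2 => hν1 i (by omega)
    refine wp_call (insertSpec b R R.level _ _ _ _ l10 hT2 hR2 huS (by omega)) ?_
    rintro _ ν' t₂ ⟨r3, f3, ht₂, -⟩
    have hν' : ∀ i < R.bnext, ν' i = Function.update μ (R.key + v) u i := fun i hi =>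
      (f3 i (by omega)).trans (hν1 i (by omega))
    refine tail ν' _ _ _ (by omega) ?_ ?_ ?_ ?_ ?_ ?_ ?_ ?_ ?_ hO r3
    · intro i hi
      rw [hν' i (by omega), Function.update_of_ne (by omega)]
    · intro i hi
      rw [hν' _ (by omega)]; exact hT1 i hi
    · rw [hν' _ (by omega), Function.update_self]
    · intro w hw
      have := h.lt w hw
      have : w ≠ v := by rintro rfl; exact hvQ hw
      rw [hν' _ (by omega), Function.update_of_ne (by omega)]
    · intro w hw
      rw [hν' _ (by omega), Function.update_of_ne (by omega)]
    · intro w hw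
      rw [hν' _ (by omega), Function.update_of_ne (by omega), h.prev w hw]
    · intro w hw
      rw [hν' _ (by omega), Function.update_of_ne (by omega)]
    · intro e he
      rw [f3 _ (by omega), hν2 e he]
    · intro e he0 he
      rw [f3 _ (by omega), hν3 e he0 he]
  · obtain ⟨f, hf, hf1, -, -⟩ := (h.buckets.head u).resolve_left h0
    have hfn := h.lt f hf
    have hS : {w | D w ≠ 0} ∪ {u} = {w | D w ≠ 0} :=
      Set.union_eq_left.2 (Set.singleton_subset_iff.2 h0)
    simp only [hf1, Nat.succ_ne_zero, if_false, hS, Nat.add_sub_cancel] at tail ⊢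
    simp (disch := omega) only [↓exec]
    have hfr : ∀ i, i ≠ R.key + v → i ≠ R.oprev + (f + 1) →
        Function.update (Function.update μ (R.key + v) u) (R.oprev + (f + 1)) (v + 1) i = μ i :=
      fun i i1 i2 => by rw [Function.update_of_ne i2, Function.update_of_ne i1]
    have tail := tail
      (Function.update (Function.update μ (R.key + v) u) (R.oprev + (f + 1)) (v + 1))
      (t₀ + 1 + 1 + 1 + 1 + 1 + 1 + 1 + 1 + 1) BX BP (by omega)
      (fun i hi => hfr i (by omega) (by omega))
      (fun i hi => by rw [hfr _ (by omega) (by omega)]; exact h.tab i hi)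
      (by rw [Function.update_of_ne (by omega), Function.update_self])
      (fun w hw => by
        have := h.lt w hw
        have : w ≠ v := by rintro rfl; exact hvQ hw
        rw [hfr _ (by omega) (by omega)])
      (fun w hw => by rw [hfr _ (by omega) (by omega)])
      (fun w hw => by
        have := h.prev w hw
        simp only [Function.update_apply]
        split_ifs <;> omega)
      (fun w hw => by rw [hfr _ (by omega) (by omega)])
      (fun e he => by rw [hfr _ (by omega) (by omega), h.bnext e he])
      (fun e he0 he => by rw [hfr _ (by omega) (by omega), h.bprev e he0 he])
      h.olist
      (h.rep.congr fun i i1 i2 => hfr i (by omega) (by omega))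
    simp (disch := omega) only [↓exec] at tail
    exact tail

/-- `delete` is correct. It makes at most one deletion in the exact structure. -/
theorem wp_delete (hL : Layout b R N L) (h : QInv R N Q K μ) {v : ℕ} (hvQ : v ∈ Q) :
    wp (ApproxVEB.delete R v : RAM b Unit) μ 0 (fun _ μ' t =>
      QInv R N (Q \ {v}) K μ' ∧ (∀ i < R.key, μ' i = μ i) ∧ t ≤ 300 * (R.level + 1)) := by
  obtain ⟨X, P, D, τ, BX, BP, h⟩ := h
  obtain ⟨l1, l2, l3, l4, l5, l6, l7, l8, l9, l10, l11, l12, l13⟩ := hL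
  have l14 := l10.end_le
  have l15 := l10.tab_le
  have hv := h.lt v hvQ
  have hu := h.key_lt hvQ
  have hB := h.buckets.delete hvQ
  have hXv := h.buckets.next v hvQ
  have hPv := h.buckets.prev v hvQ
  have hXn : X v ≤ R.n := by
    rcases hXv with h0 | ⟨q, hq, h1, -⟩
    · omega
    · have := h.lt q hq
      omega
  have hPn : P v ≤ R.n := by
    rcases hPv with ⟨h0, -⟩ | ⟨q, hq, h1, -⟩
    · omega
    · have := h.lt q hq
      omega
  simp (disch := omega) only [ApproxVEB.delete, ↓exec, h.key v hvQ, h.next v hv, h.prev v hv]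
  generalize hP' : (if X v = 0 then P else Function.update P (X v - 1) (P v)) = P' at *
  -- the stores after the backward link of the successor of `v` has been corrected
  have tail : ∀ ν t', t' ≤ 20 → (∀ i, i < R.oprev ∨ R.szTab ≤ i → ν i = μ i) →
      (∀ w < R.n, ν (R.oprev + (w + 1)) = P' w) →
      wp (do
        if ← eq (P v) 0 then
          store (← add R.dict (K v)) (X v)
          if ← eq (X v) 0 then
            let q' ← load (← add R.bnext (K v + 1))
            let p' ← load (← add R.bprev (K v + 1))
            store (← add R.bnext p') q'
            store (← add R.bprev q') p'
            vebDelete R R.level R.root (K v)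
        else store (← add R.onext (P v)) (X v) : RAM b Unit) ν t' (fun _ μ' t =>
      QInv R N (Q \ {v}) K μ' ∧ (∀ i < R.key, μ' i = μ i) ∧ t ≤ 300 * (R.level + 1)) := by
    intro ν t' ht' c1 c2
    simp only [↓exec]
    refine wp_ite (fun hp => ?_) (fun hp => ?_)
    · simp only [hp, if_true] at hB
      have hDu : D (K v) = v + 1 := by
        rcases hPv with ⟨-, h1⟩ | ⟨p, -, h1, -⟩
        · exact h1
        · omega
      simp (disch := omega) only [↓exec]
      refine wp_ite (fun hq => ?_) (fun hq => ?_)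
      · have huS : K v ∈ {w | D w ≠ 0} := by simp [hDu]
        have hO := h.olist.delete huS
        rw [hq] at hB ⊢
        have e1 : Function.update ν (R.dict + K v) 0 (R.bnext + (K v + 1)) = BX (K v + 1) := by
          rw [Function.update_of_ne (by omega), c1 _ (by omega), h.bnext _ (by omega)]
        have e2 : Function.update ν (R.dict + K v) 0 (R.bprev + (K v + 1)) = BP (K v + 1) := by
          rw [Function.update_of_ne (by omega), c1 _ (by omega), h.bprev _ (by omega) (by omega)]
        have hBX : BX (K v + 1) ≤ N := by
          rcases h.olist.next (K v + 1) (Or.inr huS) with ⟨-, hz⟩ | ⟨y, hy, hz⟩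
          · omega
          · have hy0 : D y ≠ 0 := hy.1.1
            by_contra hN
            exact hy0 (h.dict_zero y (by omega))
        have hBP : BP (K v + 1) ≤ N := by
          rcases h.olist.prev (K v) huS with ⟨-, hz⟩ | ⟨y, hy, hz⟩
          · omega
          · have hy0 : D y ≠ 0 := hy.1.1
            by_contra hN
            exact hy0 (h.dict_zero y (by omega))
        simp (disch := omega) only [↓exec, e1, e2]
        set ν' := Function.update (Function.update (Function.update ν (R.dict + K v) 0)
          (R.bnext + BP (K v + 1)) (BX (K v + 1))) (R.bprev + BX (K v + 1)) (BP (K v + 1)) with hν'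
        have hν1 : ∀ i, i < R.dict ∨ R.root ≤ i → ν' i = ν i := by
          intro i hi
          rw [hν', Function.update_of_ne (by omega), Function.update_of_ne (by omega),
            Function.update_of_ne (by omega)]
        have hν2 : ∀ u < N, ν' (R.dict + u) = Function.update D (K v) 0 u := by
          intro u hu
          have := (c1 (R.dict + u) (by omega)).trans (h.dict u hu)
          simp only [hν', Function.update_apply]
          split_ifs <;> omega
        have hν3 : ∀ e ≤ N, ν' (R.bnext + e) =
            Function.update BX (BP (K v + 1)) (BX (K v + 1)) e := by
          intro e he
          have := (c1 (R.bnext + e) (by omega)).trans (h.bnext e he)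
          simp only [hν', Function.update_apply]
          split_ifs <;> omega
        have hν4 : ∀ e, e ≠ 0 → e ≤ N → ν' (R.bprev + e) =
            Function.update BP (BX (K v + 1)) (BP (K v + 1)) e := by
          intro e he0 he
          have := (c1 (R.bprev + e) (by omega)).trans (h.bprev e he0 he)
          simp only [hν', Function.update_apply]
          split_ifs <;> omega
        clear_value ν'
        have hT2 : Tab R R.level ν' := fun i hi => by
          rw [hν1 _ (by omega), c1 _ (by omega)]; exact h.tab i hi
        have hR2 := h.rep.congr (μ' := ν') fun i i1 i2 =>
          (hν1 i (by omega)).trans (c1 i (by omega))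
        refine wp_mono (deleteSpec b R R.level _ _ _ _ l10 hT2 hR2 huS) ?_
        rintro _ ν'' t₂ ⟨r3, f3, ht₂, -⟩
        refine ⟨⟨_, P', Function.update D (K v) 0, τ,
          Function.update BX (BP (K v + 1)) (BX (K v + 1)),
          Function.update BP (BX (K v + 1)) (BP (K v + 1)),
          ⟨?_, fun w hw => h.lt w hw.1, ?_, ?_, ?_, ?_, ?_, hB, ?_, ?_, ?_, ?_⟩⟩, ?_, by omega⟩
        · intro i hi
          rw [f3 _ (by omega)]; exact hT2 i hi
        · intro w hw
          have := h.lt w hw.1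
          rw [f3 _ (by omega), hν1 _ (by omega), c1 _ (by omega), h.key w hw.1]
        · intro w hw
          rw [f3 _ (by omega), hν1 _ (by omega), c1 _ (by omega), h.next w hw]
        · intro w hw
          rw [f3 _ (by omega), hν1 _ (by omega), c2 _ (by omega)]
        · intro w hw
          rw [f3 _ (by omega), hν2 _ hw]
        · intro w hw
          rw [Function.update_of_ne (by omega)]; exact h.dict_zero w hw
        · intro e he
          rw [f3 _ (by omega), hν3 _ he]
        · intro e he0 he
          rw [f3 _ (by omega), hν4 _ he0 he]
        · rw [support_update_zero]; exact hO
        · rw [support_update_zero]; exact r3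
        · intro i hi
          rw [f3 _ (by omega), hν1 _ (by omega), c1 _ (by omega)]
      · simp only [↓exec]
        have hS : {w | Function.update D (K v) (X v) w ≠ 0} = {w | D w ≠ 0} := by
          rw [support_update_ne _ _ _ hq]
          exact Set.union_eq_left.2 (Set.singleton_subset_iff.2
            (by rw [Set.mem_ofPred_eq, hDu]; omega))
        have hfr : ∀ i, i ≠ R.dict + K v → (i < R.oprev ∨ R.szTab ≤ i) →
            Function.update ν (R.dict + K v) (X v) i = μ i := fun i i1 i2 => by
          rw [Function.update_of_ne i1, c1 i i2]
        refine ⟨⟨X, P', Function.update D (K v) (X v), τ, BX, BP,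
          ⟨?_, fun w hw => h.lt w hw.1, ?_, ?_, ?_, ?_, ?_, hB, ?_, ?_, ?_, ?_⟩⟩, ?_, by omega⟩
        · intro i hi
          rw [hfr _ (by omega) (by omega)]; exact h.tab i hi
        · intro w hw
          have := h.lt w hw.1
          rw [hfr _ (by omega) (by omega), h.key w hw.1]
        · intro w hw
          rw [hfr _ (by omega) (by omega), h.next w hw]
        · intro w hw
          rw [Function.update_of_ne (by omega), c2 _ hw]
        · intro w hw
          by_cases hwu : w = K v
          · subst hwu
            rw [Function.update_self, Function.update_self]
          · rw [hfr _ (by omega) (by omega), Function.update_of_ne hwu, h.dict w hw]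
        · intro w hw
          rw [Function.update_of_ne (by omega)]; exact h.dict_zero w hw
        · intro e he
          rw [hfr _ (by omega) (by omega), h.bnext e he]
        · intro e he0 he
          rw [hfr _ (by omega) (by omega), h.bprev e he0 he]
        · rw [hS]; exact h.olist
        · rw [hS]; exact h.rep.congr fun i i1 i2 => hfr i (by omega) (by omega)
        · intro i hi
          rw [hfr _ (by omega) (by omega)]
    · simp only [hp, if_false] at hB
      simp (disch := omega) only [↓exec]
      have hfr : ∀ i, i ≠ R.onext + P v → (i < R.oprev ∨ R.szTab ≤ i) →
          Function.update ν (R.onext + P v) (X v) i = μ i := fun i i1 i2 => by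
        rw [Function.update_of_ne i1, c1 i i2]
      refine ⟨⟨_, P', D, τ, BX, BP,
        ⟨?_, fun w hw => h.lt w hw.1, ?_, ?_, ?_, ?_, h.dict_zero, hB, ?_, ?_, h.olist, ?_⟩⟩, ?_,
        by omega⟩
      · intro i hi
        rw [hfr _ (by omega) (by omega)]; exact h.tab i hi
      · intro w hw
        have := h.lt w hw.1
        rw [hfr _ (by omega) (by omega), h.key w hw.1]
      · intro w hw
        have := (c1 (R.onext + (w + 1)) (by omega)).trans (h.next w hw)
        simp only [Function.update_apply]
        split_ifs <;> omega
      · intro w hw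
        rw [Function.update_of_ne (by omega), c2 _ hw]
      · intro w hw
        rw [hfr _ (by omega) (by omega), h.dict w hw]
      · intro e he
        rw [hfr _ (by omega) (by omega), h.bnext e he]
      · intro e he0 he
        rw [hfr _ (by omega) (by omega), h.bprev e he0 he]
      · exact h.rep.congr fun i i1 i2 => hfr i (by omega) (by omega)
      · intro i hi
        rw [hfr _ (by omega) (by omega)]
  refine wp_ite (fun hq => ?_) (fun hq => ?_)
  · have key := tail μ (0 + 1 + 1 + 1 + 1 + 1 + 1 + 1 + 1 + 1 + 1) (by omega) (fun i _ => rfl)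
      (fun w hw => by rw [h.prev w hw, ← hP', if_pos hq])
    exact key
  · simp (disch := omega) only [↓exec]
    have key := tail (Function.update μ (R.oprev + X v) (P v))
      (0 + 1 + 1 + 1 + 1 + 1 + 1 + 1 + 1 + 1 + 1 + 1 + 1) (by omega)
      (fun i _ => Function.update_of_ne (by omega) _ _)
      (fun w hw => by
        have := h.prev w hw
        rw [← hP', if_neg hq]
        simp only [Function.update_apply]
        split_ifs <;> omega)
    simp only [↓exec] at key
    exact key

end Queue

/-! ### The invariant of Dijkstra's algorithm -/

/-- The input arrays hold the adjacency lists of `G`. -/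
structure Input {n : ℕ} (G : WGraph n) (R : Regs) (μ : ℕ → ℕ) : Prop where
  n_eq : R.n = n
  first : ∀ v : Fin n, μ (R.off + v) = (G.arcsUpTo v).length
  off_le : R.off + (n + 1) ≤ R.tgt
  tgt_le : R.tgt + G.numArcs ≤ R.wt
  wt_le : R.wt + G.numArcs ≤ R.dist
  end_le : ∀ v : Fin n, μ (R.off + v) + (G.adj v).length ≤ G.numArcs
  off : ∀ v : Fin n, μ (R.off + v + 1) = μ (R.off + v) + (G.adj v).length
  tgt : ∀ (v : Fin n) (k : ℕ) (h : k < (G.adj v).length),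
    μ (R.tgt + (μ (R.off + v) + k)) = ((G.adj v)[k]).1
  wt : ∀ (v : Fin n) (k : ℕ) (h : k < (G.adj v).length),
    μ (R.wt + (μ (R.off + v) + k)) = ((G.adj v)[k]).2

theorem Input.frame {n : ℕ} {G : WGraph n} {R : Regs} {μ μ' : ℕ → ℕ} (h : Input G R μ)
    (hμ : ∀ i < R.dist, μ' i = μ i) : Input G R μ' := by
  obtain ⟨h1, h0, h2, h3, h4, h5, h6, h7, h8⟩ := h
  have e : ∀ v : Fin n, μ' (R.off + v) = μ (R.off + v) := fun v => hμ _ (by omega)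
  refine ⟨h1, fun v => by rw [e]; exact h0 v, h2, h3, h4, fun v => by rw [e]; exact h5 v,
    fun v => ?_, fun v k hk => ?_, fun v k hk => ?_⟩
  · rw [e, hμ _ (by omega)]; exact h6 v
  · have := h5 v
    rw [e, hμ _ (by omega)]; exact h7 v k hk
  · have := h5 v
    rw [e, hμ _ (by omega)]; exact h8 v k hk

/-- The conditions on the parameters: the weights are at most `U`, distances up to `n * U` are
words of at most `L` bits, and comparing mapped distances costs at most a factor `ρ`. -/
structure Setting {n : ℕ} (b : ℕ) (G : WGraph n) (R : Regs) (U N L : ℕ) (ρ : ℝ) : Prop where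
  layout : Layout b R N L
  weights : G.WeightsLE U
  lt_pow : n * U < 2 ^ L
  lt_word : n * U + 1 < 2 ^ b
  one_le : 1 ≤ ρ
  approx : ∀ x y, y ≤ n * U → amap R.prec x ≤ amap R.prec y → (x : ℝ) ≤ ρ * y

/-- The nodes in the queue: those that have a distance and have not been scanned. -/
def queued {n : ℕ} (R : Regs) (Dn : Finset (Fin n)) (μ : ℕ → ℕ) : Set ℕ :=
  {v | ∃ h : v < n, (⟨v, h⟩ : Fin n) ∉ Dn ∧ μ (R.dist + v) ≠ 0}

/-- The mapped distances. -/
def keys (R : Regs) (μ : ℕ → ℕ) (v : ℕ) : ℕ := amap R.prec (μ (R.dist + v) - 1)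

/-- The invariant of Dijkstra's algorithm, where `Dn` is the set of scanned nodes and `A v` lists
the arcs that leave `v` and have been relaxed if `v` is scanned. A scanned node has a distance that
exceeds the length of any walk to it by a factor of at most `ρ` to the number of scanned nodes. -/
structure DInv {n : ℕ} (G : WGraph n) (s : Fin n) (R : Regs) (U N : ℕ) (ρ : ℝ)
    (Dn : Finset (Fin n)) (A : Fin n → List (Fin n × ℕ)) (μ : ℕ → ℕ) : Prop where
  input : Input G R μ
  source : μ (R.dist + s) = 1
  walk : ∀ v : Fin n, μ (R.dist + v) ≠ 0 → G.Walk s v (μ (R.dist + v) - 1)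
  le : ∀ v : Fin n, μ (R.dist + v) ≤ Dn.card * U + 1
  done_le : ∀ v ∈ Dn, μ (R.dist + v) + U ≤ Dn.card * U + 1
  mark : ∀ v : Fin n, μ (R.done + v) = if v ∈ Dn then 1 else 0
  reached : ∀ v ∈ Dn, μ (R.dist + v) ≠ 0
  approx : ∀ v ∈ Dn, ∀ l, G.Walk s v l →
    ((μ (R.dist + v) - 1 : ℕ) : ℝ) ≤ ρ ^ Dn.card * l
  relaxed : ∀ v ∈ Dn, ∀ a ∈ A v, a.1 ∉ Dn →
    μ (R.dist + a.1) ≠ 0 ∧ μ (R.dist + a.1) ≤ μ (R.dist + v) + a.2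
  queue : QInv R N (queued R Dn μ) (keys R μ) μ

section Invariant

variable {n b : ℕ} {G : WGraph n} {s : Fin n} {R : Regs} {U N L : ℕ} {ρ : ℝ}
  {Dn : Finset (Fin n)} {A : Fin n → List (Fin n × ℕ)} {μ : ℕ → ℕ}

/-- On a walk to a node that has not been scanned, the first node that has not been scanned has a
good tentative distance. -/
theorem DInv.exists_frontier (hρ : 1 ≤ ρ) (h : DInv G s R U N ρ Dn G.adj μ) {v : Fin n} {l : ℕ}
    (hw : G.Walk s v l) (hv : v ∉ Dn) :
    ∃ w ∉ Dn, μ (R.dist + w) ≠ 0 ∧ ((μ (R.dist + w) - 1 : ℕ) : ℝ) ≤ ρ ^ Dn.card * l := by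
  have hp : (1 : ℝ) ≤ ρ ^ Dn.card := one_le_pow₀ hρ
  induction hw with
  | nil => exact ⟨s, hv, by rw [h.source]; omega, by rw [h.source]; simp⟩
  | @snoc u w l c hu ha ih =>
    have hl : (0 : ℝ) ≤ c := Nat.cast_nonneg c
    by_cases hud : u ∈ Dn
    · have h1 := h.approx u hud l hu
      obtain ⟨h2, h3⟩ := h.relaxed u hud _ ha hv
      have h4 := h.reached u hud
      refine ⟨w, hv, h2, ?_⟩
      have h5 : μ (R.dist + w) - 1 ≤ μ (R.dist + u) - 1 + c := by
        simp only at h3; omega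
      have h6 : ((μ (R.dist + w) - 1 : ℕ) : ℝ) ≤ ((μ (R.dist + u) - 1 : ℕ) : ℝ) + c := by
        exact_mod_cast h5
      push_cast
      nlinarith
    · obtain ⟨x, hx, hx1, hx2⟩ := ih hud
      refine ⟨x, hx, hx1, hx2.trans ?_⟩
      push_cast
      nlinarith

/-- Setting the distance of a node that has been removed from the queue, and reinserting it. -/
theorem wp_setDist (hS : Setting b G R U N L ρ) (h : DInv G s R U N ρ Dn A μ) {v w : Fin n}
    {c d t : ℕ} {ν : ℕ → ℕ} (hv : v ∈ Dn) (hd : μ (R.dist + v) = d + 1) (ha : (w, c) ∈ G.adj v)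
    (hw : w ∉ Dn) (hlt : μ (R.dist + w) = 0 ∨ d + c + 1 < μ (R.dist + w))
    (hν : ∀ i < R.key, ν i = μ i) (hQ : QInv R N (queued R Dn μ \ {w.1}) (keys R μ) ν) :
    wp (do
      store (← add R.dist w) (d + c + 1)
      ApproxVEB.insert R (d + c) w : RAM b Unit) ν t (fun _ μ' t' =>
        DInv G s R U N ρ Dn A μ' ∧ μ' (R.dist + w) = d + c + 1 ∧
        (∀ x ∈ Dn, μ' (R.dist + x) = μ (R.dist + x)) ∧ t' ≤ t + 2 + 300 * (R.level + 1)) := by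
  have l := hS.layout
  have l1 := l.dist_le
  have l2 := l.done_le
  have l3 := l.key_le
  have l4 := l.onext_le
  have l5 := l.oprev_le
  have l6 := l.fits.tab_le
  have l7 := l.fits.end_le
  have hn := h.input.n_eq
  have hc : c ≤ U := hS.weights v _ ha
  have hdU := h.done_le v hv
  have hcard : Dn.card * U ≤ n * U :=
    Nat.mul_le_mul_right U (by simpa using Finset.card_le_univ Dn)
  have hp := hS.lt_pow
  simp (disch := omega) only [↓exec]
  have hQ' : QInv R N (queued R Dn μ \ {w.1}) (keys R μ)
      (Function.update ν (R.dist + w) (d + c + 1)) :=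
    hQ.frame l fun i hi => Function.update_of_ne (by omega) _ _
  refine wp_mono (wp_insert l hQ' (v := w) (x := d + c) (by omega) (by simp) (by omega)) ?_
  rintro _ μ' t' ⟨q1, q2, ht'⟩
  have e1 : μ' (R.dist + w) = d + c + 1 := by
    rw [q2 _ (by omega), Function.update_self]
  have e2 : ∀ i < R.key, i ≠ R.dist + w → μ' i = μ i := fun i i1 i2 => by
    rw [q2 _ i1, Function.update_of_ne i2, hν i i1]
  have e3 : ∀ x : Fin n, x ≠ w → μ' (R.dist + x) = μ (R.dist + x) := fun x hx => by
    have : x.1 ≠ w.1 := fun h => hx (Fin.ext h)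
    exact e2 _ (by omega) (by omega)
  have hne : ∀ x ∈ Dn, x ≠ w := fun x hx h => hw (h ▸ hx)
  refine ⟨⟨?_, ?_, ?_, ?_, ?_, ?_, ?_, ?_, ?_, ?_⟩, e1, fun x hx => e3 x (hne x hx), by omega⟩
  · exact h.input.frame fun i hi => e2 i (by omega) (by omega)
  · rw [e3 s, h.source]
    rintro rfl
    have := h.source
    omega
  · intro x hx
    by_cases hxw : x = w
    · subst hxw
      rw [e1]
      have := h.walk v (by omega)
      rw [hd, Nat.add_sub_cancel] at this
      exact WGraph.Walk.snoc this ha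
    · rw [e3 x hxw] at hx ⊢
      exact h.walk x hx
  · intro x
    by_cases hxw : x = w
    · subst hxw; omega
    · rw [e3 x hxw]; exact h.le x
  · intro x hx
    rw [e3 x (hne x hx)]; exact h.done_le x hx
  · intro x
    rw [e2 _ (by omega) (by omega)]; exact h.mark x
  · intro x hx
    rw [e3 x (hne x hx)]; exact h.reached x hx
  · intro x hx
    rw [e3 x (hne x hx)]; exact h.approx x hx
  · intro x hx a haA ha1
    rw [e3 x (hne x hx)]
    have := h.relaxed x hx a haA ha1
    by_cases haw : a.1 = w
    · rw [haw] at this ⊢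
      omega
    · rw [e3 _ haw]; exact this
  · have hset : queued R Dn μ' = (queued R Dn μ \ {w.1}) ∪ {w.1} := by
      ext x
      simp only [queued, Set.mem_union, Set.mem_sdiff, Set.mem_singleton_iff, Set.mem_ofPred_eq]
      by_cases hxw : x = w
      · subst hxw
        simp [e1, hw]
      · constructor
        · rintro ⟨hx, hx1, hx2⟩
          have := e3 ⟨x, hx⟩ (fun h => hxw (congrArg Fin.val h))
          simp only at this
          exact Or.inl ⟨⟨hx, hx1, by rwa [this] at hx2⟩, hxw⟩
        · rintro (⟨⟨hx, hx1, hx2⟩, -⟩ | h)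
          · have := e3 ⟨x, hx⟩ (fun h => hxw (congrArg Fin.val h))
            simp only at this
            exact ⟨hx, hx1, by rwa [this]⟩
          · exact absurd h hxw
    rw [hset]
    refine q1.congr_key fun x hx => ?_
    by_cases hxw : x = w
    · subst hxw
      rw [Function.update_self, keys, e1, Nat.add_sub_cancel]
    · rw [Function.update_of_ne hxw]
      have hxn := q1.lt hx
      have := e3 ⟨x, by omega⟩ (fun h => hxw (congrArg Fin.val h))
      simp only at this
      rw [keys, this, keys]

/-- Relaxing an arc that leaves a scanned node keeps the invariant and makes the arc satisfy the
triangle inequality. It makes at most two queue operations. -/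
theorem wp_relax (hS : Setting b G R U N L ρ) (h : DInv G s R U N ρ Dn A μ) {v w : Fin n}
    {c d : ℕ} (hv : v ∈ Dn) (hd : μ (R.dist + v) = d + 1) (ha : (w, c) ∈ G.adj v) :
    wp (relax R d w c : RAM b Unit) μ 0 (fun _ μ' t =>
        DInv G s R U N ρ Dn A μ' ∧
        (w ∉ Dn → μ' (R.dist + w) ≠ 0 ∧ μ' (R.dist + w) ≤ d + 1 + c) ∧
        (∀ x ∈ Dn, μ' (R.dist + x) = μ (R.dist + x)) ∧ t ≤ 700 * (R.level + 1)) := by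
  have l := hS.layout
  have l1 := l.dist_le
  have l2 := l.done_le
  have l3 := l.key_le
  have l4 := l.onext_le
  have l5 := l.oprev_le
  have l6 := l.fits.tab_le
  have l7 := l.fits.end_le
  have hn := h.input.n_eq
  have hc : c ≤ U := hS.weights v _ ha
  have hdU := h.done_le v hv
  have hcard : Dn.card * U ≤ n * U :=
    Nat.mul_le_mul_right U (by simpa using Finset.card_le_univ Dn)
  have hp := hS.lt_word
  simp (disch := omega) only [relax, ↓exec]
  rw [h.mark w]
  refine wp_ite (fun hw => ?_) (fun hw => ?_)
  swap
  · simp only [↓exec]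
    have hw' : w ∈ Dn := by
      by_contra h'
      simp [h'] at hw
    exact ⟨h, fun h' => absurd hw' h', fun _ _ => trivial, by omega⟩
  have hw' : w ∉ Dn := by
    intro h'
    simp [h'] at hw
  have hpost : ∀ μ' : ℕ → ℕ, μ' (R.dist + w) = d + c + 1 →
      (w ∉ Dn → μ' (R.dist + w) ≠ 0 ∧ μ' (R.dist + w) ≤ d + 1 + c) := by
    intro μ' h1 _
    omega
  simp (disch := omega) only [↓exec]
  refine wp_ite (fun hold => ?_) (fun hold => ?_)
  · have hQ : QInv R N (queued R Dn μ \ {w.1}) (keys R μ) μ := by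
      have : queued R Dn μ \ {w.1} = queued R Dn μ := by
        apply Set.sdiff_singleton_eq_self
        rintro ⟨-, -, h2⟩
        exact h2 hold
      rw [this]; exact h.queue
    refine wp_mono (wp_setDist (t := 0) hS h hv hd ha hw' (Or.inl hold) (fun _ _ => rfl) hQ) ?_
    rintro _ μ' t' ⟨r1, r2, r3, r4⟩
    exact ⟨r1, hpost μ' r2, r3, by omega⟩
  · simp only [↓exec]
    refine wp_ite (fun hlt => ?_) (fun hlt => ?_)
    · refine wp_call (wp_delete l h.queue (v := w) ⟨w.2, hw', hold⟩) ?_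
      rintro _ ν t₁ ⟨q1, q2, ht₁⟩
      refine wp_mono (wp_setDist (t := 0) hS h hv hd ha hw' (Or.inr hlt) q2 q1) ?_
      rintro _ μ' t' ⟨r1, r2, r3, r4⟩
      exact ⟨r1, hpost μ' r2, r3, by omega⟩
    · simp only [↓exec]
      exact ⟨h, fun _ => ⟨hold, by omega⟩, fun _ _ => trivial, by omega⟩

/-- The list of relaxed arcs while the node `v` is scanned. -/
def during (G : WGraph n) (v : Fin n) (l : List (Fin n × ℕ)) : Fin n → List (Fin n × ℕ) :=
  fun x => if x = v then l else G.adj x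

/-- Scanning the node `v` from its `k`-th arc on. -/
theorem wp_scan (hS : Setting b G R U N L ρ) {v : Fin n} {d cnt k : ℕ} (hv : v ∈ Dn)
    (h : DInv G s R U N ρ Dn (during G v ((G.adj v).take k)) μ)
    (hd : μ (R.dist + v) = d + 1) (hk : k + cnt = (G.adj v).length) :
    wp (scan R d cnt (μ (R.off + v) + k) : RAM b Unit) μ 0 (fun _ μ' t =>
      DInv G s R U N ρ Dn G.adj μ' ∧ t ≤ 710 * (R.level + 1) * cnt + 1) := by
  induction cnt generalizing k μ with
  | zero =>
    have : during G v ((G.adj v).take k) = G.adj := by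
      ext1 x
      unfold during
      split_ifs with hx
      · rw [hx, List.take_of_length_le (by omega)]
      · rfl
    rw [this] at h
    simp only [scan, ↓exec]
    exact ⟨h, by omega⟩
  | succ cnt ih =>
    have hkl : k < (G.adj v).length := by omega
    have l := hS.layout
    have l1 := l.dist_le
    have l2 := l.done_le
    have l3 := l.key_le
    have l4 := l.onext_le
    have l5 := l.oprev_le
    have l6 := l.fits.tab_le
    have l7 := l.fits.end_le
    have l8 := vsz_ge R.beta R.level
    have i1 := h.input.off_le
    have i2 := h.input.tgt_le
    have i3 := h.input.wt_le
    have i4 := h.input.end_le v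
    have hn := h.input.n_eq
    simp (disch := omega) only [scan, ↓exec, h.input.tgt v k hkl, h.input.wt v k hkl]
    refine wp_call (wp_relax hS h hv hd (w := ((G.adj v)[k]).1) (c := ((G.adj v)[k]).2)
      (List.getElem_mem hkl)) ?_
    rintro _ μ' t₁ ⟨r1, r2, r3, ht₁⟩
    simp (disch := omega) only [↓exec]
    have e1 : μ' (R.dist + v) = d + 1 := (r3 v hv).trans hd
    have e2 : μ' (R.off + v) = μ (R.off + v) := by
      rw [r1.input.first, h.input.first]
    have r1' : DInv G s R U N ρ Dn (during G v ((G.adj v).take (k + 1))) μ' := by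
      refine { r1 with relaxed := fun x hx a ha ha1 => ?_ }
      by_cases hxv : x = v
      · subst hxv
        simp only [during, if_true, List.take_add_one, List.getElem?_eq_getElem hkl,
          Option.toList_some, List.mem_append, List.mem_singleton] at ha
        rcases ha with ha | rfl
        · exact r1.relaxed x hx a (by simpa [during] using ha) ha1
        · rw [e1]; exact r2 ha1
      · exact r1.relaxed x hx a (by simpa [during, hxv] using ha) ha1
    have key := ih r1' e1 (by omega)
    rw [e2] at key
    refine wp_mono key ?_
    rintro _ μ'' t₂ ⟨s1, s2⟩
    refine ⟨s1, ?_⟩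
    have : 710 * (R.level + 1) * (cnt + 1) = 710 * (R.level + 1) * cnt + 710 * (R.level + 1) := by
      ring
    omega

/-- Relaxed arcs stay relaxed when `v` joins the scanned nodes, as none of its arcs counts yet. -/
theorem during_nil_relaxed (h : DInv G s R U N ρ Dn G.adj μ) {v : Fin n} {D' : Finset (Fin n)}
    (hD : ∀ x ∈ D', x = v ∨ x ∈ Dn) (hsub : Dn ⊆ D') :
    ∀ x ∈ D', ∀ a ∈ during G v [] x, a.1 ∉ D' →
      μ (R.dist + a.1) ≠ 0 ∧ μ (R.dist + a.1) ≤ μ (R.dist + x) + a.2 := by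
  intro x hx a ha ha1
  by_cases hxv : x = v
  · simp [during, hxv] at ha
  · rw [during, if_neg hxv] at ha
    exact h.relaxed x ((hD x hx).resolve_left hxv) a ha fun h' => ha1 (hsub h')

/-- Marking the minimum of the queue as scanned preserves the invariant: the node `v` that the queue
returns has a distance that exceeds the best distance in the queue by a factor of at most `ρ`. -/
theorem DInv.mark_min (hS : Setting b G R U N L ρ) (h : DInv G s R U N ρ Dn G.adj μ) {v : Fin n}
    (hv : v ∉ Dn) (hv0 : μ (R.dist + v) ≠ 0)
    (hmin : ∀ x ∈ queued R Dn μ, keys R μ v ≤ keys R μ x) {ν : ℕ → ℕ}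
    (hν : ∀ i < R.key, ν i = μ i) (hQ : QInv R N (queued R Dn μ \ {v.1}) (keys R μ) ν) :
    DInv G s R U N ρ (Dn ∪ {v}) (during G v []) (Function.update ν (R.done + v) 1) := by
  have l := hS.layout
  have l1 := l.dist_le
  have l2 := l.done_le
  have hn := h.input.n_eq
  have hone := hS.one_le
  have hcard : (Dn ∪ {v}).card = Dn.card + 1 := by
    rw [Finset.card_union_of_disjoint (by simpa using hv), Finset.card_singleton]
  have hlen : Dn.card ≤ n := by simpa using Finset.card_le_univ Dn
  have hU : Dn.card * U ≤ n * U := Nat.mul_le_mul_right U hlen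
  have e1 : ∀ i < R.done, Function.update ν (R.done + v) 1 i = μ i := fun i hi => by
    rw [Function.update_of_ne (by omega), hν i (by omega)]
  have e2 : ∀ x : Fin n, Function.update ν (R.done + v) 1 (R.dist + x) = μ (R.dist + x) :=
    fun x => e1 _ (by omega)
  have hsc : (Dn.card + 1) * U = Dn.card * U + U := Nat.succ_mul _ _
  refine ⟨?_, ?_, ?_, ?_, ?_, ?_, ?_, ?_, ?_, ?_⟩
  · exact h.input.frame fun i hi => e1 i (by omega)
  · rw [e2]; exact h.source
  · intro x hx
    rw [e2] at hx ⊢; exact h.walk x hx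
  · intro x
    have := h.le x
    rw [e2, hcard]; omega
  · intro x hx
    rw [e2, hcard]
    have := h.le x
    omega
  · intro x
    by_cases hxv : x = v
    · subst hxv; simp
    · have : x.1 ≠ v.1 := fun h => hxv (Fin.ext h)
      rw [Function.update_of_ne (by omega), hν _ (by omega), h.mark x]
      simp [hxv]
  · intro x hx
    rw [e2]
    rcases Finset.mem_union.1 hx with hx | hx
    · exact h.reached x hx
    · rw [Finset.mem_singleton.1 hx]; exact hv0
  · intro x hx k hk
    rw [e2, hcard]
    have hk0 : (0 : ℝ) ≤ k := Nat.cast_nonneg k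
    have hp : (0 : ℝ) ≤ ρ ^ Dn.card := by positivity
    rcases Finset.mem_union.1 hx with hx | hx
    · refine (h.approx x hx k hk).trans ?_
      rw [pow_succ]
      have : ρ ^ Dn.card ≤ ρ ^ Dn.card * ρ := le_mul_of_one_le_right hp hone
      nlinarith
    · obtain rfl := Finset.mem_singleton.1 hx
      obtain ⟨w, hw, hw0, hwl⟩ := h.exists_frontier hone hk hv
      have h1 := hmin w ⟨w.2, hw, hw0⟩
      have h2 := hS.approx _ _ (by have := h.le w; omega) h1
      calc ((μ (R.dist + x) - 1 : ℕ) : ℝ) ≤ ρ * ((μ (R.dist + w) - 1 : ℕ) : ℝ) := h2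
        _ ≤ ρ * (ρ ^ Dn.card * k) := by gcongr
        _ = ρ ^ (Dn.card + 1) * k := by ring
  · have := during_nil_relaxed h (v := v) (D' := Dn ∪ {v})
      (fun x hx => by
        rcases Finset.mem_union.1 hx with hx | hx
        · exact Or.inr hx
        · exact Or.inl (Finset.mem_singleton.1 hx)) Finset.subset_union_left
    intro x hx a ha ha1
    rw [e2, e2]
    exact this x hx a ha ha1
  · have hset : queued R (Dn ∪ {v}) (Function.update ν (R.done + v) 1) =
        queued R Dn μ \ {v.1} := by
      ext x
      simp only [queued, Set.mem_sdiff, Set.mem_singleton_iff, Set.mem_ofPred_eq,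
        Finset.mem_union, Finset.mem_singleton, not_or, Fin.ext_iff]
      constructor
      · rintro ⟨hx, ⟨hx1, hx2⟩, hx3⟩
        have := e2 ⟨x, hx⟩
        simp only at this
        exact ⟨⟨hx, hx1, by rwa [this] at hx3⟩, hx2⟩
      · rintro ⟨⟨hx, hx1, hx3⟩, hx2⟩
        have := e2 ⟨x, hx⟩
        simp only at this
        exact ⟨hx, ⟨hx1, hx2⟩, by rwa [this]⟩
    rw [hset]
    have hQ' : QInv R N (queued R Dn μ \ {v.1}) (keys R μ) (Function.update ν (R.done + v) 1) :=
      hQ.frame l fun i hi => Function.update_of_ne (by omega) _ _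
    refine hQ'.congr_key fun x hx => ?_
    have := e2 ⟨x, hx.1.1⟩
    simp only at this
    rw [keys, this, keys]

/-- The number of arcs that leave nodes outside `Dn`. -/
def remaining (G : WGraph n) (Dn : Finset (Fin n)) : ℕ := ∑ v ∈ Dnᶜ, (G.adj v).length

theorem remaining_union {v : Fin n} (hv : v ∉ Dn) :
    remaining G Dn = remaining G (Dn ∪ {v}) + (G.adj v).length := by
  unfold remaining
  have h : Dnᶜ = (Dn ∪ {v})ᶜ ∪ {v} := by
    ext x
    simp only [Finset.mem_compl, Finset.mem_union, Finset.mem_singleton]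
    by_cases hx : x = v
    · subst hx; simpa using hv
    · simp [hx]
  rw [h, Finset.sum_union (by simp), Finset.sum_singleton]

/-- The main loop ends in a state in which all nodes that have a distance are scanned. Its time is
proportional to the number of remaining iterations and arcs. -/
theorem wp_mainLoop (hS : Setting b G R U N L ρ) {cnt : ℕ} (h : DInv G s R U N ρ Dn G.adj μ)
    (hcnt : cnt + Dn.card = n) :
    wp (mainLoop R cnt : RAM b Unit) μ 0 (fun _ μ' t => ∃ Dn' : Finset (Fin n),
      DInv G s R U N ρ Dn' G.adj μ' ∧ (∀ v ∉ Dn', μ' (R.dist + v) = 0) ∧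
      t ≤ 710 * (R.level + 1) * (cnt + 1 + remaining G Dn)) := by
  induction cnt generalizing Dn μ with
  | zero =>
    have huniv : Dn = Finset.univ := by
      rw [← Finset.card_eq_iff_eq_univ]; simpa using hcnt
    simp only [mainLoop, ↓exec]
    refine ⟨Dn, h, fun v hv => absurd (huniv ▸ Finset.mem_univ v) hv, ?_⟩
    calc 0 + 1 ≤ 710 * (R.level + 1) * 1 := by omega
      _ ≤ _ := Nat.mul_le_mul_left _ (by omega)
  | succ cnt ih =>
    have l := hS.layout
    have l1 := l.dist_le
    have l2 := l.done_le
    have l3 := l.key_le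
    have l4 := l.onext_le
    have l5 := l.oprev_le
    have l6 := l.fits.tab_le
    have l7 := l.fits.end_le
    have l8 := vsz_ge R.beta R.level
    have i1 := h.input.off_le
    have i2 := h.input.tgt_le
    have i3 := h.input.wt_le
    have hn := h.input.n_eq
    simp (disch := omega) only [mainLoop, ↓exec]
    refine wp_call (wp_minimum l h.queue) ?_
    rintro r μ' t₁ ⟨hμ', ht₁, hr⟩
    obtain rfl : μ = μ' := hμ'.symm
    simp (disch := omega) only [↓exec]
    refine wp_ite (fun hr0 => ?_) (fun hr0 => ?_)
    · have hem : queued R Dn μ = ∅ := by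
        rcases hr with ⟨-, hem⟩ | ⟨f, -, hf, -⟩
        · exact hem
        · omega
      simp only [↓exec]
      refine ⟨Dn, h, fun v hv => ?_, ?_⟩
      · by_contra h0
        have : v.1 ∈ queued R Dn μ := ⟨v.2, hv, h0⟩
        rw [hem] at this
        exact absurd this (Set.notMem_empty _)
      · calc _ ≤ 710 * (R.level + 1) * 1 := by omega
          _ ≤ _ := Nat.mul_le_mul_left _ (by omega)
    · obtain ⟨f, hf, rfl, hmin⟩ := hr.resolve_left fun h => hr0 h.1
      obtain ⟨hfn, hfD, hf0⟩ := id hf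
      simp (disch := omega) only [↓exec, Nat.add_sub_cancel]
      refine wp_call (wp_delete l h.queue hf) ?_
      rintro _ ν t₂ ⟨q1, q2, ht₂⟩
      have hD := h.mark_min hS (v := ⟨f, hfn⟩) hfD hf0 hmin q2 q1
      have hoff := hD.input.off ⟨f, hfn⟩
      have hend := hD.input.end_le ⟨f, hfn⟩
      have hf0' := hD.reached ⟨f, hfn⟩ (by simp)
      simp only at hoff hend hf0' hD
      simp (disch := omega) only [↓exec]
      generalize Function.update ν (R.done + f) 1 = μ₂ at *
      rw [hoff, Nat.add_sub_cancel_left]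
      refine wp_call (wp_scan (k := 0) hS (v := ⟨f, hfn⟩)
        (Dn := Dn ∪ {⟨f, hfn⟩}) (by simp) (by rw [List.take_zero]; exact hD)
        (d := μ₂ (R.dist + f) - 1) (by change μ₂ (R.dist + f) = _; omega) (Nat.zero_add _)) ?_
      rintro _ μ₃ t₃ ⟨r1, ht₃⟩
      have hcard : (Dn ∪ {⟨f, hfn⟩}).card = Dn.card + 1 := by
        rw [Finset.card_union_of_disjoint (by simpa using hfD), Finset.card_singleton]
      refine wp_mono (ih r1 (by rw [hcard]; omega)) ?_
      rintro _ μ₄ t₄ ⟨Dn', s1, s2, ht₄⟩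
      refine ⟨Dn', s1, s2, ?_⟩
      rw [remaining_union hfD]
      generalize remaining G (Dn ∪ {⟨f, hfn⟩}) = ρ' at *
      generalize (G.adj ⟨f, hfn⟩).length = dg at *
      have : 710 * (R.level + 1) * (cnt + 1 + 1 + (ρ' + dg)) =
          710 * (R.level + 1) * (cnt + 1 + ρ') + 710 * (R.level + 1) * dg +
          710 * (R.level + 1) := by ring
      omega

end Invariant

/-! ### The setup -/

/-- The space of an instance is at most quadratic in the size of its universe. -/
theorem vsz_le {β : ℕ} (hβ : 1 ≤ β) (j : ℕ) : vsz β j ≤ uni β j * uni β j := by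
  induction j with
  | zero =>
    have : 2 ^ 1 ≤ uni β 0 := Nat.pow_le_pow_right (by norm_num) (by simpa using hβ)
    simp only [vsz]
    nlinarith
  | succ j ih =>
    have h2 : 2 ^ 1 ≤ uni β j :=
      Nat.pow_le_pow_right (by norm_num) (by have : 0 < 2 ^ j := by positivity
                                             nlinarith)
    rw [uni_succ]
    simp only [vsz]
    generalize uni β j = u at *
    have h3 : (u + 1) * vsz β j ≤ (u + 1) * (u * u) := Nat.mul_le_mul_left _ ih
    have h4 : 2 * (u * u) ≤ u * (u * u) := Nat.mul_le_mul_right _ (by omega)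
    have h5 : 2 * (u * (u * u)) ≤ u * (u * (u * u)) := Nat.mul_le_mul_right _ (by omega)
    have h6 : u * u * (u * u) = u * (u * (u * u)) := by ring
    have h7 : 2 * 2 ≤ u * u := Nat.mul_le_mul (by omega) (by omega)
    have h8 : (u + 1) * (u * u) = u * (u * u) + u * u := by ring
    omega

/-- The table of sizes is filled up to the first level whose universe has `nb`-bit numbers. -/
theorem wp_mkLevels {b beta szTab nb cnt j : ℕ} {μ : ℕ → ℕ} (hβ : 1 ≤ beta) (hβb : beta < 2 ^ b)
    (hnb : 4 * nb < b) (hend : szTab + nb < 2 ^ b) (hj : j + cnt = nb)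
    (hT : ∀ i < j, μ (szTab + i) = vsz beta i) (hw : j = 0 ∨ beta * 2 ^ (j - 1) < nb) :
    wp (mkLevels beta szTab nb cnt j (vsz beta j) : RAM b ℕ) μ 0 (fun lev μ' t =>
      (∀ i < lev, μ' (szTab + i) = vsz beta i) ∧
      (∀ i, i < szTab ∨ szTab + nb ≤ i → μ' i = μ i) ∧ nb ≤ beta * 2 ^ lev ∧
      (lev = 0 ∨ beta * 2 ^ (lev - 1) < nb) ∧ lev ≤ nb ∧ j ≤ lev ∧
      t + 20 * j ≤ 20 * lev + 20) := by
  have h2nb : 4 * nb < 2 ^ b := hnb.trans Nat.lt_two_pow_self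
  induction cnt generalizing j μ with
  | zero =>
    simp only [mkLevels, ↓exec]
    have : j < 2 ^ j := Nat.lt_two_pow_self
    have : 1 * 2 ^ j ≤ beta * 2 ^ j := Nat.mul_le_mul_right _ hβ
    exact ⟨hT, fun _ _ => trivial, by omega, hw, by omega, le_rfl, by omega⟩
  | succ cnt ih =>
    have hwb : beta * 2 ^ j < 2 ^ b := by
      rcases hw with rfl | hw
      · simpa using hβb
      · cases j with
        | zero => simpa using hβb
        | succ j =>
          rw [Nat.add_sub_cancel] at hw
          have : beta * 2 ^ (j + 1) = 2 * (beta * 2 ^ j) := by ring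
          omega
    simp (disch := omega) only [mkLevels, ↓exec]
    have e1 : Function.update μ (szTab + j) (vsz beta j) (szTab + j) = vsz beta j :=
      Function.update_self ..
    have e2 : ∀ i, i ≠ szTab + j → Function.update μ (szTab + j) (vsz beta j) i = μ i :=
      fun i hi => Function.update_of_ne hi _ _
    generalize Function.update μ (szTab + j) (vsz beta j) = μ₁ at *
    refine wp_ite (fun h => ?_) (fun h => ?_)
    · have hsz : vsz beta (j + 1) < 2 ^ b := by
        refine (vsz_le hβ _).trans_lt ?_
        rw [uni_succ]
        unfold uni
        rw [← pow_add, ← pow_add]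
        exact Nat.pow_lt_pow_right (by norm_num) (by omega)
      have hsz' : vsz beta (j + 1) = (1 * 2 ^ (beta * 2 ^ j) + 1) * vsz beta j + 2 := by
        simp [vsz, uni]
      have hwp : 1 * 2 ^ (beta * 2 ^ j) + 1 < 2 ^ b := by
        have := vsz_ge beta j
        nlinarith
      have hm : (1 * 2 ^ (beta * 2 ^ j) + 1) * vsz beta j + 2 < 2 ^ b := by omega
      simp (disch := omega) only [↓exec]
      rw [← hsz']
      refine wp_mono (ih (by omega) ?_ (Or.inr (by simpa using h))) ?_
      · intro i hi
        by_cases hij : i = j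
        · rw [hij, e1]
        · rw [e2 _ (by omega), hT i (by omega)]
      · rintro lev μ' t ⟨r1, r2, r3, r4, r5, r6, r7⟩
        refine ⟨r1, fun i hi => ?_, r3, r4, r5, by omega, by omega⟩
        rw [r2 i hi, e2 i (by omega)]
    · simp only [↓exec]
      refine ⟨fun i hi => ?_, fun i hi => e2 i (by omega), by omega, hw, by omega, le_rfl, by omega⟩
      rw [e2 _ (by omega), hT i hi]

/-- The precision that is computed from `n` and the two words of `ε`. -/
def rawPrec (n b e₀ e₁ : ℕ) : ℕ :=
  Nat.log 2 n + 2 + (if e₀ = 0 then b - Nat.log 2 e₁ else 0)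

/-- `precision` computes `rawPrec`. -/
theorem wp_precision {b n e₀ e₁ t : ℕ} {α : Type} {f : ℕ → RAM b α} {μ : ℕ → ℕ}
    {Q : α → (ℕ → ℕ) → ℕ → Prop} (hb : Nat.log 2 n + 2 + b < 2 ^ b)
    (h : ∀ t' ≤ t + 10, wp (f (rawPrec n b e₀ e₁)) μ t' Q) :
    wp (precision n b e₀ e₁ >>= f) μ t Q := by
  rw [wp_bind]
  simp (disch := omega) only [precision, ↓exec]
  unfold rawPrec at h
  refine wp_ite (fun h0 => ?_) (fun h0 => ?_)
  · rw [if_pos h0] at h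
    have := Nat.sub_le b (Nat.log 2 e₁)
    simp (disch := omega) only [↓exec]
    exact h _ (by omega)
  · rw [if_neg h0] at h
    simp only [↓exec]
    exact h _ (by omega)

/-- The registers are laid out for a graph with `n` nodes and `m` arcs, with precision `prec`, `N`
possible images and a table of `nb` sizes. -/
structure LaidOut (b n m prec N nb : ℕ) (R : Regs) : Prop where
  n_eq : R.n = n
  off : R.off = 7
  tgt : R.tgt = n + 8
  wt : R.wt = n + 8 + m
  dist : R.dist = n + 8 + m + m
  done : R.done = R.dist + n
  key : R.key = R.done + n
  onext : R.onext = R.key + n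
  oprev : R.oprev = R.onext + (n + 1)
  szTab : R.szTab = R.oprev + (n + 1)
  dict : R.dict = R.szTab + nb
  bnext : R.bnext = R.dict + N
  bprev : R.bprev = R.bnext + (N + 1)
  root : R.root = R.bprev + (N + 1)
  prec : R.prec = prec
  beta : R.beta = Nat.log 2 b
  level_le : R.level ≤ nb
  le_width : nb ≤ R.beta * 2 ^ R.level
  width_lt : R.level = 0 ∨ R.beta * 2 ^ (R.level - 1) < nb

/-- `setup` lays out the memory and fills the table of sizes, and changes nothing else. -/
theorem wp_setup {b n m U e₀ e₁ p L prec N nb : ℕ} {μ : ℕ → ℕ} (h0 : μ 0 = n) (h1 : μ 1 = m)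
    (h3 : μ 3 = U) (h4 : μ 4 = b) (h5 : μ 5 = e₀) (h6 : μ 6 = e₁)
    (hL : L = Nat.log 2 (n * U) + 1) (hp : p = rawPrec n b e₀ e₁)
    (hprec : prec = if p < L then p else L) (hN : N = L * 2 ^ prec + 1)
    (hnb : nb = Nat.log 2 N + 1) (hnU : n * U < 2 ^ b) (hb : Nat.log 2 n + 2 + b < 2 ^ b)
    (hb2 : 2 ≤ b) (hnb4 : 4 * nb < b) (hLb : L < 2 ^ b)
    (hend : 6 * n + 2 * m + 12 + nb + 3 * N < 2 ^ b) :
    wp (setup : RAM b Regs) μ 0 (fun R μ' t => LaidOut b n m prec N nb R ∧ Tab R R.level μ' ∧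
      (∀ i, i < R.szTab ∨ R.dict ≤ i → μ' i = μ i) ∧ t ≤ 20 * R.level + 100) := by
  have hβ : 1 ≤ Nat.log 2 b := Nat.le_log_of_pow_le (by norm_num) (by simpa using hb2)
  have hβb : Nat.log 2 b < 2 ^ b := (Nat.log_le_self 2 b).trans_lt Nat.lt_two_pow_self
  simp (disch := omega) only [setup, ↓exec, h0, h1, h3, h4, h5, h6]
  rw [← hL]
  refine wp_precision hb fun t₁ ht₁ => ?_
  rw [← hp]
  have rest : ∀ t', t' ≤ 40 → wp (do
      let N ← add (← shl L prec) 1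
      let nb ← add (← msb N) 1
      let beta ← msb b
      let off := 7
      let tgt ← add n 8
      let wt ← add tgt m
      let dist ← add wt m
      let done ← add dist n
      let key ← add done n
      let onext ← add key n
      let oprev ← add onext (← add n 1)
      let szTab ← add oprev (← add n 1)
      let dict ← add szTab nb
      let bnext ← add dict N
      let bprev ← add bnext (← add N 1)
      let root ← add bprev (← add N 1)
      let level ← mkLevels beta szTab nb nb 0 3
      pure (Regs.mk n off tgt wt dist done key onext oprev
        prec beta szTab level dict bnext bprev root) : RAM b Regs) μ t'
      (fun R μ' t => LaidOut b n m prec N nb R ∧ Tab R R.level μ' ∧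
      (∀ i, i < R.szTab ∨ R.dict ≤ i → μ' i = μ i) ∧ t ≤ 20 * R.level + 100) := by
    intro t' ht'
    simp (disch := omega) only [↓exec]
    rw [← hN]
    simp (disch := omega) only [↓exec]
    rw [← hnb]
    have key := wp_mkLevels (b := b) (beta := Nat.log 2 b) (j := 0) (cnt := nb) (μ := μ)
      (szTab := n + 8 + m + m + n + n + n + (n + 1) + (n + 1)) (nb := nb)
      hβ hβb hnb4 (by omega) (by omega) (by omega) (Or.inl rfl)
    refine wp_call key ?_
    rintro lev μ' t₂ ⟨r1, r2, r3, r4, r5, -, r7⟩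
    simp only [↓exec]
    exact ⟨⟨rfl, rfl, rfl, rfl, rfl, rfl, rfl, rfl, rfl, rfl, rfl, rfl, rfl, rfl, rfl, rfl, r5, r3,
      r4⟩, r1, r2, by omega⟩
  simp only [↓exec]
  refine wp_ite (fun hpl => ?_) (fun hpl => ?_)
  · rw [if_pos hpl] at hprec
    subst hprec
    have := rest (t₁ + 1) (by omega)
    simp only [↓exec] at this ⊢
    exact this
  · rw [if_neg hpl] at hprec
    subst hprec
    have := rest (t₁ + 1) (by omega)
    simp only [↓exec] at this ⊢
    exact this

/-! ### The input in memory -/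

section InputMemory

variable {n : ℕ} (G : WGraph n)

theorem arcsUpTo_succ (v : Fin n) : G.arcsUpTo (v + 1) = G.arcsUpTo v ++ G.adj v := by
  simp [WGraph.arcsUpTo, List.take_add_one, List.flatMap_append]

theorem arcsUpTo_prefix {i j : ℕ} (h : i ≤ j) : G.arcsUpTo i <+: G.arcsUpTo j :=
  (List.take_prefix_take_left h).flatMap _

theorem arcsUpTo_length_add_le (v : Fin n) :
    (G.arcsUpTo v).length + (G.adj v).length ≤ G.numArcs := by
  have := (arcsUpTo_prefix G (show v.1 + 1 ≤ n from v.2)).length_le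
  rwa [arcsUpTo_succ, List.length_append] at this

theorem arcsUpTo_getElem (v : Fin n) {k : ℕ} (hk : k < (G.adj v).length)
    (h : (G.arcsUpTo v).length + k < (G.arcsUpTo n).length) :
    (G.arcsUpTo n)[(G.arcsUpTo v).length + k] = (G.adj v)[k] := by
  have hp := arcsUpTo_prefix G (show v.1 + 1 ≤ n from v.2)
  have hl : (G.arcsUpTo v).length + k < (G.arcsUpTo (v + 1)).length := by
    rw [arcsUpTo_succ, List.length_append]; omega
  rw [← hp.getElem hl]
  simp [arcsUpTo_succ]

theorem remaining_empty : remaining G ∅ = G.numArcs := by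
  simp [remaining, WGraph.numArcs, WGraph.arcsUpTo, List.length_flatMap, Fin.sum_univ_def,
    List.take_of_length_le]

variable (s : Fin n) (U b : ℕ) (ε : ℝ)

theorem inputMemory_param {i : ℕ} (hi : i < 7) : inputMemory G s U b ε i =
    [n, G.numArcs, s.1, U, b, ⌊ε⌋₊, ⌊Int.fract ε * 2 ^ b⌋₊].getD i 0 := by
  unfold inputMemory inputWords
  rw [List.append_assoc, List.append_assoc, List.getD_append _ _ _ _ (by simpa using hi)]

theorem inputMemory_off {i : ℕ} (hi : i ≤ n) :
    inputMemory G s U b ε (7 + i) = (G.arcsUpTo i).length := by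
  unfold inputMemory inputWords
  rw [List.append_assoc, List.append_assoc, List.getD_append_right _ _ _ _ (by simp),
    List.getD_append _ _ _ _ (by simp; omega)]
  simp [List.getD_eq_getElem?_getD, Nat.lt_succ_of_le hi]

theorem inputMemory_head {i : ℕ} (hi : i < (G.arcsUpTo n).length) :
    inputMemory G s U b ε (n + 8 + i) = (G.arcsUpTo n)[i].1 := by
  unfold inputMemory inputWords
  rw [List.append_assoc, List.getD_append_right _ _ _ _ (by simp),
    List.getD_append _ _ _ _ (by simp; omega)]
  simp [List.getD_eq_getElem?_getD, hi]

theorem inputMemory_weight {i : ℕ} (hi : i < (G.arcsUpTo n).length) :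
    inputMemory G s U b ε (n + 8 + G.numArcs + i) = (G.arcsUpTo n)[i].2 := by
  unfold inputMemory inputWords
  rw [List.getD_append_right _ _ _ _ (by simp [WGraph.numArcs]; omega)]
  generalize hj : n + 8 + G.numArcs + i - _ = j
  obtain rfl : j = i := by
    rw [← hj]
    simp only [List.length_append, List.length_cons, List.length_nil, List.length_map,
      List.length_range, WGraph.numArcs]
    omega
  simp [List.getD_eq_getElem?_getD, hi]

theorem inputMemory_zero {a : ℕ} (ha : n + 8 + G.numArcs + G.numArcs ≤ a) :
    inputMemory G s U b ε a = 0 := by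
  unfold inputMemory inputWords
  rw [List.getD_eq_default]
  simp only [List.length_append, List.length_cons, List.length_nil, List.length_map,
    List.length_range]
  unfold WGraph.numArcs at ha
  omega

variable {G s U b ε}

/-- The arrays of the input words are where the registers say, if they are untouched. -/
theorem LaidOut.input {prec N nb : ℕ} {R : Regs} (h : LaidOut b n G.numArcs prec N nb R)
    {μ : ℕ → ℕ} (hμ : ∀ i < R.szTab, μ i = inputMemory G s U b ε i) : Input G R μ := by
  obtain ⟨h1, h2, h3, h4, h5, h6, h7, h8, h9, h10, -⟩ := h
  have e1 : ∀ v : Fin n, μ (R.off + v) = (G.arcsUpTo v).length := fun v => by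
    rw [hμ _ (by omega), h2, inputMemory_off _ _ _ _ _ (by omega)]
  refine ⟨h1, e1, by omega, by omega, by omega, fun v => ?_, fun v => ?_, fun v k hk => ?_,
    fun v k hk => ?_⟩
  · rw [e1]; exact arcsUpTo_length_add_le G v
  · rw [e1, hμ _ (by omega), h2, Nat.add_assoc, inputMemory_off _ _ _ _ _ (by omega),
      arcsUpTo_succ, List.length_append]
  · have h0 := arcsUpTo_length_add_le G v
    have h' : (G.arcsUpTo v).length + k < (G.arcsUpTo n).length := by
      unfold WGraph.numArcs at h0; omega
    rw [e1, hμ _ (by omega), h3, inputMemory_head _ _ _ _ _ h', arcsUpTo_getElem G v hk]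
  · have h0 := arcsUpTo_length_add_le G v
    have h' : (G.arcsUpTo v).length + k < (G.arcsUpTo n).length := by
      unfold WGraph.numArcs at h0; omega
    rw [e1, hμ _ (by omega), h4, inputMemory_weight _ _ _ _ _ h', arcsUpTo_getElem G v hk]

end InputMemory

/-! ### The initial state -/

/-- Zero-initialized memory represents the empty set. -/
theorem rep_empty {β j a : ℕ} {μ : ℕ → ℕ} (h : ∀ i, a ≤ i → μ i = 0) : Rep β j a ∅ μ := by
  induction j generalizing a with
  | zero =>
    refine ⟨?_, ?_, by simp, ?_⟩
    · rw [h _ le_rfl]; exact minEnc_empty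
    · rw [h _ (by omega)]; exact maxEnc_empty
    · rw [h _ (by omega)]; simp
  | succ j ih =>
    refine ⟨?_, ?_, by simp, ?_, ?_⟩
    · rw [h _ le_rfl]; exact minEnc_empty
    · rw [h _ (by omega)]; exact maxEnc_empty
    · have : his (uni β j) (core ∅) = ∅ := by simp [his, core]
      rw [this]
      exact ih fun i hi => h i (by omega)
    · intro k _
      have : los (uni β j) k (core ∅) = ∅ := by simp [los, core]
      rw [this]
      exact ih fun i hi => h i (by omega)

/-- Zero-initialized memory represents the empty queue. -/
theorem qInv_empty {b : ℕ} {R : Regs} {N L : ℕ} {K μ : ℕ → ℕ} (hL : Layout b R N L)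
    (hT : Tab R R.level μ) (h0 : ∀ i, R.dict ≤ i → μ i = 0) : QInv R N ∅ K μ := by
  obtain ⟨l1, l2, l3, l4, l5, l6, l7, l8, l9, l10, l11, l12⟩ := hL
  have e : {u : ℕ | (fun _ : ℕ => (0 : ℕ)) u ≠ 0} = ∅ := by simp
  refine ⟨fun v => μ (R.onext + (v + 1)), fun v => μ (R.oprev + (v + 1)), fun _ => 0, fun _ => 0,
    fun _ => 0, fun _ => 0, hT, by simp, by simp, fun _ _ => rfl, fun _ _ => rfl,
    fun u _ => h0 _ (by omega), fun _ _ => rfl, ⟨by simp, by simp, fun _ => Or.inl rfl⟩,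
    fun e _ => h0 _ (by omega), fun e _ _ => h0 _ (by omega), ?_, ?_⟩
  · rw [e]
    refine ⟨fun e _ => ?_, by simp⟩
    simpa using minEnc_empty
  · rw [e]
    exact rep_empty fun i hi => h0 i (by omega)

/-- With the source in the queue and no node scanned, the invariant holds. -/
theorem dInv_init {n b : ℕ} {G : WGraph n} {s : Fin n} {R : Regs} {U N L : ℕ} {ρ : ℝ}
    {μ ν : ℕ → ℕ} (hL : Layout b R N L) (hI : Input G R μ)
    (h0 : ∀ i, R.dist ≤ i → i < R.key → μ i = 0)
    {K : ℕ → ℕ} (hQ : QInv R N (∅ ∪ {s.1}) (Function.update K s (amap R.prec 0)) ν)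
    (hν : ∀ i < R.key, ν i = Function.update μ (R.dist + s) 1 i) :
    DInv G s R U N ρ ∅ G.adj ν := by
  have hn := hI.n_eq
  have l1 := hL.dist_le
  have l2 := hL.done_le
  have es : ν (R.dist + s) = 1 := by rw [hν _ (by omega), Function.update_self]
  have ev : ∀ v : Fin n, v ≠ s → ν (R.dist + v) = 0 := fun v hv => by
    have : v.1 ≠ s.1 := fun h => hv (Fin.ext h)
    rw [hν _ (by omega), Function.update_of_ne (by omega), h0 _ (by omega) (by omega)]
  refine ⟨hI.frame fun i hi => ?_, es, fun v hv => ?_, fun v => ?_, by simp, fun v => ?_, by simp,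
    by simp, by simp, ?_⟩
  · rw [hν _ (by omega), Function.update_of_ne (by omega)]
  · by_cases h : v = s
    · subst h
      rw [es]; exact WGraph.Walk.nil
    · exact absurd (ev v h) hv
  · by_cases h : v = s
    · subst h; rw [es]; simp
    · rw [ev v h]; simp
  · rw [hν _ (by omega), Function.update_of_ne (by omega), h0 _ (by omega) (by omega)]
    simp
  · have e : queued R (∅ : Finset (Fin n)) ν = ∅ ∪ {s.1} := by
      ext x
      simp only [queued, Set.empty_union, Set.mem_ofPred_eq, Set.mem_singleton_iff,
        Finset.notMem_empty, not_false_eq_true, true_and]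
      constructor
      · rintro ⟨hx, hx0⟩
        by_contra hxs
        exact hx0 (ev ⟨x, hx⟩ fun h => hxs (congrArg Fin.val h))
      · rintro rfl
        exact ⟨s.2, by omega⟩
    rw [e]
    refine hQ.congr_key fun v hv => ?_
    obtain rfl : v = s.1 := by simpa using hv
    rw [Function.update_self, keys, es]

/-! ### The choice of the parameters -/

/-- A laid out memory that ends before address `2 ^ b` satisfies the requirements of the queue. The
bound `2 ^ (4 * nb)` for the size of the top instance comes from the minimality of its level. -/
theorem LaidOut.layout {b n m prec N nb L : ℕ} {R : Regs} (h : LaidOut b n m prec N nb R)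
    (hN : N = L * 2 ^ prec + 1) (hnb : nb = Nat.log 2 N + 1) (hb : 2 ≤ b) (hnb4 : 4 * nb < b)
    (hend : 6 * n + 2 * m + 12 + nb + 3 * N + 2 ^ (4 * nb) ≤ 2 ^ b) (hprec : prec + 1 < b) :
    Layout b R N L := by
  obtain ⟨h1, h2, h3, h4, h5, h6, h7, h8, h9, h10, h11, h12, h13, h14, h15, h16, h17, h18, h19⟩ := h
  have hβ : 1 ≤ R.beta := by
    rw [h16]; exact Nat.le_log_of_pow_le (by norm_num) (by simpa using hb)
  have hbits : 2 ^ R.beta ≤ b := by rw [h16]; exact Nat.pow_log_le_self 2 (by omega)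
  have hsz : vsz R.beta R.level ≤ 2 ^ (4 * nb) ∧ uni R.beta R.level < 2 ^ b := by
    rcases h19 with h19 | h19
    · rw [h19]
      constructor
      · calc vsz R.beta 0 ≤ 2 ^ 4 := by simp [vsz]
          _ ≤ _ := Nat.pow_le_pow_right (by norm_num) (by omega)
      · simp only [uni, pow_zero, mul_one]
        exact hbits.trans_lt Nat.lt_two_pow_self
    · obtain hl | ⟨l, hl⟩ : R.level = 0 ∨ ∃ l, R.level = l + 1 := by
        cases R.level with
        | zero => exact Or.inl rfl
        | succ l => exact Or.inr ⟨l, rfl⟩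
      · rw [hl]
        constructor
        · calc vsz R.beta 0 ≤ 2 ^ 4 := by simp [vsz]
            _ ≤ _ := Nat.pow_le_pow_right (by norm_num) (by omega)
        · simp only [uni, pow_zero, mul_one]
          exact hbits.trans_lt Nat.lt_two_pow_self
      · rw [hl, Nat.add_sub_cancel] at h19
        have e : R.beta * 2 ^ (l + 1) = 2 * (R.beta * 2 ^ l) := by ring
        rw [hl]
        constructor
        · refine (vsz_le hβ _).trans ?_
          unfold uni
          rw [← pow_add]
          exact Nat.pow_le_pow_right (by norm_num) (by omega)
        · exact Nat.pow_lt_pow_right (by norm_num) (by omega)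
  have huni : N ≤ uni R.beta R.level := by
    have : N < 2 ^ nb := by rw [hnb]; exact Nat.lt_pow_succ_log_self (by norm_num) _
    exact this.le.trans (Nat.pow_le_pow_right (by norm_num) h18)
  refine ⟨by omega, by omega, by omega, by omega, by omega, by omega, by omega, by omega, by omega,
    ⟨by omega, by omega, hsz.2, hbits⟩, huni, by rw [h15]; exact hN, by omega⟩

/-- Words of `64 * log₂ (n + m + U + 2)` bits suffice for all addresses and parameters. -/
theorem param_bounds {n m U b L prec N nb : ℕ} (hn : 1 ≤ n)
    (hb : 64 * Nat.log 2 (n + m + U + 2) ≤ b) (hL : L = Nat.log 2 (n * U) + 1) (hprec : prec ≤ L)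
    (hN : N = L * 2 ^ prec + 1) (hnb : nb = Nat.log 2 N + 1) :
    64 ≤ b ∧ 4 * nb < b ∧ L + 1 < b ∧ n * U < 2 ^ L ∧ n * U + 1 < 2 ^ b ∧
      Nat.log 2 n + 2 + b < 2 ^ b ∧
      6 * n + 2 * m + 12 + nb + 3 * N + 2 ^ (4 * nb) < 2 ^ b := by
  have hA2 := Nat.lt_pow_succ_log_self (b := 2) (by norm_num) (n + m + U + 2)
  have hl1 : 1 ≤ Nat.log 2 (n + m + U + 2) :=
    Nat.le_log_of_pow_le (by norm_num) (by omega)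
  have hln : Nat.log 2 n ≤ Nat.log 2 (n + m + U + 2) := Nat.log_mono_right (by omega)
  generalize Nat.log 2 (n + m + U + 2) = l at *
  have hnU : n * U < 2 ^ L := by rw [hL]; exact Nat.lt_pow_succ_log_self (by norm_num) _
  have hL2 : L ≤ 2 * l + 2 := by
    by_cases h0 : n * U = 0
    · rw [hL, h0]; simp
    · have : n * U < 2 ^ (2 * l + 2) := by
        have e : 2 ^ (2 * l + 2) = 2 ^ (l + 1) * 2 ^ (l + 1) := by rw [← pow_add]; congr 1; ring
        rw [e]
        exact Nat.mul_lt_mul_of_lt_of_lt (by omega) (by omega)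
      have := Nat.log_lt_of_lt_pow h0 this
      omega
  have hN2 : N ≤ 2 ^ (4 * l + 4) := by
    have h1 : L + 1 ≤ 2 ^ L := Nat.lt_two_pow_self
    have h2 : 2 ^ prec ≤ 2 ^ L := Nat.pow_le_pow_right (by norm_num) hprec
    have h3 : (L + 1) * 2 ^ prec ≤ 2 ^ L * 2 ^ L := Nat.mul_le_mul h1 h2
    have h4 : 2 ^ L * 2 ^ L ≤ 2 ^ (4 * l + 4) := by
      rw [← pow_add]; exact Nat.pow_le_pow_right (by norm_num) (by omega)
    have h5 : 0 < 2 ^ prec := by positivity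
    rw [Nat.succ_mul] at h3
    omega
  have hnb2 : nb ≤ 4 * l + 5 := by
    have := (Nat.log_mono_right (b := 2) hN2).trans_eq (Nat.log_pow (by norm_num) _)
    omega
  have hbb : 2 * b + 2 < 2 ^ b := by
    obtain ⟨c, rfl⟩ : ∃ c, b = c + 2 := ⟨b - 2, by omega⟩
    have : c < 2 ^ c := Nat.lt_two_pow_self
    have e : 2 ^ (c + 2) = 4 * 2 ^ c := by ring
    omega
  refine ⟨by omega, by omega, by omega, hnU, ?_, by omega, ?_⟩
  · have : 2 ^ (L + 1) ≤ 2 ^ b := Nat.pow_le_pow_right (by norm_num) (by omega)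
    have : 0 < 2 ^ L := by positivity
    rw [pow_succ] at *
    omega
  · have e1 : 2 ^ (4 * nb) ≤ 2 ^ (16 * l + 20) := Nat.pow_le_pow_right (by norm_num) (by omega)
    have e2 : 2 ^ (16 * l + 22) ≤ 2 ^ b := Nat.pow_le_pow_right (by norm_num) (by omega)
    have e3 : nb < 2 ^ nb := Nat.lt_two_pow_self
    have e4 : 2 ^ nb ≤ 2 ^ (4 * l + 5) := Nat.pow_le_pow_right (by norm_num) (by omega)
    have e5 : 2 ^ (16 * l + 22) = 4 * 2 ^ (16 * l + 20) := by ring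
    have e6 : 2 ^ (4 * l + 5) = 2 * 2 ^ (4 * l + 4) := by ring
    have e7 : 2 ^ (4 * l + 4) = 8 * (2 ^ (l + 1) * 2 ^ (3 * l)) := by
      rw [← pow_add, show 4 * l + 4 = 3 + (l + 1 + 3 * l) by ring, pow_add]; rfl
    have e8 : 2 ^ (l + 1) * 1 ≤ 2 ^ (l + 1) * 2 ^ (3 * l) :=
      Nat.mul_le_mul_left _ Nat.one_le_two_pow
    have e9 : 2 ^ (4 * l + 7) ≤ 2 ^ (16 * l + 20) :=
      Nat.pow_le_pow_right (by norm_num) (by omega)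
    have e10 : 2 ^ (4 * l + 7) = 8 * 2 ^ (4 * l + 4) := by ring
    omega

/-- The words of `ε` determine `ε` up to rounding, and hence its precision up to a constant. -/
theorem rawPrec_bounds {n b : ℕ} {ε : ℝ} (hn : 1 ≤ n) (hε : 0 < ε) (hε2 : ε ≤ 2) :
    (rawPrec n b ⌊ε⌋₊ ⌊Int.fract ε * 2 ^ b⌋₊ < b →
      2 * n ≤ ε * 2 ^ rawPrec n b ⌊ε⌋₊ ⌊Int.fract ε * 2 ^ b⌋₊) ∧
    ε * 2 ^ rawPrec n b ⌊ε⌋₊ ⌊Int.fract ε * 2 ^ b⌋₊ ≤ 8 * n := by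
  have h1 : (2 : ℝ) ^ Nat.log 2 n ≤ n := by exact_mod_cast Nat.pow_log_le_self 2 (by omega)
  have h2 : (n : ℝ) ≤ 2 ^ (Nat.log 2 n + 1) := by
    exact_mod_cast (Nat.lt_pow_succ_log_self (b := 2) (by norm_num) n).le
  rw [pow_succ] at h2
  unfold rawPrec
  have hpos : (0 : ℝ) < 2 ^ Nat.log 2 n := by positivity
  split_ifs with h0
  · have hfr : Int.fract ε = ε := by
      rw [Int.fract_eq_self]
      exact ⟨hε.le, by simpa using Nat.floor_eq_zero.1 h0⟩
    have hlt : ε < 1 := Nat.floor_eq_zero.1 h0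
    rw [hfr]
    have hb : (0 : ℝ) < 2 ^ b := by positivity
    have f1 : (⌊ε * 2 ^ b⌋₊ : ℝ) ≤ ε * 2 ^ b := Nat.floor_le (by positivity)
    have f2 : ε * 2 ^ b < ⌊ε * 2 ^ b⌋₊ + 1 := Nat.lt_floor_add_one _
    generalize ⌊ε * 2 ^ b⌋₊ = e at *
    by_cases he : e = 0
    · subst he
      simp only [Nat.log_zero_right, Nat.sub_zero, Nat.cast_zero, zero_add] at *
      refine ⟨fun h => absurd h (by omega), ?_⟩
      rw [pow_add, pow_add]
      nlinarith
    · have g1 : (2 : ℝ) ^ Nat.log 2 e ≤ e := by exact_mod_cast Nat.pow_log_le_self 2 he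
      have g2 : (e : ℝ) + 1 ≤ 2 ^ (Nat.log 2 e + 1) := by
        exact_mod_cast Nat.lt_pow_succ_log_self (b := 2) (by norm_num) e
      have g3 : Nat.log 2 e ≤ b := by
        have : e < 2 ^ b := by
          have : (e : ℝ) < 2 ^ b := by nlinarith
          exact_mod_cast this
        exact (Nat.log_lt_of_lt_pow he this).le
      have g4 : (2 : ℝ) ^ b = 2 ^ (b - Nat.log 2 e) * 2 ^ Nat.log 2 e := by
        rw [← pow_add]; congr 1; omega
      rw [pow_succ] at g2
      rw [g4] at f1 f2
      have gp : (0 : ℝ) < 2 ^ Nat.log 2 e := by positivity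
      have k1 : 1 ≤ ε * 2 ^ (b - Nat.log 2 e) := by
        by_contra hk
        push Not at hk
        nlinarith
      have k2 : ε * 2 ^ (b - Nat.log 2 e) ≤ 2 := by
        by_contra hk
        push Not at hk
        nlinarith
      rw [pow_add, pow_add]
      generalize (2 : ℝ) ^ (b - Nat.log 2 e) = z at *
      generalize (2 : ℝ) ^ Nat.log 2 n = y at *
      have e1 : ε * (y * 2 ^ 2 * z) = (ε * z) * (4 * y) := by ring
      rw [e1]
      exact ⟨fun _ => by nlinarith, by nlinarith⟩
  · have hge : 1 ≤ ε := by
      by_contra h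
      exact h0 (Nat.floor_eq_zero.2 (by linarith))
    rw [Nat.add_zero, pow_add]
    exact ⟨fun _ => by nlinarith, by nlinarith⟩

/-- Distances with comparable images are comparable up to the factor `1 + ε / (2 * n)`: either the
precision is high enough, or it is so high that the map is injective. -/
theorem approx_factor {n U b L p prec : ℕ} {ε : ℝ} (hn : 1 ≤ n) (hε : 0 < ε) (hε2 : ε ≤ 2)
    (hL : n * U < 2 ^ L) (hLb : L ≤ b) (hp : p = rawPrec n b ⌊ε⌋₊ ⌊Int.fract ε * 2 ^ b⌋₊)
    (hprec : prec = if p < L then p else L) {x y : ℕ} (hy : y ≤ n * U)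
    (hxy : amap prec x ≤ amap prec y) : (x : ℝ) ≤ (1 + ε / (2 * n)) * y := by
  have hn' : (0 : ℝ) < n := by exact_mod_cast hn
  have hδ : 0 ≤ ε / (2 * n) := by positivity
  have hy0 : (0 : ℝ) ≤ y := Nat.cast_nonneg y
  rcases le_of_amap_le hxy with h | ⟨h1, h2⟩
  · have : (x : ℝ) ≤ y := by exact_mod_cast h
    nlinarith
  · by_cases hy1 : y = 0
    · subst hy1
      have : x = 0 := by simpa using h2
      subst this
      simp
    have hlog : Nat.log 2 y < L := Nat.log_lt_of_lt_pow hy1 (by omega)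
    have hpp : prec = p ∧ p < L := by
      split_ifs at hprec with h
      · exact ⟨hprec, h⟩
      · omega
    obtain ⟨rfl, hpL⟩ := hpp
    have h3 := (rawPrec_bounds (b := b) hn hε hε2).1 (by omega)
    rw [← hp] at h3
    have h4 : (2 : ℝ) ^ prec * x ≤ (2 ^ prec + 1) * y := by exact_mod_cast h2
    have hq : (0 : ℝ) < 2 ^ prec := by positivity
    have h5 : 1 ≤ ε / (2 * n) * 2 ^ prec := by
      rw [div_mul_eq_mul_div, le_div_iff₀ (by positivity)]; linarith
    by_contra hc
    push Not at hc
    nlinarith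

/-- The error accumulates to at most `1 + ε` over `n` scans. -/
theorem pow_factor_le {n k : ℕ} {ε : ℝ} (hn : 1 ≤ n) (hk : k ≤ n) (hε : 0 < ε) (hε2 : ε ≤ 2) :
    (1 + ε / (2 * n)) ^ k ≤ 1 + ε := by
  have hn' : (0 : ℝ) < n := by exact_mod_cast hn
  have h1 : (1 + ε / (2 * n)) ^ k ≤ (1 + ε / (2 * n)) ^ n :=
    pow_le_pow_right₀ (by have : 0 ≤ ε / (2 * n) := by positivity
                          linarith) hk
  have h2 : (1 + ε / (2 * n)) ^ n ≤ Real.exp (ε / (2 * n)) ^ n :=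
    pow_le_pow_left₀ (by positivity) (by have := Real.add_one_le_exp (ε / (2 * n)); linarith) n
  have h3 : Real.exp (ε / (2 * n)) ^ n = Real.exp (ε / 2) := by
    rw [← Real.exp_nat_mul]; congr 1; field_simp
  -- `exp` is convex, so it lies below its chord on `[0, 1]`
  have h4 := convexOn_exp.2 (Set.mem_univ (0 : ℝ)) (Set.mem_univ (1 : ℝ))
    (show 0 ≤ 1 - ε / 2 by linarith) (show 0 ≤ ε / 2 by positivity) (by ring)
  simp only [smul_eq_mul, mul_zero, mul_one, zero_add, Real.exp_zero] at h4
  have h5 := Real.exp_one_lt_three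
  nlinarith

/-- The level of the top instance is at most logarithmic in `log (2 n / ε) / log log U`. -/
theorem level_le {n m U b L prec N nb beta level : ℕ} {ε : ℝ} (hn : 1 ≤ n) (hε : 0 < ε)
    (hε2 : ε ≤ 2) (hb : 64 * Real.logb 2 (n + m + U + 2) ≤ b) (hbeta : beta = Nat.log 2 b)
    (hLb : L < b) (hprec : prec ≤ rawPrec n b ⌊ε⌋₊ ⌊Int.fract ε * 2 ^ b⌋₊)
    (hN : N = L * 2 ^ prec + 1) (hnb : nb = Nat.log 2 N + 1)
    (hlev : level = 0 ∨ beta * 2 ^ (level - 1) < nb) :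
    (level : ℝ) + 1 ≤
      4 * Real.logb 2 (2 + Real.logb 2 (2 * n / ε) / Real.logb 2 (Real.logb 2 (U + 4))) := by
  have hn' : (1 : ℝ) ≤ n := by exact_mod_cast hn
  have hm0 : (0 : ℝ) ≤ m := Nat.cast_nonneg m
  have hU0 : (0 : ℝ) ≤ U := Nat.cast_nonneg U
  have hlg : 0 ≤ Real.logb 2 (2 * n / ε) :=
    Real.logb_nonneg (by norm_num) (by rw [le_div_iff₀ hε]; linarith)
  have hlu : 2 ≤ Real.logb 2 ((U : ℝ) + 4) := by
    rw [Real.le_logb_iff_rpow_le (by norm_num) (by positivity)]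
    norm_num
  have hll : 1 ≤ Real.logb 2 (Real.logb 2 ((U : ℝ) + 4)) := by
    rw [Real.le_logb_iff_rpow_le (by norm_num) (by linarith)]
    simpa using hlu
  have hx : 0 ≤ Real.logb 2 (2 * n / ε) / Real.logb 2 (Real.logb 2 ((U : ℝ) + 4)) := by positivity
  have hone : 1 ≤ Real.logb 2
      (2 + Real.logb 2 (2 * n / ε) / Real.logb 2 (Real.logb 2 ((U : ℝ) + 4))) := by
    rw [Real.le_logb_iff_rpow_le (by norm_num) (by positivity)]
    simpa using hx
  rcases hlev with rfl | hlev
  · push_cast; linarith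
  by_cases hl0 : level = 0
  · subst hl0; push_cast; linarith
  -- `log₂ log₂ U` is at most `beta + 1`
  have hA : 1 ≤ Real.logb 2 ((n : ℝ) + m + U + 2) := by
    rw [Real.le_logb_iff_rpow_le (by norm_num) (by positivity)]
    norm_num; linarith
  have hb64 : (64 : ℝ) ≤ b := by linarith
  have hb64' : 64 ≤ b := by exact_mod_cast hb64
  have hbeta6 : 6 ≤ beta := by
    rw [hbeta]; exact Nat.le_log_of_pow_le (by norm_num) (by simpa using hb64')
  have hbeta6' : (6 : ℝ) ≤ beta := by exact_mod_cast hbeta6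
  have hbb : b < 2 ^ (beta + 1) := by
    rw [hbeta]; exact Nat.lt_pow_succ_log_self (by norm_num) _
  have hlub : Real.logb 2 ((U : ℝ) + 4) ≤ b := by
    have : Real.logb 2 ((U : ℝ) + 4) ≤ Real.logb 2 (((n : ℝ) + m + U + 2) ^ 2) :=
      Real.logb_le_logb_of_le (by norm_num) (by positivity) (by nlinarith)
    rw [Real.logb_pow] at this
    push_cast at this
    linarith
  have hllb : Real.logb 2 (Real.logb 2 ((U : ℝ) + 4)) ≤ beta + 1 := by
    rw [Real.logb_le_iff_le_rpow (by norm_num) (by linarith)]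
    have h : (b : ℝ) ≤ 2 ^ (beta + 1) := by exact_mod_cast hbb.le
    have e : (2 : ℝ) ^ ((beta : ℝ) + 1) = 2 ^ (beta + 1) := by
      rw [← Real.rpow_natCast]; push_cast; rfl
    rw [e]; linarith
  -- the precision is at most `log₂ (2 n / ε) + 2`
  have hp : (prec : ℝ) ≤ Real.logb 2 (2 * n / ε) + 2 := by
    have h1 := (rawPrec_bounds (b := b) hn hε hε2).2
    have h2 : (2 : ℝ) ^ prec ≤ 2 ^ rawPrec n b ⌊ε⌋₊ ⌊Int.fract ε * 2 ^ b⌋₊ :=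
      pow_le_pow_right₀ (by norm_num) hprec
    have h3 : (2 : ℝ) ^ prec ≤ 2 * n / ε * 2 ^ 2 := by
      rw [div_mul_eq_mul_div, le_div_iff₀ hε]
      nlinarith
    have h4 : (prec : ℝ) = Real.logb 2 (2 ^ prec) := by
      rw [Real.logb_pow, Real.logb_self_eq_one (by norm_num), mul_one]
    have h5 : Real.logb 2 (2 * n / ε * 2 ^ 2) = Real.logb 2 (2 * n / ε) + 2 := by
      rw [Real.logb_mul (by positivity) (by norm_num), Real.logb_pow,
        Real.logb_self_eq_one (by norm_num)]
      norm_num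
    rw [h4, ← h5]
    exact Real.logb_le_logb_of_le (by norm_num) (by positivity) h3
  have hnb2 : nb ≤ beta + prec + 1 := by
    have h1 : N < 2 ^ (beta + 1 + prec) := by
      rw [pow_add]
      have : (L + 1) * 2 ^ prec ≤ b * 2 ^ prec := Nat.mul_le_mul_right _ hLb
      have h2 : b * 2 ^ prec < 2 ^ (beta + 1) * 2 ^ prec :=
        Nat.mul_lt_mul_of_pos_right hbb (by positivity)
      have : 0 < 2 ^ prec := by positivity
      rw [Nat.succ_mul] at *
      omega
    have := Nat.log_lt_of_lt_pow (by omega) h1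
    omega
  obtain ⟨l, rfl⟩ : ∃ l, level = l + 1 := ⟨level - 1, by omega⟩
  rw [Nat.add_sub_cancel] at hlev
  have h1 : (beta : ℝ) * 2 ^ l ≤ beta + prec := by
    have : beta * 2 ^ l ≤ beta + prec := by omega
    exact_mod_cast this
  set lg := Real.logb 2 (2 * n / ε)
  set ll := Real.logb 2 (Real.logb 2 ((U : ℝ) + 4))
  have h2 : (2 : ℝ) ^ l ≤ 2 * (2 + lg / ll) := by
    have h3 : lg / ll * ll = lg := div_mul_cancel₀ _ (by positivity)
    have h4 : lg ≤ lg / ll * (beta + 1) := by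
      calc lg = lg / ll * ll := h3.symm
        _ ≤ _ := mul_le_mul_of_nonneg_left hllb hx
    generalize lg / ll = q at *
    by_contra hc
    push Not at hc
    nlinarith
  have h3 : (l : ℝ) ≤ 1 + Real.logb 2 (2 + lg / ll) := by
    have h4 : (l : ℝ) = Real.logb 2 (2 ^ l) := by
      rw [Real.logb_pow, Real.logb_self_eq_one (by norm_num), mul_one]
    have h5 : Real.logb 2 (2 * (2 + lg / ll)) = 1 + Real.logb 2 (2 + lg / ll) := by
      rw [Real.logb_mul (by norm_num) (by positivity), Real.logb_self_eq_one (by norm_num)]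
    rw [h4, ← h5]
    exact Real.logb_le_logb_of_le (by norm_num) (by positivity) h2
  push_cast
  linarith

/-! ### Dijkstra's algorithm -/

/-- At the end the invariant holds for a set `Dn` of scanned nodes outside of which no node has a
distance. -/
theorem wp_dijkstra {n b U : ℕ} {G : WGraph n} {s : Fin n} {ε : ℝ} (hG : G.WeightsLE U)
    (hε : 0 < ε) (hε2 : ε ≤ 2) (hb : 64 * Real.logb 2 (n + G.numArcs + U + 2) ≤ b) :
    wp (dijkstra b) (inputMemory G s U b ε) 0 (fun _ μ t => ∃ (R : Regs) (N : ℕ)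
      (Dn : Finset (Fin n)), DInv G s R U N (1 + ε / (2 * n)) Dn G.adj μ ∧
      (∀ v ∉ Dn, μ (R.dist + v) = 0) ∧ R.dist = n + 8 + G.numArcs + G.numArcs ∧
      (R.level : ℝ) + 1 ≤
        4 * Real.logb 2 (2 + Real.logb 2 (2 * n / ε) / Real.logb 2 (Real.logb 2 (U + 4))) ∧
      t ≤ 2000 * (R.level + 1) * (n + G.numArcs)) := by
  have hn : 1 ≤ n := s.pos
  have hb' : 64 * Nat.log 2 (n + G.numArcs + U + 2) ≤ b := by
    have h := Real.natLog_le_logb (n + G.numArcs + U + 2) 2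
    push_cast at h
    have : (64 * Nat.log 2 (n + G.numArcs + U + 2) : ℝ) ≤ b := by linarith
    exact_mod_cast this
  obtain ⟨L, hL⟩ : ∃ L, L = Nat.log 2 (n * U) + 1 := ⟨_, rfl⟩
  obtain ⟨p, hp⟩ : ∃ p, p = rawPrec n b ⌊ε⌋₊ ⌊Int.fract ε * 2 ^ b⌋₊ := ⟨_, rfl⟩
  obtain ⟨prec, hprec⟩ : ∃ prec, prec = if p < L then p else L := ⟨_, rfl⟩
  obtain ⟨N, hN⟩ : ∃ N, N = L * 2 ^ prec + 1 := ⟨_, rfl⟩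
  obtain ⟨nb, hnb⟩ : ∃ nb, nb = Nat.log 2 N + 1 := ⟨_, rfl⟩
  have hpL : prec ≤ L := by split_ifs at hprec <;> omega
  have hpp : prec ≤ p := by split_ifs at hprec <;> omega
  obtain ⟨c1, c2, c3, c4, c5, c6, c7⟩ := param_bounds hn hb' hL hpL hN hnb
  have hpar : ∀ i < 7, inputMemory G s U b ε i = _ := fun i hi => inputMemory_param G s U b ε hi
  have hs2 : inputMemory G s U b ε 2 = s := hpar 2 (by norm_num)
  have hset := wp_setup (b := b) (n := n) (m := G.numArcs) (U := U) (e₀ := ⌊ε⌋₊)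
    (e₁ := ⌊Int.fract ε * 2 ^ b⌋₊) (μ := inputMemory G s U b ε) (hpar 0 (by norm_num))
    (hpar 1 (by norm_num)) (hpar 3 (by norm_num)) (hpar 4 (by norm_num)) (hpar 5 (by norm_num))
    (hpar 6 (by norm_num)) hL hp hprec hN hnb (by omega) c6 (by omega) c2
    (by have : b < 2 ^ b := Nat.lt_two_pow_self
        omega) ((Nat.le_add_right _ _).trans_lt c7)
  unfold dijkstra
  refine wp_call hset ?_
  rintro R μ t ⟨r1, r2, r3, ht⟩
  have l := r1.layout hN hnb (by omega) c2 c7.le (by omega)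
  have l1 := l.dist_le
  have l2 := l.done_le
  have l3 := l.key_le
  have l4 := l.onext_le
  have l5 := l.oprev_le
  have l6 := l.szTab_le
  have l7 := l.dict_le
  have l8 := l.bnext_le
  have l9 := l.bprev_le
  have l10 := l.fits.end_le
  have rn := r1.n_eq
  have rd := r1.dist
  have hz : ∀ i, R.dist ≤ i → i < R.szTab ∨ R.dict ≤ i → μ i = 0 := fun i h1 h2 => by
    rw [r3 i h2]; exact inputMemory_zero _ _ _ _ _ (by omega)
  have hI : Input G R μ := r1.input (s := s) (U := U) (ε := ε) fun i hi => r3 i (Or.inl hi)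
  have hQ : QInv R N ∅ (fun _ => 0) μ := qInv_empty l r2 fun i hi => hz i (by omega) (Or.inr hi)
  have hS : Setting b G R U N L (1 + ε / (2 * n)) :=
    ⟨l, hG, c4, c5, le_add_of_nonneg_right (by positivity), fun x y hy hxy =>
      approx_factor hn hε hε2 c4 (by omega) hp hprec hy (by rwa [r1.prec] at hxy)⟩
  have hs : μ 2 = s := by rw [r3 2 (Or.inl (by omega)), hs2]
  have hsn := s.2
  simp (disch := omega) only [↓exec, hs]
  have hQ' : QInv R N ∅ (fun _ => 0) (Function.update μ (R.dist + s) 1) :=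
    hQ.frame l fun i hi => Function.update_of_ne (by omega) _ _
  refine wp_call (wp_insert l hQ' (v := s) (x := 0) (by omega) (by simp) (by positivity)) ?_
  rintro _ ν t₁ ⟨q1, q2, ht₁⟩
  have hD : DInv G s R U N (1 + ε / (2 * n)) ∅ G.adj ν :=
    dInv_init l hI (fun i h1 h2 => hz i h1 (Or.inl (by omega))) q1 q2
  refine wp_mono (wp_mainLoop hS (cnt := R.n) hD (by simpa using rn)) ?_
  rintro _ μ' t₂ ⟨Dn, d1, d2, ht₂⟩
  refine ⟨R, N, Dn, d1, d2, rd, ?_, ?_⟩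
  · exact level_le hn hε hε2 hb rfl (show L < b by omega) (hpp.trans hp.le) hN hnb
      (by have := r1.width_lt; rwa [r1.beta] at this)
  · rw [remaining_empty, rn] at ht₂
    have e1 : 710 * (R.level + 1) * (n + 1 + G.numArcs) =
      710 * (R.level + 1) * (n + G.numArcs) + 710 * (R.level + 1) := by ring
    have e2 : (R.level + 1) * 1 ≤ (R.level + 1) * (n + G.numArcs) :=
      Nat.mul_le_mul_left _ (by omega)
    have e3 : ∀ c, c * (R.level + 1) * (n + G.numArcs) =
      c * ((R.level + 1) * (n + G.numArcs)) := fun c => Nat.mul_assoc ..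
    rw [e1, e3] at ht₂
    rw [e3]
    omega

end ApproxVEB

open ApproxVEB in
theorem theorem2 :
    ∃ κ C : ℕ, ∀ (n : ℕ) (G : ApproxVEB.WGraph n) (U : ℕ) (s : Fin n) (ε : ℝ) (b : ℕ),
      G.WeightsLE U → 0 < ε → ε ≤ 2 →
      κ * Real.logb 2 (n + G.numArcs + U + 2) ≤ b →
      (∀ v : Fin n,
        (∀ d : ℕ, G.IsDist s v d → ∃ d' : ℕ,
          ApproxVEB.outputWord G v
            ((ApproxVEB.dijkstra b).memory (ApproxVEB.inputMemory G s U b ε)) = d' + 1 ∧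
          d ≤ d' ∧ (d' : ℝ) ≤ (1 + ε) * d) ∧
        ((¬ ∃ l : ℕ, G.Walk s v l) →
          ApproxVEB.outputWord G v
            ((ApproxVEB.dijkstra b).memory (ApproxVEB.inputMemory G s U b ε)) = 0)) ∧
      ((ApproxVEB.dijkstra b).time (ApproxVEB.inputMemory G s U b ε) : ℝ) ≤
        C * (n + G.numArcs) *
          Real.logb 2 (2 + Real.logb 2 (2 * n / ε) / Real.logb 2 (Real.logb 2 (U + 4))) := by
  refine ⟨64, 8000, fun n G U s ε b hG hε hε2 hb => ?_⟩
  obtain ⟨R, N, Dn, h1, h2, h3, h4, h5⟩ := wp_dijkstra (s := s) hG hε hε2 (by simpa using hb)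
  -- the clock and the memory in `wp` are those of `time` and `memory`
  change DInv G s R U N _ Dn G.adj ((ApproxVEB.dijkstra b).memory _) at h1
  change ∀ v ∉ Dn, (ApproxVEB.dijkstra b).memory _ (R.dist + v.1) = 0 at h2
  change 0 + (ApproxVEB.dijkstra b).time _ ≤ _ at h5
  generalize (ApproxVEB.dijkstra b).memory _ = μ at *
  generalize (ApproxVEB.dijkstra b).time _ = t at *
  have hn : 1 ≤ n := s.pos
  have ho : ∀ v : Fin n, ApproxVEB.outputWord G v μ = μ (R.dist + v) := fun v => by rw [h3]; rfl
  have hρ : 1 ≤ 1 + ε / (2 * n) := le_add_of_nonneg_right (by positivity)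
  refine ⟨fun v => ⟨fun d hd => ?_, fun hv => ?_⟩, ?_⟩
  · have hvD : v ∈ Dn := by
      by_contra hv
      obtain ⟨w, hw, hw0, -⟩ := h1.exists_frontier hρ hd.1 hv
      exact hw0 (h2 w hw)
    have h0 := h1.reached v hvD
    refine ⟨μ (R.dist + v) - 1, by rw [ho]; omega, hd.2 (h1.walk v h0), ?_⟩
    refine (h1.approx v hvD d hd.1).trans ?_
    exact mul_le_mul_of_nonneg_right
      (pow_factor_le hn (by simpa using Finset.card_le_univ Dn) hε hε2) (Nat.cast_nonneg d)
  · rw [ho]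
    by_contra h0
    exact hv ⟨_, h1.walk v h0⟩
  · have h6 : (t : ℝ) ≤ 2000 * ((R.level : ℝ) + 1) * (n + G.numArcs) := by
      have : t ≤ 2000 * (R.level + 1) * (n + G.numArcs) := by omega
      exact_mod_cast this
    have h7 : (0 : ℝ) ≤ 2000 * ((n : ℝ) + G.numArcs) := by positivity
    push_cast
    nlinarith [mul_le_mul_of_nonneg_left h4 h7]
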